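/- **Theorem.** Let $n\ge 1$, let $0\le v_1\le\dots\le v_{n-1}\le v_n:=w$ be integers (the ranks of the $A_{n-1}$ quiver with one framing of rank $w=\mathbf w_{n-1}$ at the last node, whose Nakajima variety is the cotangent bundle of a type $A$ partial flag variety), put $v_0=0$ and $v'_m=v_m-v_{m-1}$ for $m=1,\dots,n$. Let $q\in\mathbb C$, $0<|q|<1$, $\hbar\in\mathbb C^\times$, $t=q/\hbar$, let $t^{1/2}$ be a square root of $t$, and let $\varphi(x)=\prod_{i\ge 0}(1-q^ix)$. Fix logarithms $\log q$, $\log\zeta_m$ ($1\le m\le n$), $\log a_i$ ($1\le i\le w$), where $a_1,\dots,a_w\in\mathbb C^\times$ are pairwise distinct. Functions of $a$ are regarded as functions of $\log a$, and the shift operator $p_i: a_i\mapsto qa_i$ acts by $\log a_i\mapsto\log a_i+\log q$. For $r\geq 0$ let $$T_r(a)=\sum_{\substack{\mathcal I\subset\{1,\dots,w\}\\|\mathcal I|=r}}\ \prod_{i\in\mathcal I,\,j\notin\mathcal I}\frac{t\,a_i-a_j}{a_i-a_j}\ \prod_{i\in\mathcal I}p_i .$$ Write $s_{n,j}=a_j$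 and $$\mathrm V(a,\zeta)=\frac{e^{\frac{\log\zeta_n\sum_{i=1}^{w}\log a_i}{\log q}}}{2\pi i}\int_C F\ \prod_{m=1}^{n-1}\prod_{i=1}^{v_m}\frac{ds_{m,i}}{s_{m,i}},$$ $$F=\prod_{m=1}^{n-1}\Bigl[\prod_{\substack{i,j=1\\ i\ne j}}^{v_m}\frac{\varphi(s_{m,i}/s_{m,j})}{\varphi(t\,s_{m,i}/s_{m,j})}\ \prod_{i=1}^{v_m}e^{\frac{(\log\zeta_m-\log\zeta_{m+1})\log s_{m,i}}{\log q}}\ \prod_{i=1}^{v_m}\prod_{j=1}^{v_{m+1}}\frac{\varphi(t\,s_{m,i}/s_{m+1,j})}{\varphi(s_{m,i}/s_{m+1,j})}\Bigr].$$ Here $C=\prod_{m,i}C_{m,i}$ is a product of $C^1$-parametrized curves in the planes of the $\log s_{m,i}$. Each $C_{m,i}$ either has both ends at infinity, or is compact, describes a closed curve in the $s_{m,i}$-plane and is such that $e^{(\log\zeta_m-\log\zeta_{m+1})\log s_{m,i}/\log q}$ takes equal values at its two endpoints. The contour is assumed unaffected by $q$-shifts in the following sense: there are $\delta>0$ and $M<\infty$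 such that, whenever the variables in a subset of $\{s_{m,1},\dots,s_{m,v_m}\}$ (for one $m$) are multiplied by $q^u$, $-1\le u\le 1$ (that is, $u\log q$ is added to their logarithms), and then each $\log s_{m,i}$ is translated by a constant of modulus at most $\delta$, no denominator $\varphi(t\,s_{m,i}/s_{m,j})$ $(i\neq j)$, $\varphi(s_{m,i}/s_{m+1,j})$ vanishes on the resulting contour, and the integral of $F$ over it converges absolutely, the integral of the absolute value being at most $M$. Then $\mathrm V$ satisfies the tRS difference equations $$T_r(a)\,\mathrm V(a,\zeta)=t^{r(w-r)/2}\,S_r\,\mathrm V(a,\zeta),\qquad r=1,\dots,w,$$ where $S_r$ is the $r$-th elementary symmetric polynomial of the $w=\sum_m v'_m$ variables $$t^{\frac{v'_m-1}{2}}\hat\zeta_m,\ t^{\frac{v'_m-3}{2}}\hat\zeta_m,\ \dots,\ t^{\frac{1-v'_m}{2}}\hat\zeta_m\quad(m=1,\dots,n),\qquad \hat\zeta_m=t^{\frac{v_m+v_{m-1}-w}{2}}\,\zeta_m ,$$ and all half-integral powers of $t$ are powers of the chosen $t^{1/2}$. -/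

import Mathlib

/-!  Trigonometric Ruijsenaars-Schneider (Macdonald) difference operators and the Mellin-Barnes
integral attached to the cotangent bundle of a type A partial flag variety.

All multiplicative variables are described by their logarithms: `a i = exp (b i)`,
`s m i = exp (y m i)`, `ζ m = exp (ω m)`, `q = exp L`.  In this way the multivalued powers
`exp (log ζ * log s / log q)` are honest functions and `s ↦ q s` is the translation by `L`.

The quiver has `k` gauge nodes.  The dimension vector is `v : Fin (k + 1) → ℕ`: the entries
`v 0, …, v (k - 1)` are the ranks of the gauge nodes and the last entry `v k` is the rank of
the framing. -/

namespace TRS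

open Filter

/-- `φ(x) = ∏_{i ≥ 0} (1 - q ^ i x)`. -/
noncomputable def phi (q x : ℂ) : ℂ := ∏' i : ℕ, (1 - q ^ i * x)

/-- `E(s) = ∏_{i ≠ j} φ(s_i / s_j) / φ(t s_i / s_j)`, where `s_i = exp (y i)`. -/
noncomputable def factorE (q t : ℂ) {d : ℕ} (y : Fin d → ℂ) : ℂ :=
  ∏ i, ∏ j ∈ Finset.univ.erase i,
    phi q (Complex.exp (y i - y j)) / phi q (t * Complex.exp (y i - y j))

/-- `H(s, s') = ∏_{i, j} φ(t s_i / s'_j) / φ(s_i / s'_j)`, where `s_i = exp (y i)` and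
`s'_j = exp (y' j)`. -/
noncomputable def factorH (q t : ℂ) {d d' : ℕ} (y : Fin d → ℂ) (y' : Fin d' → ℂ) : ℂ :=
  ∏ i, ∏ j,
    phi q (t * Complex.exp (y i - y' j)) / phi q (Complex.exp (y i - y' j))

/-- Families indexed by the integration variables `s m i`, `m` a gauge node, `i < v m`. -/
abbrev Vars {k : ℕ} (v : Fin (k + 1) → ℕ) (R : Type) : Type :=
  (m : Fin k) → Fin (v m.castSucc) → R

/-- The integration variables together with the framing variables put at the last node. -/
def withFraming {k : ℕ} {v : Fin (k + 1) → ℕ} (y : Vars v ℂ) (b : Fin (v (Fin.last k)) → ℂ) :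
    (m : Fin (k + 1)) → Fin (v m) → ℂ :=
  Fin.snoc (α := fun m => Fin (v m) → ℂ) y b

/-- The integrand with respect to `∏ ds / s = ∏ dy`. -/
noncomputable def integrand {k : ℕ} (L t : ℂ) (v : Fin (k + 1) → ℕ) (ω : Fin (k + 1) → ℂ)
    (b : Fin (v (Fin.last k)) → ℂ) (y : Vars v ℂ) : ℂ :=
  ∏ m : Fin k,
    (factorE (Complex.exp L) t (y m) *
      (∏ i, Complex.exp ((ω m.castSucc - ω m.succ) * y m i / L)) *
      factorH (Complex.exp L) t (withFraming y b m.castSucc) (withFraming y b m.succ))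

/-- None of the denominators of the integrand vanishes at `y`. -/
def PoleFree {k : ℕ} (L t : ℂ) (v : Fin (k + 1) → ℕ)
    (b : Fin (v (Fin.last k)) → ℂ) (y : Vars v ℂ) : Prop :=
  (∀ (m : Fin k) (i j : Fin (v m.castSucc)), i ≠ j →
    phi (Complex.exp L) (t * Complex.exp (y m i - y m j)) ≠ 0) ∧
  (∀ (m : Fin k) (i : Fin (v m.castSucc)) (j : Fin (v m.succ)),
    phi (Complex.exp L)
      (Complex.exp (withFraming y b m.castSucc i - withFraming y b m.succ j)) ≠ 0)

/-- Contours in the logarithmic plane, as `C¹` maps `γ : ℝ → ℂ` (not necessarily regular, so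
that corners are allowed); the curve in the plane of `s` is `exp ∘ γ`.  Either both ends of
`γ` go to infinity (so that `s` runs from `0` or `∞` to `0` or `∞`), or
`γ` is constant outside `[A, B]` and `exp ∘ γ` is a closed curve on which `s ^ c`, continued
along the curve, returns to its initial value. -/
def IsContour (c : ℂ) (γ : ℝ → ℂ) : Prop :=
  ContDiff ℝ 1 γ ∧
  (Tendsto γ (cocompact ℝ) (cocompact ℂ) ∨
    ∃ A B : ℝ, A ≤ B ∧ (∀ x ≤ A, γ x = γ A) ∧ (∀ x ≥ B, γ x = γ B) ∧
      Complex.exp (γ B) = Complex.exp (γ A) ∧ Complex.exp (c * (γ B - γ A)) = 1)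

/-- The point with parameter `x` of the product contour `γ`, after the variables `s m i`,
`i ∈ K m`, have been multiplied by `q ^ u`, and all logarithms have been perturbed by `η`. -/
noncomputable def shiftedPoint {k : ℕ} {v : Fin (k + 1) → ℕ} (L : ℂ) (γ : Vars v (ℝ → ℂ))
    (K : (m : Fin k) → Finset (Fin (v m.castSucc))) (u : ℝ) (η : Vars v ℂ) (x : Vars v ℝ) :
    Vars v ℂ :=
  fun m i => γ m i (x m i) + (if i ∈ K m then (u : ℂ) * L else 0) + η m i

/-- The Jacobian of the parametrization of the product contour. -/
noncomputable def jacobian {k : ℕ} {v : Fin (k + 1) → ℕ} (γ : Vars v (ℝ → ℂ)) (x : Vars v ℝ) :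
    ℂ :=
  ∏ m, ∏ i, deriv (γ m i) (x m i)

/-- The product contour `γ` is admissible for the framing variables `b`: when any
subset of the variables of one node is shifted, `s ↦ q ^ u s` with `-1 ≤ u ≤ 1`, the contour stays at a
positive distance from the poles of the integrand, and the integral stays absolutely
convergent, with uniform bounds, on the shifted contours and on their small translates. -/
def Admissible {k : ℕ} (L t : ℂ) (v : Fin (k + 1) → ℕ) (ω : Fin (k + 1) → ℂ)
    (b : Fin (v (Fin.last k)) → ℂ) (γ : Vars v (ℝ → ℂ)) : Prop :=
  (∀ m i, IsContour ((ω m.castSucc - ω m.succ) / L) (γ m i)) ∧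
  ∃ δ : ℝ, 0 < δ ∧ ∃ M : ℝ,
    ∀ (m₀ : Fin k) (K : (m : Fin k) → Finset (Fin (v m.castSucc))),
      (∀ m, m ≠ m₀ → K m = ∅) → ∀ u : ℝ, |u| ≤ 1 → ∀ η : Vars v ℂ, (∀ m i, ‖η m i‖ ≤ δ) →
        (∀ x : Vars v ℝ, PoleFree L t v b (shiftedPoint L γ K u η x)) ∧
        MeasureTheory.Integrable (fun x : Vars v ℝ =>
          integrand L t v ω b (shiftedPoint L γ K u η x) * jacobian γ x) ∧
        ∫ x : Vars v ℝ,
          ‖integrand L t v ω b (shiftedPoint L γ K u η x) * jacobian γ x‖ ≤ M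

/-- The function `V(a, ζ)`, in terms of `b = log a` and `ω = log ζ`. -/
noncomputable def V {k : ℕ} (L t : ℂ) (v : Fin (k + 1) → ℕ) (ω : Fin (k + 1) → ℂ)
    (γ : Vars v (ℝ → ℂ)) (b : Fin (v (Fin.last k)) → ℂ) : ℂ :=
  Complex.exp (ω (Fin.last k) * (∑ i, b i) / L) / (2 * Real.pi * Complex.I) *
    ∫ x : Vars v ℝ, integrand L t v ω b (fun m i => γ m i (x m i)) * jacobian γ x

/-- The operator `T_r = ∑_{|I| = r} ∏_{i ∈ I, j ∉ I} (t a_i - a_j) / (a_i - a_j) ∏_{i ∈ I} p_i`,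
acting on functions of `b = log a`; the shift `p_i : a_i ↦ q a_i` is `b_i ↦ b_i + L`. -/
noncomputable def T {w : ℕ} (L t : ℂ) (r : ℕ) (f : (Fin w → ℂ) → ℂ) (b : Fin w → ℂ) : ℂ :=
  ∑ I ∈ Finset.powersetCard r (Finset.univ : Finset (Fin w)),
    (∏ i ∈ I, ∏ j ∈ Iᶜ,
      (t * Complex.exp (b i) - Complex.exp (b j)) / (Complex.exp (b i) - Complex.exp (b j))) *
    f (fun i => if i ∈ I then b i + L else b i)

/-- The rank of the preceding node, with `0` before the first node. -/
def prevRank {k : ℕ} (v : Fin (k + 1) → ℕ) (m : Fin (k + 1)) : ℕ :=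
  Fin.cases (motive := fun _ => ℕ) 0 (fun j => v j.castSucc) m

/-- `v'_m = v_m - v_{m-1}`. -/
def rankDiff {k : ℕ} (v : Fin (k + 1) → ℕ) (m : Fin (k + 1)) : ℕ := v m - prevRank v m

/-- `ζ̂_m = τ ^ (v_m + v_{m-1} - w) ζ_m`, where `w` is the rank of the framing. -/
noncomputable def zetaHat {k : ℕ} (τ : ℂ) (v : Fin (k + 1) → ℕ) (ω : Fin (k + 1) → ℂ)
    (m : Fin (k + 1)) : ℂ :=
  τ ^ ((v m : ℤ) + (prevRank v m : ℤ) - (v (Fin.last k) : ℤ)) * Complex.exp (ω m)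

/-- `S_r`, the `r`-th elementary symmetric polynomial of the variables
`τ ^ (v'_m - 1) z_m, τ ^ (v'_m - 3) z_m, …, τ ^ (1 - v'_m) z_m`, over all nodes `m`. -/
noncomputable def S {k : ℕ} (τ : ℂ) (v : Fin (k + 1) → ℕ) (z : Fin (k + 1) → ℂ) (r : ℕ) : ℂ :=
  ((Finset.univ : Finset (Σ m : Fin (k + 1), Fin (rankDiff v m))).val.map
    (fun p => τ ^ ((rankDiff v p.1 : ℤ) - 1 - 2 * ((p.2 : ℕ) : ℤ)) * z p.1)).esymm r

end TRS

/-!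
The variables of the framing node, and those of every gauge node, carry Macdonald difference
operators `T_r`.  The proof moves `T_r`, acting on the integral in the framing variables, along the
quiver from node to node until it reaches the first node, where it acts on a constant.

**The step.**  The variables `a` of one node and `s` of the preceding node are linked in the
integrand by `∏ φ(t s / a) / φ(s / a)`.  The kernel identity (`kernel_identity`) says that `T_r` in
`a`, applied to this kernel, equals a combination of the formal adjoints of the operators
`T_l`, `l ≤ r`, in `s`, applied to the same kernel.  Multiplying the contours of some of the
variables `s` by `q` is allowed by Cauchy's theorem (`integral_adjointTerm_shift`).  It turns the
adjoint operators into the operators `T_l` themselves, which now act on the remaining factors of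
the integrand, that is, on the kernel that links `s` to the node before it; the powers
`s ^ (log ζ / log q)` contribute a factor for each shifted variable.  Hence the integral is an
eigenfunction of the operators of every node (`sum_integral_nodeIntegrand`).  The eigenvalues obey a
recursion with `t`-binomial coefficients, which by the `q`-binomial theorem is solved by elementary
symmetric polynomials (`eigenvalue_succ`, `eigenvalue_last`).

**The kernel identity.**  For equally many variables `a` and `s` it follows from Cauchy's
determinant: with the matrices `A = (1 / (a_i - t s_k))` and `B = (1 / (a_i - s_k))`, the
coefficient of `u ^ r` in `det (A + u B)` can be expanded along the rows or along the columns, and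
each determinant that occurs is a Cauchy determinant.  The case of fewer variables `s` follows by
letting the other ones tend to zero.

**The contour shift.**  The coefficients of the adjoint operators have poles at `s_i = s_j`, and
these are cancelled by zeros of the integrand (`factorE_mul_coefB`).  Absolute integrability of the
product, for contours that pass through such points, follows from the mean value property: around
each point there is a circle, out of a fixed finite collection, on which the coefficients are
bounded, so that the value of the product at the centre is bounded by an average of the integrand
over this circle (`integrable_of_circle_bound`).  A small translation in the plane of one variable
does not change the integral (`integral_contour_translate`): the difference of the two integrands
is the derivative of the integral `P` of the function over a short segment, and `P` tends to zero
at the ends of a contour that goes to infinity, because `P dγ` is integrable and such a contour has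
infinite length.
-/

namespace TRS

section

open Finset Matrix Polynomial

/-! ### Cauchy matrices -/

/-- The Cauchy matrix with entries `1 / (x i - y j)`. -/
noncomputable def cauchy {n : ℕ} (x y : Fin n → ℂ) : Matrix (Fin n) (Fin n) ℂ :=
  Matrix.of fun i j => (x i - y j)⁻¹

/-- Clearing denominators row by row turns a Cauchy matrix into a Vandermonde matrix times a matrix
that depends on `y` alone: the coefficient matrix of `∏_{k ≠ j} (X - y k)`. -/
lemma exists_det_cauchy_rows {n : ℕ} (y : Fin n → ℂ) :
    ∃ N : ℂ, (Function.Injective y → N ≠ 0) ∧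
      ∀ x : Fin n → ℂ, (∀ i j, x i ≠ y j) →
        (∏ i, ∏ j, (x i - y j)) * (cauchy x y).det = (vandermonde x).det * N := by
  let p : Fin n → ℂ[X] := fun j => ∏ k ∈ univ.erase j, (X - C (y k))
  let A : Matrix (Fin n) (Fin n) ℂ := Matrix.of fun l j => (p j).coeff l
  have hdeg : ∀ j, (p j).natDegree < n := by
    intro j
    have : (p j).natDegree = (univ.erase j).card := by
      simp only [p]
      rw [natDegree_prod_of_monic _ _ (fun k _ => monic_X_sub_C _)]
      simp
    rw [this, card_erase_of_mem (mem_univ j), card_univ, Fintype.card_fin]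
    have := j.pos
    omega
  have hmul : ∀ x : Fin n → ℂ,
      vandermonde x * A = Matrix.of fun i j => ∏ k ∈ univ.erase j, (x i - y k) := by
    intro x
    ext i j
    have h : (p j).eval (x i) = ∏ k ∈ univ.erase j, (x i - y k) := by
      simp [p, eval_prod]
    rw [Matrix.of_apply, ← h, eval_eq_sum_range' (hdeg j), Matrix.mul_apply,
      ← Fin.sum_univ_eq_sum_range (fun l => (p j).coeff l * x i ^ l) n]
    exact Finset.sum_congr rfl fun l _ => by simp [A, vandermonde_apply, mul_comm]
  refine ⟨A.det, fun hy h0 => ?_, fun x hx => ?_⟩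
  · have h1 := congrArg Matrix.det (hmul y)
    have h2 : (Matrix.of fun i j => ∏ k ∈ univ.erase j, (y i - y k)) =
        Matrix.diagonal fun j => ∏ k ∈ univ.erase j, (y j - y k) := by
      ext i j
      by_cases hij : i = j
      · subst hij; simp
      · rw [Matrix.of_apply, Matrix.diagonal_apply_ne _ hij]
        exact Finset.prod_eq_zero (mem_erase.2 ⟨hij, mem_univ _⟩) (sub_self _)
    rw [h2, det_mul, h0, mul_zero, det_diagonal] at h1
    exact (Finset.prod_ne_zero_iff.2 fun j _ => Finset.prod_ne_zero_iff.2 fun k hk =>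
      sub_ne_zero.2 fun h => (mem_erase.1 hk).1 (hy h).symm) h1.symm
  · rw [← det_mul, hmul, ← det_mul_column]
    congr 1
    ext i j
    rw [Matrix.of_apply, Matrix.of_apply, ← Finset.mul_prod_erase _ _ (mem_univ j)]
    simp only [cauchy, Matrix.of_apply]
    have := sub_ne_zero.2 (hx i j)
    field_simp

/-- The column version of `exists_det_cauchy_rows`. -/
lemma exists_det_cauchy_cols {n : ℕ} (x : Fin n → ℂ) :
    ∃ N : ℂ, ∀ y : Fin n → ℂ, (∀ i j, x i ≠ y j) →
        (∏ i, ∏ j, (x i - y j)) * (cauchy x y).det = (vandermonde y).det * N := by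
  obtain ⟨N, -, hN⟩ := exists_det_cauchy_rows x
  refine ⟨(∏ _i : Fin n, ∏ _j : Fin n, (-1)) * ((∏ _i : Fin n, (-1)) * N), fun y hy => ?_⟩
  have h1 : (cauchy x y).det = (∏ _i : Fin n, (-1)) * (cauchy y x).det := by
    rw [← det_transpose, ← det_mul_column]
    congr 1
    ext i j
    simp only [cauchy, Matrix.of_apply, Matrix.transpose_apply]
    rw [← neg_sub, inv_neg]; ring
  have h2 : (∏ i, ∏ j, (x i - y j)) =
      (∏ _i : Fin n, ∏ _j : Fin n, (-1)) * ∏ i, ∏ j, (y i - x j) := by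
    rw [prod_comm, ← prod_mul_distrib]
    refine prod_congr rfl fun i _ => ?_
    rw [← prod_mul_distrib]
    refine prod_congr rfl fun i _ => by ring
  rw [h1, h2]
  linear_combination (∏ _i : Fin n, ∏ _j : Fin n, (-1 : ℂ)) * (∏ _i : Fin n, (-1 : ℂ)) *
    hN y (fun i j => (hy j i).symm)

lemma det_cauchy_ne_zero {n : ℕ} {x y : Fin n → ℂ} (hx : Function.Injective x)
    (hy : Function.Injective y) (hxy : ∀ i j, x i ≠ y j) : (cauchy x y).det ≠ 0 := by
  obtain ⟨N, hN, h⟩ := exists_det_cauchy_rows y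
  intro h0
  have := h x hxy
  rw [h0, mul_zero] at this
  exact mul_ne_zero (det_vandermonde_ne_zero_iff.2 hx) (hN hy) this.symm

/-- Multiplying the variables `x i`, `i ∈ I`, by `t` changes the Vandermonde determinant by
a power of `t` times the coefficient of the Macdonald operator. -/
lemma det_vandermonde_piecewise {n : ℕ} {x : Fin n → ℂ} (hx : Function.Injective x) (t : ℂ)
    (I : Finset (Fin n)) {r : ℕ} (hr : I.card = r) :
    (vandermonde fun i => if i ∈ I then t * x i else x i).det =
      t ^ (r * (r - 1) / 2) * (∏ i ∈ I, ∏ j ∈ Iᶜ, (t * x i - x j) / (x i - x j)) *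
        (vandermonde x).det := by
  -- the quotients of the factors `x j - x i` of the two determinants: a factor `t` for two
  -- indices in `I`, and a factor of the Macdonald coefficient for one index in `I`
  let σ : Fin n → Fin n → ℂ := fun i j =>
    if i ∈ I ∧ j ∈ Iᶜ then (t * x i - x j) / (x i - x j) else 1
  let κ : Fin n → Fin n → ℕ := fun i j => if i ∈ I ∧ j ∈ I then 1 else 0
  have hκ : ∑ i, ∑ j ∈ Ioi i, κ i j = r * (r - 1) / 2 := by
    have h1 := sum_sum_Ioi_add_eq_sum_sum_off_diag κ
    have h2 : ∑ i, ∑ j ∈ Ioi i, (κ j i + κ i j) = 2 * ∑ i, ∑ j ∈ Ioi i, κ i j := by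
      rw [mul_sum]
      refine sum_congr rfl fun i _ => ?_
      rw [mul_sum]
      refine sum_congr rfl fun j _ => ?_
      simp only [κ, and_comm]; ring
    have h3 : ∑ i, ∑ j ∈ ({i}ᶜ : Finset (Fin n)), κ j i = r * (r - 1) := by
      have : ∀ i, ∑ j ∈ ({i}ᶜ : Finset (Fin n)), κ j i = if i ∈ I then r - 1 else 0 := by
        intro i
        by_cases hi : i ∈ I
        · simp only [κ, hi, and_true, if_true]
          rw [← sum_filter, sum_const, smul_eq_mul, mul_one]
          have : ({i}ᶜ : Finset (Fin n)).filter (· ∈ I) = I.erase i := by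
            ext j; simp
          rw [this, card_erase_of_mem hi, hr]
        · simp [κ, hi]
      simp only [this]
      rw [← sum_filter, sum_const, smul_eq_mul]
      simp [hr]
    rw [h2, h3] at h1
    omega
  have hσ : ∏ i, ∏ j ∈ Ioi i, (σ j i * σ i j) =
      ∏ i ∈ I, ∏ j ∈ Iᶜ, (t * x i - x j) / (x i - x j) := by
    rw [prod_prod_Ioi_mul_eq_prod_prod_off_diag]
    have : ∀ i, ∏ j ∈ ({i}ᶜ : Finset (Fin n)), σ j i = ∏ j, σ j i := by
      intro i
      refine prod_subset (subset_univ _) fun j _ hj => ?_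
      have : j = i := by simpa using hj
      subst this
      simp [σ]
    simp only [this]
    rw [prod_comm, ← prod_subset (subset_univ I)]
    · refine prod_congr rfl fun i hi => ?_
      rw [← prod_subset (subset_univ Iᶜ)]
      · exact prod_congr rfl fun j hj => by simp only [σ, hi, hj, and_self, if_true]
      · intro j _ hj
        simp only [σ, hj, and_false, if_false]
    · intro i _ hi
      exact prod_eq_one fun j _ => by simp only [σ, hi, false_and, if_false]
  rw [det_vandermonde, det_vandermonde, ← hσ, ← hκ, ← prod_pow_eq_pow_sum, ← prod_mul_distrib,
    ← prod_mul_distrib]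
  refine prod_congr rfl fun i _ => ?_
  rw [← prod_pow_eq_pow_sum, ← prod_mul_distrib, ← prod_mul_distrib]
  refine prod_congr rfl fun j hj => ?_
  have hij : i ≠ j := (mem_Ioi.1 hj).ne
  have h1 : x i - x j ≠ 0 := sub_ne_zero.2 fun h => hij (hx h)
  have h2 : x j - x i ≠ 0 := sub_ne_zero.2 fun h => hij (hx h).symm
  by_cases hi : i ∈ I <;> by_cases hj : j ∈ I <;> simp [σ, κ, hi, hj] <;> field_simp
  ring

end

section

open Finset Matrix Polynomial

/-! ### The kernel identity -/

/-- Replacing `r` rows of `A` by those of `B`, in all possible ways, gives the same sum of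
determinants as replacing `r` columns: both sums are the coefficient of `u ^ r` in
`det (A + u B)`. -/
lemma sum_det_rows_eq_sum_det_cols {n : ℕ} (A B : Matrix (Fin n) (Fin n) ℂ) (r : ℕ) :
    ∑ I ∈ powersetCard r univ, (Matrix.of fun i j => if i ∈ I then B i j else A i j).det =
      ∑ K ∈ powersetCard r univ, (Matrix.of fun i j => if j ∈ K then B i j else A i j).det := by
  have key : ∀ (A B : Matrix (Fin n) (Fin n) ℂ) (u : ℂ), (u • B + A).det =
      ∑ I : Finset (Fin n),
        u ^ I.card * (Matrix.of fun i j => if i ∈ I then B i j else A i j).det := by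
    intro A B u
    have h := (Matrix.detRowAlternating (n := Fin n) (R := ℂ)).map_add_univ
      (fun i => (u • B) i) (fun i => A i)
    refine Eq.trans h (Finset.sum_congr rfl fun I _ => ?_)
    have h2 : (∏ i, (if i ∈ I then u else 1)) = u ^ I.card := by
      rw [prod_ite_mem, univ_inter, prod_const]
    rw [← h2, ← det_mul_column]
    change Matrix.det _ = _
    congr 1
    ext i j
    by_cases hi : i ∈ I <;> simp [Finset.piecewise, hi]
  have hpoly : (∑ I : Finset (Fin n), X ^ I.card *
        C (Matrix.of fun i j => if i ∈ I then B i j else A i j).det) =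
      ∑ I : Finset (Fin n), X ^ I.card *
        C (Matrix.of fun i j => if j ∈ I then B i j else A i j).det := by
    refine Polynomial.funext fun u => ?_
    simp only [eval_finsetSum, eval_mul, eval_pow, eval_X, eval_C]
    rw [← key, ← det_transpose, transpose_add, transpose_smul, key]
    refine Finset.sum_congr rfl fun I _ => ?_
    rw [← det_transpose (Matrix.of fun i j => if j ∈ I then B i j else A i j)]
    rfl
  have hc := congrArg (fun p : ℂ[X] => p.coeff r) hpoly
  simp only [finsetSum_coeff, coeff_X_pow_mul', coeff_C] at hc
  have conv : ∀ f : Finset (Fin n) → ℂ,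
      (∑ I : Finset (Fin n), if I.card ≤ r then (if r - I.card = 0 then f I else 0) else 0) =
        ∑ I ∈ powersetCard r univ, f I := by
    intro f
    rw [← Finset.sum_subset (subset_univ (powersetCard r univ))]
    · refine Finset.sum_congr rfl fun I hI => ?_
      rw [(mem_powersetCard.1 hI).2]; simp
    · intro I _ hI
      have : I.card ≠ r := fun h => hI (mem_powersetCard.2 ⟨subset_univ _, h⟩)
      split_ifs <;> first | rfl | omega
  rw [conv, conv] at hc
  exact hc

/-- The kernel identity for equally many variables, for generic `t`.  By Cauchy's determinant
formula its two sides are the row and the column replacements of the Cauchy matrix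
`1 / (a i - t s k)` by `1 / (a i - s k)`. -/
lemma kernel_square_generic {n : ℕ} {a s : Fin n → ℂ} (ha : Function.Injective a)
    (hs : Function.Injective s) (has : ∀ i k, a i ≠ s k) {t : ℂ} (ht : t ≠ 0)
    (hat : ∀ i k, a i ≠ t * s k) (r : ℕ) :
    ∑ I ∈ powersetCard r (univ : Finset (Fin n)),
        (∏ i ∈ I, ∏ j ∈ Iᶜ, (t * a i - a j) / (a i - a j)) *
          ∏ i ∈ I, ∏ k, (a i - t * s k) / (a i - s k) =
      ∑ K ∈ powersetCard r (univ : Finset (Fin n)),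
        (∏ k ∈ K, ∏ l ∈ Kᶜ, (s k - t * s l) / (s k - s l)) *
          ∏ k ∈ K, ∏ i, (a i - t * s k) / (a i - s k) := by
  have hts : Function.Injective fun k => t * s k := fun i j h => hs (mul_left_cancel₀ ht h)
  set D := (cauchy a fun k => t * s k).det with hD
  have hD0 : D ≠ 0 := det_cauchy_ne_zero ha hts hat
  -- replacing the rows in `I` amounts, up to a factor `t` for each row, to replacing `a i` by
  -- `t * a i`, so that the result is again a Cauchy matrix
  have hrow : ∀ I ∈ powersetCard r (univ : Finset (Fin n)),
      t ^ (n * r) * (Matrix.of fun i j => if i ∈ I then cauchy a s i j else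
          cauchy a (fun k => t * s k) i j).det =
        t ^ (r + r * (r - 1) / 2) * ((∏ i ∈ I, ∏ j ∈ Iᶜ, (t * a i - a j) / (a i - a j)) *
          ∏ i ∈ I, ∏ k, (a i - t * s k) / (a i - s k)) * D := by
    intro I hI
    have hc := (mem_powersetCard.1 hI).2
    obtain ⟨N, -, hN⟩ := exists_det_cauchy_rows fun k => t * s k
    set a' : Fin n → ℂ := fun i => if i ∈ I then t * a i else a i with ha'
    have hne : ∀ i j, a' i ≠ t * s j := by
      intro i j
      by_cases hi : i ∈ I
      · simpa [ha', hi, ht] using has i j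
      · simpa [ha', hi] using hat i j
    have e1 := hN a' hne
    have e2 := hN a hat
    rw [ha', det_vandermonde_piecewise ha t I hc, ← ha'] at e1
    have e3 : (Matrix.of fun i j => if i ∈ I then cauchy a s i j else
          cauchy a (fun k => t * s k) i j).det = t ^ r * (cauchy a' fun k => t * s k).det := by
      have h2 : (∏ i, (if i ∈ I then t else 1)) = t ^ r := by
        rw [prod_ite_mem, univ_inter, prod_const, hc]
      rw [← h2, ← det_mul_column]
      congr 1
      ext i j
      by_cases hi : i ∈ I
      · simp only [Matrix.of_apply, hi, if_true, cauchy, ha', ← mul_sub, mul_inv]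
        rw [mul_inv_cancel_left₀ ht]
      · simp [hi, cauchy, ha']
    have e4 : (∏ i, ∏ j, (a' i - t * s j)) * ∏ i ∈ I, ∏ k, (a i - t * s k) / (a i - s k) =
        t ^ (n * r) * ∏ i, ∏ j, (a i - t * s j) := by
      have h2 : (∏ i, (if i ∈ I then t ^ n else 1)) = t ^ (n * r) := by
        rw [prod_ite_mem, univ_inter, prod_const, hc, pow_mul]
      have h3 : ∏ i ∈ I, ∏ k, (a i - t * s k) / (a i - s k) =
          ∏ i, if i ∈ I then ∏ k, (a i - t * s k) / (a i - s k) else 1 := by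
        rw [prod_ite_mem, univ_inter]
      rw [← h2, h3, ← prod_mul_distrib, ← prod_mul_distrib]
      refine prod_congr rfl fun i _ => ?_
      by_cases hi : i ∈ I
      · have h4 : (t ^ n : ℂ) = ∏ _k : Fin n, t := by simp
        simp only [hi, if_true, ha']
        rw [h4, ← prod_mul_distrib, ← prod_mul_distrib]
        refine prod_congr rfl fun k _ => ?_
        have := sub_ne_zero.2 (has i k)
        field_simp
      · simp [hi, ha']
    have h5 : (∏ i, ∏ j, (a' i - t * s j)) ≠ 0 :=
      prod_ne_zero_iff.2 fun i _ => prod_ne_zero_iff.2 fun j _ => sub_ne_zero.2 (hne i j)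
    rw [e3]
    refine mul_left_cancel₀ h5 ?_
    calc _ = t ^ (n * r) * t ^ r *
          ((∏ i, ∏ j, (a' i - t * s j)) * (cauchy a' fun k => t * s k).det) := by ring
      _ = t ^ (n * r) * t ^ r * (t ^ (r * (r - 1) / 2) *
          (∏ i ∈ I, ∏ j ∈ Iᶜ, (t * a i - a j) / (a i - a j)) * ((vandermonde a).det * N)) := by
            rw [e1]; ring
      _ = t ^ r * t ^ (r * (r - 1) / 2) * (∏ i ∈ I, ∏ j ∈ Iᶜ, (t * a i - a j) / (a i - a j)) *
          (t ^ (n * r) * ∏ i, ∏ j, (a i - t * s j)) * D := by rw [← e2, ← hD]; ring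
      _ = _ := by rw [← e4, pow_add]; ring
  -- replacing the columns in `K` amounts to removing the factor `t` from `t * s k`
  have hcol : ∀ K ∈ powersetCard r (univ : Finset (Fin n)),
      t ^ (n * r) * (Matrix.of fun i j => if j ∈ K then cauchy a s i j else
          cauchy a (fun k => t * s k) i j).det =
        t ^ (r + r * (r - 1) / 2) * ((∏ k ∈ K, ∏ l ∈ Kᶜ, (s k - t * s l) / (s k - s l)) *
          ∏ k ∈ K, ∏ i, (a i - t * s k) / (a i - s k)) * D := by
    intro K hK
    have hc := (mem_powersetCard.1 hK).2
    have hrn : r ≤ n := by rw [← hc]; simpa using card_le_univ K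
    obtain ⟨N, hN⟩ := exists_det_cauchy_cols a
    set y : Fin n → ℂ := fun k => t * s k with hy
    set y' : Fin n → ℂ := fun k => if k ∈ K then t⁻¹ * y k else y k with hy'
    have hyK : ∀ k ∈ K, y' k = s k := fun k hk => by simp [hy', hy, hk, ht]
    have hyK' : ∀ k ∉ K, y' k = t * s k := fun k hk => by simp [hy', hy, hk]
    have hne : ∀ i j, a i ≠ y' j := by
      intro i j
      by_cases hj : j ∈ K
      · rw [hyK j hj]; exact has i j
      · rw [hyK' j hj]; exact hat i j
    have e1 := hN y' hne
    have e2 := hN y hat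
    rw [hy', det_vandermonde_piecewise hts t⁻¹ K hc, ← hy'] at e1
    have e3 : (Matrix.of fun i j => if j ∈ K then cauchy a s i j else cauchy a y i j) =
        cauchy a y' := by
      ext i j
      by_cases hj : j ∈ K
      · simp [hj, cauchy, hyK j hj]
      · simp [hj, cauchy, hyK' j hj, hy]
    have e4 : (∏ i, ∏ j, (a i - y' j)) * ∏ k ∈ K, ∏ i, (a i - t * s k) / (a i - s k) =
        ∏ i, ∏ j, (a i - y j) := by
      have h3 : ∏ k ∈ K, ∏ i, (a i - t * s k) / (a i - s k) =
          ∏ k, if k ∈ K then ∏ i, (a i - t * s k) / (a i - s k) else 1 := by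
        rw [prod_ite_mem, univ_inter]
      rw [h3, prod_comm, ← prod_mul_distrib, prod_comm (f := fun i j => a i - y j)]
      refine prod_congr rfl fun k _ => ?_
      by_cases hk : k ∈ K
      · simp only [hk, if_true, hyK]
        rw [← prod_mul_distrib]
        refine prod_congr rfl fun i _ => ?_
        have := sub_ne_zero.2 (has i k)
        field_simp
        simp [hy, mul_comm]
      · simp [hk, hyK', hy]
    have e5 : (∏ k ∈ K, ∏ l ∈ Kᶜ, (s k - t * s l) / (s k - s l)) = t ^ (r * (n - r)) *
        ∏ k ∈ K, ∏ l ∈ Kᶜ, (t⁻¹ * (t * s k) - t * s l) / (t * s k - t * s l) := by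
      have h2 : (t ^ (r * (n - r)) : ℂ) = ∏ k ∈ K, ∏ l ∈ Kᶜ, t := by
        rw [prod_const, prod_const, card_compl, hc, Fintype.card_fin, ← pow_mul, mul_comm]
      rw [h2, ← prod_mul_distrib]
      refine prod_congr rfl fun k hk => ?_
      rw [← prod_mul_distrib]
      refine prod_congr rfl fun l hl => ?_
      rw [inv_mul_cancel_left₀ ht, ← mul_sub, ← div_div, mul_div_assoc', mul_div_cancel₀ _ ht]
    have h5 : (∏ i, ∏ j, (a i - y' j)) ≠ 0 :=
      prod_ne_zero_iff.2 fun i _ => prod_ne_zero_iff.2 fun j _ => sub_ne_zero.2 (hne i j)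
    have hexp : n * r = r * (n - r) + (r * (r - 1) / 2) + (r + r * (r - 1) / 2) := by
      have h6 : r * (r - 1) / 2 + r * (r - 1) / 2 = r * (r - 1) := by
        have := Nat.even_mul_pred_self r
        obtain ⟨m, hm⟩ := this
        omega
      obtain ⟨d, rfl⟩ := Nat.exists_eq_add_of_le hrn
      have h7 : r * (r - 1) + r = r * r := by
        cases r
        · rfl
        · simp; ring
      have h8 : r + d - r = d := by omega
      rw [h8]
      nlinarith
    have hpow : (t : ℂ) ^ (n * r) * t⁻¹ ^ (r * (r - 1) / 2) =
        t ^ (r * (n - r)) * t ^ (r + r * (r - 1) / 2) := by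
      rw [hexp, pow_add, pow_add, inv_pow]
      field_simp
    rw [e3]
    refine mul_left_cancel₀ h5 ?_
    calc _ = t ^ (n * r) * ((∏ i, ∏ j, (a i - y' j)) * (cauchy a y').det) := by ring
      _ = (t ^ (n * r) * t⁻¹ ^ (r * (r - 1) / 2)) *
          (∏ k ∈ K, ∏ l ∈ Kᶜ, (t⁻¹ * (t * s k) - t * s l) / (t * s k - t * s l)) *
            ((vandermonde y).det * N) := by rw [e1]; ring
      _ = t ^ (r + r * (r - 1) / 2) *
          (t ^ (r * (n - r)) *
            ∏ k ∈ K, ∏ l ∈ Kᶜ, (t⁻¹ * (t * s k) - t * s l) / (t * s k - t * s l)) *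
            (∏ i, ∏ j, (a i - y j)) * D := by rw [hpow, ← e2, ← hD]; ring
      _ = _ := by rw [← e5, ← e4]; ring
  have hmain := sum_det_rows_eq_sum_det_cols (cauchy a fun k => t * s k) (cauchy a s) r
  have h := congrArg (fun z => t ^ (n * r) * z) hmain
  simp only [mul_sum] at h
  rw [Finset.sum_congr rfl hrow, Finset.sum_congr rfl hcol] at h
  simp only [← sum_mul, ← mul_sum] at h
  exact mul_left_cancel₀ (pow_ne_zero _ ht) (mul_right_cancel₀ hD0 h)

/-- The kernel identity for equally many variables. -/
lemma kernel_square {n : ℕ} {a s : Fin n → ℂ} (ha : Function.Injective a)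
    (hs : Function.Injective s) (has : ∀ i k, a i ≠ s k) (t : ℂ) (r : ℕ) :
    ∑ I ∈ powersetCard r (univ : Finset (Fin n)),
        (∏ i ∈ I, ∏ j ∈ Iᶜ, (t * a i - a j) / (a i - a j)) *
          ∏ i ∈ I, ∏ k, (a i - t * s k) / (a i - s k) =
      ∑ K ∈ powersetCard r (univ : Finset (Fin n)),
        (∏ k ∈ K, ∏ l ∈ Kᶜ, (s k - t * s l) / (s k - s l)) *
          ∏ k ∈ K, ∏ i, (a i - t * s k) / (a i - s k) := by
  -- both sides are polynomials in `t`, and all but finitely many `t` are generic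
  let B : Finset ℂ := insert 0 (univ.image fun p : Fin n × Fin n => a p.1 / s p.2)
  have hd : Dense ((B : Set ℂ)ᶜ) := B.finite_toSet.countable.dense_compl ℂ
  refine congrFun (Continuous.ext_on (f := fun t : ℂ =>
    ∑ I ∈ powersetCard r (univ : Finset (Fin n)),
        (∏ i ∈ I, ∏ j ∈ Iᶜ, (t * a i - a j) / (a i - a j)) *
          ∏ i ∈ I, ∏ k, (a i - t * s k) / (a i - s k)) (g := fun t : ℂ =>
      ∑ K ∈ powersetCard r (univ : Finset (Fin n)),
        (∏ k ∈ K, ∏ l ∈ Kᶜ, (s k - t * s l) / (s k - s l)) *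
          ∏ k ∈ K, ∏ i, (a i - t * s k) / (a i - s k)) hd (by fun_prop) (by fun_prop) ?_) t
  intro u hu
  have hu' : u ∉ B := hu
  simp only [B, mem_insert, mem_image, mem_univ, true_and, not_or, not_exists, Prod.forall] at hu'
  by_cases h0 : ∀ i k, a i ≠ u * s k
  · exact kernel_square_generic ha hs has hu'.1 h0 r
  · push Not at h0
    obtain ⟨i, k, hik⟩ := h0
    by_cases hk : s k = 0
    · exact absurd (by rw [hik, hk, mul_zero]) (has i k)
    · exact absurd (by rw [hik, mul_div_cancel_right₀ _ hk]) (hu'.2 i k)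

end

section

open Finset Filter Topology

/-- The Gaussian binomial coefficient `[N, p]_t`, defined by the `t`-Pascal rule. -/
noncomputable def gaussBinom (t : ℂ) : ℕ → ℕ → ℂ
  | _, 0 => 1
  | 0, _ + 1 => 0
  | N + 1, p + 1 => t ^ (p + 1) * gaussBinom t N (p + 1) + gaussBinom t N p

lemma gaussBinom_zero_right (t : ℂ) (N : ℕ) : gaussBinom t N 0 = 1 := by
  cases N <;> rfl

lemma gaussBinom_zero_left (t : ℂ) (p : ℕ) (hp : p ≠ 0) : gaussBinom t 0 p = 0 := by
  cases p
  · exact absurd rfl hp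
  · rfl

lemma gaussBinom_succ_succ (t : ℂ) (N p : ℕ) : gaussBinom t (N + 1) (p + 1) =
    t ^ (p + 1) * gaussBinom t N (p + 1) + gaussBinom t N p := rfl

/-- One term of the kernel identity on the side of the variables `S`. -/
noncomputable def kernelTerm {n : ℕ} (t : ℂ) (a : Fin n → ℂ) (S K : Finset ℂ) : ℂ :=
  (∏ x ∈ K, ∏ y ∈ S \ K, (x - t * y) / (x - y)) * ∏ x ∈ K, ∏ i, (a i - t * x) / (a i - x)

/-- The value at `ε` of the side of the variables `S` of the kernel identity, after `ε` has been
added to `S`. -/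
lemma sum_kernelTerm_insert {n : ℕ} (t : ℂ) (a : Fin n → ℂ) (S : Finset ℂ) {ε : ℂ} (hε : ε ∉ S)
    (l : ℕ) :
    ∑ K ∈ powersetCard (l + 1) (insert ε S), kernelTerm t a (insert ε S) K =
      ∑ K ∈ powersetCard (l + 1) S, (∏ x ∈ K, (x - t * ε) / (x - ε)) * kernelTerm t a S K +
      ∑ K ∈ powersetCard l S, ((∏ y ∈ S \ K, (ε - t * y) / (ε - y)) *
        ∏ i, (a i - t * ε) / (a i - ε)) * kernelTerm t a S K := by
  rw [powersetCard_succ_insert hε, sum_union, sum_image]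
  · congr 1
    · refine sum_congr rfl fun K hK => ?_
      have hKS := (mem_powersetCard.1 hK).1
      have hεK : ε ∉ K := fun h => hε (hKS h)
      rw [kernelTerm, kernelTerm, insert_sdiff_of_notMem _ hεK]
      simp only [prod_insert (fun h => hε (Finset.mem_sdiff.1 h).1 : ε ∉ S \ K), prod_mul_distrib]
      ring
    · refine sum_congr rfl fun K hK => ?_
      have hKS := (mem_powersetCard.1 hK).1
      have hεK : ε ∉ K := fun h => hε (hKS h)
      have : insert ε S \ insert ε K = S \ K := by
        ext x
        simp only [Finset.mem_sdiff, mem_insert, not_or]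
        exact ⟨fun h => ⟨h.1.resolve_left h.2.1, h.2.2⟩,
          fun h => ⟨Or.inr h.1, fun hx => hε (hx ▸ h.1), h.2⟩⟩
      rw [kernelTerm, kernelTerm, this, prod_insert hεK, prod_insert hεK]
      ring
  · intro K hK K' hK' h
    have h1 : ε ∉ K := fun h => hε ((mem_powersetCard.1 hK).1 h)
    have h2 : ε ∉ K' := fun h => hε ((mem_powersetCard.1 hK').1 h)
    rw [← erase_insert h1, ← erase_insert h2, h]
  · rw [disjoint_left]
    intro K hK hK'
    obtain ⟨K', -, rfl⟩ := mem_image.1 hK'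
    exact hε ((mem_powersetCard.1 hK).1 (mem_insert_self _ _))

lemma sum_kernelTerm_image {n d : ℕ} (t : ℂ) (a : Fin n → ℂ) {s : Fin d → ℂ}
    (hs : Function.Injective s) (r : ℕ) :
    ∑ K ∈ powersetCard r (univ.map ⟨s, hs⟩), kernelTerm t a (univ.map ⟨s, hs⟩) K =
      ∑ K ∈ powersetCard r (univ : Finset (Fin d)),
        (∏ k ∈ K, ∏ l ∈ Kᶜ, (s k - t * s l) / (s k - s l)) *
          ∏ k ∈ K, ∏ i, (a i - t * s k) / (a i - s k) := by
  rw [powersetCard_map, sum_map]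
  refine sum_congr rfl fun K _ => ?_
  have h : univ.map ⟨s, hs⟩ \ K.map ⟨s, hs⟩ = Kᶜ.map ⟨s, hs⟩ := by
    rw [← Finset.map_sdiff, compl_eq_univ_sdiff]
  simp [kernelTerm, h]

/-- The kernel identity for sets `S` with at most as many elements as there are variables `a`.
Missing elements of `S` are sent to zero one at a time. -/
lemma kernel_finset {n : ℕ} {a : Fin n → ℂ} (ha : Function.Injective a) (ha0 : ∀ i, a i ≠ 0)
    (t : ℂ) (N : ℕ) : ∀ S : Finset ℂ, S.card + N = n → 0 ∉ S → (∀ i, a i ∉ S) → ∀ r : ℕ,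
    ∑ I ∈ powersetCard r (univ : Finset (Fin n)),
        (∏ i ∈ I, ∏ j ∈ Iᶜ, (t * a i - a j) / (a i - a j)) *
          ∏ i ∈ I, ∏ x ∈ S, (a i - t * x) / (a i - x) =
      ∑ l ∈ range (r + 1), t ^ ((S.card - l) * (r - l)) * gaussBinom t N (r - l) *
        ∑ K ∈ powersetCard l S, kernelTerm t a S K := by
  induction N with
  | zero =>
    intro S hS h0 haS r
    have h1 : ∀ l ∈ range r, t ^ ((S.card - l) * (r - l)) * gaussBinom t 0 (r - l) *
        ∑ K ∈ powersetCard l S, kernelTerm t a S K = 0 := by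
      intro l hl
      have : r - l ≠ 0 := by have := mem_range.1 hl; omega
      rw [gaussBinom_zero_left t _ this, mul_zero, zero_mul]
    rw [sum_range_succ, sum_eq_zero h1, zero_add, Nat.sub_self, mul_zero, pow_zero,
      gaussBinom_zero_right, one_mul, one_mul]
    have e : Fin n ≃ S := (Fintype.equivFinOfCardEq (by simpa using hS)).symm
    have hinj : Function.Injective fun k => (e k : ℂ) :=
      Subtype.val_injective.comp e.injective
    have hSe : S = univ.map ⟨fun k => (e k : ℂ), hinj⟩ := by
      ext x
      simp only [Finset.mem_map, mem_univ, true_and, Function.Embedding.coeFn_mk]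
      exact ⟨fun hx => ⟨e.symm ⟨x, hx⟩, by simp⟩, fun ⟨k, hk⟩ => hk ▸ (e k).2⟩
    have := kernel_square ha hinj (fun i k h => haS i (h ▸ (e k).2)) t r
    rw [← sum_kernelTerm_image t a hinj, ← hSe] at this
    rw [← this]
    refine sum_congr rfl fun I _ => ?_
    conv_lhs => rw [hSe]
    simp
  | succ N ih =>
    intro S hS h0 haS r
    set R : ℕ → ℂ := fun l => ∑ K ∈ powersetCard l S, kernelTerm t a S K with hR
    set d := S.card with hd
    -- the two sides of the identity for `insert ε S`, continuous at `ε = 0`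
    let f : ℂ → ℂ := fun ε => ∑ I ∈ powersetCard r (univ : Finset (Fin n)),
        (∏ i ∈ I, ∏ j ∈ Iᶜ, (t * a i - a j) / (a i - a j)) *
          ∏ i ∈ I, (((a i - t * ε) / (a i - ε)) * ∏ x ∈ S, (a i - t * x) / (a i - x))
    let g : ℂ → ℂ := fun ε => (∑ l ∈ range r,
        t ^ ((d + 1 - (l + 1)) * (r - (l + 1))) * gaussBinom t N (r - (l + 1)) *
        (∑ K ∈ powersetCard (l + 1) S, (∏ x ∈ K, (x - t * ε) / (x - ε)) * kernelTerm t a S K +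
          ∑ K ∈ powersetCard l S, ((∏ y ∈ S \ K, (ε - t * y) / (ε - y)) *
            ∏ i, (a i - t * ε) / (a i - ε)) * kernelTerm t a S K)) +
        t ^ ((d + 1) * r) * gaussBinom t N r * R 0
    have hfg : ∀ᶠ ε in 𝓝[≠] (0 : ℂ), f ε = g ε := by
      have h1 : ∀ᶠ ε in 𝓝 (0 : ℂ), ε ∉ S :=
        S.finite_toSet.isClosed.isOpen_compl.mem_nhds h0
      have h2 : ∀ᶠ ε in 𝓝 (0 : ℂ), ∀ i, ε ≠ a i := by
        rw [eventually_all]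
        exact fun i => isOpen_ne.mem_nhds (ha0 i).symm
      filter_upwards [nhdsWithin_le_nhds h1, nhdsWithin_le_nhds h2, self_mem_nhdsWithin]
        with ε hε1 hε2 hε3
      have := ih (insert ε S) (by rw [card_insert_of_notMem hε1]; omega)
        (by simpa [mem_insert, not_or] using ⟨fun h => hε3 h.symm, h0⟩)
        (fun i => by simpa [mem_insert, not_or] using ⟨fun h => hε2 i h.symm, haS i⟩) r
      simp only [prod_insert hε1] at this
      rw [sum_range_succ', card_insert_of_notMem hε1] at this
      simp only [sum_kernelTerm_insert t a S hε1] at this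
      refine this.trans ?_
      simp only [g, hR, powersetCard_zero, sum_singleton, kernelTerm, prod_empty]
      simp [hd]
    have hcq1 : ∀ u c : ℂ, u ≠ 0 → ContinuousAt (fun ε : ℂ => (u - c * ε) / (u - ε)) 0 :=
      fun u c hu => by
        refine ContinuousAt.div (by fun_prop) (by fun_prop) (by simpa using hu)
    have hcq2 : ∀ u : ℂ, u ≠ 0 → ContinuousAt (fun ε : ℂ => (ε - t * u) / (ε - u)) 0 :=
      fun u hu => by
        refine ContinuousAt.div (by fun_prop) (by fun_prop) (by simpa using hu)
    have hS0 : ∀ x ∈ S, x ≠ 0 := fun x hx h => h0 (h ▸ hx)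
    have hf : ContinuousAt f 0 := by
      refine tendsto_finsetSum _ fun I _ => Tendsto.mul tendsto_const_nhds ?_
      exact tendsto_finsetProd _ fun i _ => Tendsto.mul (hcq1 _ _ (ha0 i)) tendsto_const_nhds
    have hg : ContinuousAt g 0 := by
      refine Tendsto.add (tendsto_finsetSum _ fun l _ => Tendsto.mul tendsto_const_nhds
        (Tendsto.add (tendsto_finsetSum _ fun K hK => Tendsto.mul ?_ tendsto_const_nhds)
          (tendsto_finsetSum _ fun K hK => Tendsto.mul (Tendsto.mul ?_ ?_) tendsto_const_nhds)))
          tendsto_const_nhds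
      · exact tendsto_finsetProd _ fun x hx => hcq1 _ _ (hS0 x ((mem_powersetCard.1 hK).1 hx))
      · exact tendsto_finsetProd _ fun x hx => hcq2 _ (hS0 x (Finset.mem_sdiff.1 hx).1)
      · exact tendsto_finsetProd _ fun i _ => hcq1 _ _ (ha0 i)
    have h00 : f 0 = g 0 := tendsto_nhds_unique
      ((hf.tendsto.mono_left nhdsWithin_le_nhds).congr' hfg)
      (hg.tendsto.mono_left nhdsWithin_le_nhds)
    have hf0 : f 0 = ∑ I ∈ powersetCard r (univ : Finset (Fin n)),
        (∏ i ∈ I, ∏ j ∈ Iᶜ, (t * a i - a j) / (a i - a j)) *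
          ∏ i ∈ I, ∏ x ∈ S, (a i - t * x) / (a i - x) := by
      simp [f, ha0]
    -- at `ε = 0` the new factors are `1`, except `(ε - t y) / (ε - y)`, which become `t`
    have hg0 : g 0 = (∑ l ∈ range r,
        t ^ ((d - l) * (r - (l + 1))) * gaussBinom t N (r - (l + 1)) *
        (R (l + 1) + t ^ (d - l) * R l)) + t ^ ((d + 1) * r) * gaussBinom t N r * R 0 := by
      simp only [g, hR]
      congr 1
      refine sum_congr rfl fun l _ => ?_
      congr 1
      · rw [Nat.add_sub_add_right]
      · congr 1
        · refine sum_congr rfl fun K hK => ?_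
          rw [prod_eq_one, one_mul]
          intro x hx
          simp [hS0 x ((mem_powersetCard.1 hK).1 hx)]
        · rw [mul_sum]
          refine sum_congr rfl fun K hK => ?_
          obtain ⟨h1, h2⟩ := mem_powersetCard.1 hK
          have h3 : ∏ y ∈ S \ K, (0 - t * y) / (0 - y) = t ^ (d - l) := by
            rw [prod_congr rfl (g := fun _ => t), prod_const, card_sdiff_of_subset h1, h2]
            intro y hy
            have := hS0 y (Finset.mem_sdiff.1 hy).1
            field_simp
            ring
          rw [h3]
          simp [ha0]
    rw [← hf0, h00, hg0]
    have hRd : ∀ l, d < l → R l = 0 := by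
      intro l hl
      simp only [hR]
      rw [powersetCard_eq_empty.2 hl, sum_empty]
    -- the `t`-Pascal rule for the coefficient of `R l`
    have hpas : ∀ l < r, (t ^ ((d - l) * (r - l)) * gaussBinom t (N + 1) (r - l)) * R l =
        (t ^ ((d + 1 - l) * (r - l)) * gaussBinom t N (r - l) +
          t ^ ((d - l) * (r - (l + 1))) * gaussBinom t N (r - (l + 1)) * t ^ (d - l)) * R l := by
      intro l hl
      rcases lt_or_ge d l with h | h
      · rw [hRd l h, mul_zero, mul_zero]
      · obtain ⟨p, rfl⟩ : ∃ p, r = l + (p + 1) := ⟨r - l - 1, by omega⟩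
        obtain ⟨e, he⟩ : ∃ e, d = l + e := ⟨d - l, by omega⟩
        have h1 : l + (p + 1) - l = p + 1 := by omega
        have h2 : l + (p + 1) - (l + 1) = p := by omega
        have h3 : d - l = e := by omega
        have h4 : d + 1 - l = e + 1 := by omega
        rw [h1, h2, h3, h4, gaussBinom_succ_succ]
        ring
    rw [sum_range_succ, sum_congr rfl fun l hl => hpas l (mem_range.1 hl)]
    have e1 : ∀ l, t ^ ((d - l) * (r - (l + 1))) * gaussBinom t N (r - (l + 1)) *
        (R (l + 1) + t ^ (d - l) * R l) =
        t ^ ((d + 1 - (l + 1)) * (r - (l + 1))) * gaussBinom t N (r - (l + 1)) * R (l + 1) +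
        t ^ ((d - l) * (r - (l + 1))) * gaussBinom t N (r - (l + 1)) * t ^ (d - l) * R l := by
      intro l
      rw [Nat.add_sub_add_right]; ring
    simp only [e1, add_mul, sum_add_distrib]
    -- the terms with `R (l + 1)` and `R 0` combine to a sum over all `l ≤ r`
    have e2 := sum_range_succ (fun l => t ^ ((d + 1 - l) * (r - l)) * gaussBinom t N (r - l) * R l)
      r
    rw [sum_range_succ'] at e2
    simp only [Nat.sub_zero, Nat.sub_self, mul_zero, pow_zero, gaussBinom_zero_right] at e2 ⊢
    linear_combination e2

/-- **The kernel identity.**  It expresses the action of the Macdonald operator in the variables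
`a` on the kernel `∏ φ(t s / a) / φ(s / a)` through the adjoint operators in the variables `s`. -/
theorem kernel_identity {n d : ℕ} (hdn : d ≤ n) {a : Fin n → ℂ} {s : Fin d → ℂ}
    (ha : Function.Injective a) (hs : Function.Injective s) (ha0 : ∀ i, a i ≠ 0)
    (hs0 : ∀ k, s k ≠ 0) (has : ∀ i k, a i ≠ s k) (t : ℂ) (r : ℕ) :
    ∑ I ∈ powersetCard r (univ : Finset (Fin n)),
        (∏ i ∈ I, ∏ j ∈ Iᶜ, (t * a i - a j) / (a i - a j)) *
          ∏ i ∈ I, ∏ k, (a i - t * s k) / (a i - s k) =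
      ∑ l ∈ range (r + 1), t ^ ((d - l) * (r - l)) * gaussBinom t (n - d) (r - l) *
        ∑ K ∈ powersetCard l (univ : Finset (Fin d)),
          (∏ k ∈ K, ∏ l ∈ Kᶜ, (s k - t * s l) / (s k - s l)) *
            ∏ k ∈ K, ∏ i, (a i - t * s k) / (a i - s k) := by
  have := kernel_finset ha ha0 t (n - d) (univ.map ⟨s, hs⟩) (by simp; omega)
    (by simpa using hs0) (fun i => by simpa using fun k => (has i k).symm) r
  simp only [sum_kernelTerm_image, card_map, card_univ, Fintype.card_fin, prod_map,
    Function.Embedding.coeFn_mk] at this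
  exact this

end

section

open Finset Polynomial

/-! ### The eigenvalues -/

/-- The generating polynomial of the elementary symmetric functions of the string
`τ ^ (N - 1) c, τ ^ (N - 3) c, …, τ ^ (1 - N) c`. -/
noncomputable def stringPoly (τ : ℂ) (N : ℕ) (c : ℂ) : ℂ[X] :=
  ∏ p ∈ range N, (1 + C (τ ^ ((N : ℤ) - 1 - 2 * (p : ℤ)) * c) * X)

/-- The `q`-binomial theorem. -/
lemma coeff_stringPoly {τ : ℂ} (hτ : τ ≠ 0) (N : ℕ) : ∀ (c : ℂ) (p : ℕ),
    (stringPoly τ N c).coeff p =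
      c ^ p * τ ^ (-((p : ℤ) * ((N : ℤ) - p))) * gaussBinom (τ ^ 2) N p := by
  induction N with
  | zero =>
    intro c p
    cases p with
    | zero => simp [stringPoly, gaussBinom_zero_right]
    | succ p => simp [stringPoly, gaussBinom_zero_left, coeff_one]
  | succ N ih =>
    intro c p
    have h : stringPoly τ (N + 1) c =
        stringPoly τ N (τ * c) * (1 + C (τ ^ (-(N : ℤ)) * c) * X) := by
      rw [stringPoly, prod_range_succ, stringPoly]
      refine congrArg₂ (· * ·) ?_ ?_
      · refine prod_congr rfl fun p _ => ?_
        have e : ((N + 1 : ℕ) : ℤ) - 1 - 2 * (p : ℤ) = (N : ℤ) - 1 - 2 * p + 1 := by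
          push_cast; ring
        rw [e, zpow_add_one₀ hτ, mul_assoc]
      · have e : ((N + 1 : ℕ) : ℤ) - 1 - 2 * (N : ℤ) = -(N : ℤ) := by push_cast; ring
        rw [e]
    rw [h, mul_add, mul_one, ← mul_assoc, coeff_add]
    cases p with
    | zero => simp [ih, gaussBinom_zero_right]
    | succ p =>
      rw [coeff_mul_X, coeff_mul_C, ih, ih, gaussBinom_succ_succ]
      have e1 : τ ^ (-(((p + 1 : ℕ) : ℤ) * ((N : ℤ) - (p + 1 : ℕ)))) * τ ^ (p + 1) =
          τ ^ (-(((p + 1 : ℕ) : ℤ) * (((N + 1 : ℕ) : ℤ) - (p + 1 : ℕ)))) * (τ ^ 2) ^ (p + 1) := by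
        rw [← zpow_natCast, ← pow_mul, ← zpow_natCast, ← zpow_add₀ hτ, ← zpow_add₀ hτ]
        congr 1; push_cast; ring
      have e2 : τ ^ (-(N : ℤ)) * τ ^ p * τ ^ (-((p : ℤ) * ((N : ℤ) - p))) =
          τ ^ (-(((p + 1 : ℕ) : ℤ) * (((N + 1 : ℕ) : ℤ) - (p + 1 : ℕ)))) := by
        rw [← zpow_natCast, ← zpow_add₀ hτ, ← zpow_add₀ hτ]
        congr 1; push_cast; ring
      rw [mul_pow, mul_pow]
      linear_combination c ^ (p + 1) * gaussBinom (τ ^ 2) N (p + 1) * e1 +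
        c ^ (p + 1) * gaussBinom (τ ^ 2) N p * e2

lemma natDegree_stringPoly_le (τ : ℂ) (N : ℕ) (c : ℂ) : (stringPoly τ N c).natDegree ≤ N := by
  refine (natDegree_prod_le _ _).trans ?_
  refine (sum_le_card_nsmul _ _ 1 fun p _ => ?_).trans (by simp)
  compute_degree

lemma stringPoly_comp (τ : ℂ) (N : ℕ) (c u : ℂ) :
    (stringPoly τ N c).comp (C u * X) = stringPoly τ N (u * c) := by
  rw [stringPoly, stringPoly, Polynomial.prod_comp]
  refine prod_congr rfl fun p _ => ?_
  simp only [add_comp, one_comp, mul_comp, C_comp, X_comp, C_mul]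
  ring

/-- The generating polynomial of the variables of all nodes up to `M`, normalized as if `M` were
the framing node. -/
noncomputable def stagePoly {k : ℕ} (τ : ℂ) (v : Fin (k + 1) → ℕ) (ω : Fin (k + 1) → ℂ)
    (M : Fin (k + 1)) : ℂ[X] :=
  ∏ m ∈ Iic M, stringPoly τ (rankDiff v m)
    (τ ^ ((v m : ℤ) + (prevRank v m : ℤ) - (v M : ℤ)) * Complex.exp (ω m))

/-- The eigenvalue of the `r`-th Macdonald operator in the variables of the node `m`. -/
noncomputable def eigenvalue {k : ℕ} (τ : ℂ) (v : Fin (k + 1) → ℕ) (ω : Fin (k + 1) → ℂ)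
    (m : Fin (k + 1)) (r : ℕ) : ℂ :=
  τ ^ (r * (v m - r)) * (stagePoly τ v ω m).coeff r

lemma Iic_succ_eq {k : ℕ} (j : Fin k) : Iic j.succ = insert j.succ (Iic j.castSucc) := by
  ext x
  simp only [mem_Iic, mem_insert, Fin.le_def, Fin.ext_iff, Fin.val_succ, Fin.val_castSucc]
  omega

lemma succ_notMem_Iic {k : ℕ} (j : Fin k) : j.succ ∉ Iic j.castSucc := by
  simp [Fin.le_def]

lemma rankDiff_zero {k : ℕ} (v : Fin (k + 1) → ℕ) : rankDiff v 0 = v 0 := by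
  simp [rankDiff, prevRank]

lemma rankDiff_succ {k : ℕ} (v : Fin (k + 1) → ℕ) (j : Fin k) :
    rankDiff v j.succ = v j.succ - v j.castSucc := by
  simp [rankDiff, prevRank]

lemma Iic_zero_eq {k : ℕ} : (Iic 0 : Finset (Fin (k + 1))) = {0} := by
  ext x; simp

lemma sum_rankDiff {k : ℕ} {v : Fin (k + 1) → ℕ} (hv : Monotone v) (M : Fin (k + 1)) :
    ∑ m ∈ Iic M, rankDiff v m = v M := by
  induction M using Fin.induction with
  | zero => rw [Iic_zero_eq, sum_singleton, rankDiff_zero]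
  | succ j ih =>
    rw [Iic_succ_eq, sum_insert (succ_notMem_Iic j), ih, rankDiff_succ]
    have := hv (Fin.castSucc_lt_succ (i := j)).le
    omega

lemma natDegree_stagePoly_le {k : ℕ} (τ : ℂ) {v : Fin (k + 1) → ℕ} (hv : Monotone v)
    (ω : Fin (k + 1) → ℂ) (M : Fin (k + 1)) : (stagePoly τ v ω M).natDegree ≤ v M := by
  rw [← sum_rankDiff hv M]
  exact (natDegree_prod_le _ _).trans (sum_le_sum fun m _ => natDegree_stringPoly_le _ _ _)

lemma stagePoly_succ {k : ℕ} {τ : ℂ} (hτ : τ ≠ 0) {v : Fin (k + 1) → ℕ} (hv : Monotone v)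
    (ω : Fin (k + 1) → ℂ) (j : Fin k) :
    stagePoly τ v ω j.succ =
      (stagePoly τ v ω j.castSucc).comp
        (C (τ ^ (-((v j.succ - v j.castSucc : ℕ) : ℤ))) * X) *
      stringPoly τ (v j.succ - v j.castSucc)
        (τ ^ v j.castSucc * Complex.exp (ω j.succ)) := by
  have hle := hv (Fin.castSucc_lt_succ (i := j)).le
  rw [stagePoly, Iic_succ_eq, prod_insert (succ_notMem_Iic j), mul_comm]
  refine congrArg₂ (· * ·) ?_ ?_
  · rw [stagePoly, Polynomial.prod_comp]
    refine prod_congr rfl fun m _ => ?_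
    have e : (v m : ℤ) + (prevRank v m : ℤ) - (v j.succ : ℤ) =
        -((v j.succ - v j.castSucc : ℕ) : ℤ) +
          ((v m : ℤ) + (prevRank v m : ℤ) - (v j.castSucc : ℤ)) := by
      rw [Nat.cast_sub hle]; ring
    rw [stringPoly_comp, ← mul_assoc, ← zpow_add₀ hτ, e]
  · have e : (v j.succ : ℤ) + (prevRank v j.succ : ℤ) - (v j.succ : ℤ) = (v j.castSucc : ℕ) := by
      simp [prevRank]
    rw [rankDiff_succ, e, zpow_natCast]

lemma eigenvalue_zero {k : ℕ} {τ : ℂ} (hτ : τ ≠ 0) (v : Fin (k + 1) → ℕ) (ω : Fin (k + 1) → ℂ)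
    (r : ℕ) (hr : r ≤ v 0) :
    eigenvalue τ v ω 0 r = Complex.exp (ω 0) ^ r * gaussBinom (τ ^ 2) (v 0) r := by
  rw [eigenvalue, stagePoly, Iic_zero_eq, prod_singleton, rankDiff_zero, coeff_stringPoly hτ]
  have h1 : prevRank v 0 = 0 := rfl
  have h2 : τ ^ (r * (v 0 - r)) * τ ^ (-((r : ℤ) * ((v 0 : ℤ) - r))) = 1 := by
    rw [← zpow_natCast, ← zpow_add₀ hτ]
    rw [Nat.cast_mul, Nat.cast_sub hr, add_neg_cancel, zpow_zero]
  rw [h1, Nat.cast_zero, add_zero, sub_self, zpow_zero, one_mul]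
  linear_combination Complex.exp (ω 0) ^ r * gaussBinom (τ ^ 2) (v 0) r * h2

lemma gaussBinom_eq_zero (t : ℂ) : ∀ N p : ℕ, N < p → gaussBinom t N p = 0 := by
  intro N
  induction N with
  | zero => exact fun p hp => gaussBinom_zero_left t p (by omega)
  | succ N ih =>
    intro p hp
    cases p with
    | zero => omega
    | succ p => rw [gaussBinom_succ_succ, ih _ (by omega), ih _ (by omega)]; simp

lemma coeff_comp_C_mul_X (f : ℂ[X]) (u : ℂ) (l : ℕ) :
    (f.comp (C u * X)).coeff l = f.coeff l * u ^ l := by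
  induction f using Polynomial.induction_on' with
  | add p q hp hq => simp [add_comp, hp, hq, add_mul]
  | monomial n a =>
    rw [monomial_comp, mul_pow, ← C_pow, ← mul_assoc, ← C_mul, coeff_C_mul_X_pow, coeff_monomial]
    by_cases h : n = l
    · simp [h]
    · simp [h, Ne.symm h]

/-- The recursion of the eigenvalues along the quiver, with the coefficients of the kernel
identity. -/
lemma eigenvalue_succ {k : ℕ} {τ : ℂ} (hτ : τ ≠ 0) {v : Fin (k + 1) → ℕ} (hv : Monotone v)
    (ω : Fin (k + 1) → ℂ) (j : Fin k) (r : ℕ) (hr : r ≤ v j.succ) :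
    eigenvalue τ v ω j.succ r =
      ∑ l ∈ range (r + 1), (τ ^ 2) ^ ((v j.castSucc - l) * (r - l)) *
        gaussBinom (τ ^ 2) (v j.succ - v j.castSucc) (r - l) *
          (Complex.exp (ω j.succ) ^ (r - l) * eigenvalue τ v ω j.castSucc l) := by
  have hle := hv (Fin.castSucc_lt_succ (i := j)).le
  have hdeg := natDegree_stagePoly_le τ hv ω j.castSucc
  rw [eigenvalue, stagePoly_succ hτ hv, coeff_mul, Nat.sum_antidiagonal_eq_sum_range_succ
    (fun l p => ((stagePoly τ v ω j.castSucc).comp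
        (C (τ ^ (-((v j.succ - v j.castSucc : ℕ) : ℤ))) * X)).coeff l *
      (stringPoly τ (v j.succ - v j.castSucc)
        (τ ^ v j.castSucc * Complex.exp (ω j.succ))).coeff p), mul_sum]
  refine sum_congr rfl fun l hl => ?_
  have hlr : l ≤ r := by have := mem_range.1 hl; omega
  rw [coeff_comp_C_mul_X, coeff_stringPoly hτ, eigenvalue]
  rcases lt_or_ge (v j.castSucc) l with h | h
  · rw [coeff_eq_zero_of_natDegree_lt (hdeg.trans_lt h)]; simp
  rcases lt_or_ge (v j.succ - v j.castSucc) (r - l) with h' | h'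
  · rw [gaussBinom_eq_zero _ _ _ h']; simp
  have e : τ ^ (r * (v j.succ - r)) * ((τ ^ (-((v j.succ - v j.castSucc : ℕ) : ℤ))) ^ l *
      ((τ ^ v j.castSucc) ^ (r - l) *
        τ ^ (-(((r - l : ℕ) : ℤ) * (((v j.succ - v j.castSucc : ℕ) : ℤ) - (r - l : ℕ)))))) =
      (τ ^ 2) ^ ((v j.castSucc - l) * (r - l)) * τ ^ (l * (v j.castSucc - l)) := by
    simp only [← zpow_natCast, ← zpow_mul]
    rw [← zpow_add₀ hτ, ← zpow_add₀ hτ, ← zpow_add₀ hτ, ← zpow_add₀ hτ]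
    congr 1
    push_cast [hle, h, hlr, hr]
    ring
  rw [mul_pow]
  linear_combination (stagePoly τ v ω j.castSucc).coeff l * Complex.exp (ω j.succ) ^ (r - l) *
    gaussBinom (τ ^ 2) (v j.succ - v j.castSucc) (r - l) * e

lemma coeff_prod_one_add_C_mul_X {ι : Type*} (s : Finset ι) (f : ι → ℂ) (r : ℕ) :
    (∏ i ∈ s, (1 + C (f i) * X)).coeff r = ∑ K ∈ powersetCard r s, ∏ i ∈ K, f i := by
  classical
  rw [prod_one_add, finsetSum_coeff, ← sum_subset (s₁ := powersetCard r s)]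
  · refine sum_congr rfl fun K hK => ?_
    rw [prod_mul_distrib, prod_const, ← map_prod, coeff_C_mul_X_pow, (mem_powersetCard.1 hK).2,
      if_pos rfl]
  · exact fun K hK => mem_powerset.2 (mem_powersetCard.1 hK).1
  · intro K hK hK'
    rw [prod_mul_distrib, prod_const, ← map_prod, coeff_C_mul_X_pow, if_neg]
    exact fun h => hK' (mem_powersetCard.2 ⟨mem_powerset.1 hK, h.symm⟩)

lemma eigenvalue_last {k : ℕ} (τ : ℂ) (v : Fin (k + 1) → ℕ) (ω : Fin (k + 1) → ℂ) (r : ℕ) :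
    eigenvalue τ v ω (Fin.last k) r =
      τ ^ (r * (v (Fin.last k) - r)) * S τ v (zetaHat τ v ω) r := by
  rw [eigenvalue, S, Finset.esymm_map_val, ← coeff_prod_one_add_C_mul_X]
  congr 2
  have : (Iic (Fin.last k) : Finset (Fin (k + 1))) = univ := by ext x; simp [Fin.le_last]
  rw [stagePoly, this, Fintype.prod_sigma]
  refine prod_congr rfl fun m _ => ?_
  rw [stringPoly, ← Fin.prod_univ_eq_prod_range
    (fun p => 1 + C (τ ^ ((rankDiff v m : ℤ) - 1 - 2 * (p : ℤ)) *
      (τ ^ ((v m : ℤ) + (prevRank v m : ℤ) - (v (Fin.last k) : ℤ)) * Complex.exp (ω m))) * X)]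
  rfl

end

section

open MeasureTheory Filter Topology Set

/-! ### Translation of a contour in one variable -/

/-- A function `P` with a limit along a curve going to infinity has limit zero if `P dγ` is
integrable there, because the curve has infinite length. -/
lemma eq_zero_of_integrableAtFilter_mul {l : Filter ℝ} [l.NeBot] [l.IsMeasurablyGenerated]
    {P γ' : ℝ → ℂ}
    {ℓ : ℂ} (hP : Tendsto P l (𝓝 ℓ)) (hγ' : Continuous γ')
    (hint : IntegrableAtFilter (fun x => P x * γ' x) l)
    (hlen : ¬ IntegrableAtFilter γ' l) : ℓ = 0 := by
  by_contra hℓ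
  have hpos : 0 < ‖ℓ‖ := norm_pos_iff.2 hℓ
  apply hlen
  have hev : ∀ᶠ x in l, ‖ℓ‖ / 2 < ‖P x‖ :=
    (continuous_norm.continuousAt.tendsto.comp hP).eventually (lt_mem_nhds (by linarith))
  obtain ⟨s, hs, hs'⟩ := hint
  obtain ⟨s', hs'l, hs'm, hs's⟩ :=
    IsMeasurablyGenerated.exists_measurable_subset (f := l) (inter_mem hs hev)
  refine ⟨s', hs'l, ?_⟩
  have h1 : IntegrableOn (fun x => (2 / ‖ℓ‖ : ℝ) • ‖P x * γ' x‖) s' :=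
    Integrable.smul (2 / ‖ℓ‖ : ℝ) (hs'.mono_set fun x hx => (hs's hx).1).norm
  refine Integrable.mono h1 hγ'.aestronglyMeasurable ?_
  refine (ae_restrict_iff' hs'm).2 (Eventually.of_forall fun x hx => ?_)
  have h2 : ‖ℓ‖ / 2 < ‖P x‖ := (hs's hx).2
  rw [smul_eq_mul, norm_mul, norm_norm, norm_mul, Real.norm_of_nonneg (by positivity),
    ← mul_assoc]
  have h3 : 1 ≤ 2 / ‖ℓ‖ * ‖P x‖ := by
    rw [div_mul_eq_mul_div, le_div_iff₀ hpos]; linarith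
  nlinarith [norm_nonneg (γ' x)]

lemma not_integrableAtFilter_atTop {γ : ℝ → ℂ} (hγ : ContDiff ℝ 1 γ)
    (h : Tendsto γ atTop (cocompact ℂ)) : ¬ IntegrableAtFilter (deriv γ) atTop := by
  rintro ⟨s, hs, hint⟩
  obtain ⟨a, ha⟩ := mem_atTop_sets.1 hs
  have hlim := tendsto_limUnder_of_hasDerivAt_of_integrableOn_Ioi (a := a) (f := γ)
    (f' := deriv γ) (fun x _ => (hγ.differentiable one_ne_zero x).hasDerivAt)
    (hint.mono_set fun x hx => ha x (le_of_lt hx))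
  exact hlim.not_tendsto (disjoint_nhds_cocompact _) h

lemma not_integrableAtFilter_atBot {γ : ℝ → ℂ} (hγ : ContDiff ℝ 1 γ)
    (h : Tendsto γ atBot (cocompact ℂ)) : ¬ IntegrableAtFilter (deriv γ) atBot := by
  rintro ⟨s, hs, hint⟩
  obtain ⟨a, ha⟩ := mem_atBot_sets.1 hs
  have hlim := tendsto_limUnder_of_hasDerivAt_of_integrableOn_Iic (a := a) (f := γ)
    (f' := deriv γ) (fun x _ => (hγ.differentiable one_ne_zero x).hasDerivAt)
    (hint.mono_set fun x hx => ha x hx)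
  exact hlim.not_tendsto (disjoint_nhds_cocompact _) h

/-- The primitive along short segments: the derivative in `x` of
`∫_0^1 g (γ x + s h) h ds` is the difference of `g` at the two ends of the segment, times `γ'`. -/
lemma hasDerivAt_segment_integral {g : ℂ → ℂ} {γ : ℝ → ℂ} {h : ℂ} {ρ : ℝ} (hh : ‖h‖ < ρ)
    (hγ : Differentiable ℝ γ)
    (hg : ∀ x z, ‖z‖ < ρ → DifferentiableAt ℂ g (γ x + z)) (x₀ : ℝ) :
    HasDerivAt (fun x => h * ∫ s in (0:ℝ)..1, g (γ x + s * h))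
      (g (γ x₀ + h) * deriv γ x₀ - g (γ x₀) * deriv γ x₀) x₀ := by
  have hρ : 0 < ρ := (norm_nonneg h).trans_lt hh
  have hd : DifferentiableOn ℂ g (Metric.ball (γ x₀) ρ) := by
    intro w hw
    have := hg x₀ (w - γ x₀) (by simpa [dist_eq_norm] using hw)
    rw [add_sub_cancel] at this
    exact this.differentiableWithinAt
  obtain ⟨Γ, hΓ⟩ := hd.isExactOn_ball
  have hin : ∀ᶠ x in 𝓝 x₀, γ x ∈ Metric.ball (γ x₀) (ρ - ‖h‖) :=
    (hγ x₀).continuousAt (Metric.ball_mem_nhds _ (by linarith))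
  have hmem : ∀ x, γ x ∈ Metric.ball (γ x₀) (ρ - ‖h‖) → ∀ s ∈ Icc (0:ℝ) 1,
      γ x + s * h ∈ Metric.ball (γ x₀) ρ := by
    intro x hx s hs
    rw [Metric.mem_ball, dist_eq_norm] at hx ⊢
    have h1 : ‖(s : ℂ) * h‖ ≤ ‖h‖ := by
      rw [norm_mul, Complex.norm_real, Real.norm_of_nonneg hs.1]
      nlinarith [norm_nonneg h, hs.2]
    calc ‖γ x + s * h - γ x₀‖ = ‖(γ x - γ x₀) + s * h‖ := by ring_nf
      _ ≤ ‖γ x - γ x₀‖ + ‖(s : ℂ) * h‖ := norm_add_le _ _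
      _ < ρ := by linarith
  have hev : (fun x => h * ∫ s in (0:ℝ)..1, g (γ x + s * h)) =ᶠ[𝓝 x₀]
      fun x => Γ (γ x + h) - Γ (γ x) := by
    filter_upwards [hin] with x hx
    have hder : ∀ s ∈ uIcc (0:ℝ) 1,
        HasDerivAt (fun s : ℝ => Γ (γ x + s * h)) (g (γ x + s * h) * h) s := by
      intro s hs
      rw [uIcc_of_le zero_le_one] at hs
      have h1 := hΓ _ (hmem x hx s hs)
      have h2 : HasDerivAt (fun s : ℝ => γ x + (s : ℂ) * h) h s := by
        simpa using ((Complex.ofRealCLM.hasDerivAt (x := s)).mul_const h).const_add (γ x)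
      exact h1.comp s h2
    have hcont : ContinuousOn (fun s : ℝ => g (γ x + s * h) * h) (uIcc (0:ℝ) 1) := by
      rw [uIcc_of_le zero_le_one]
      refine ContinuousOn.mul ?_ continuousOn_const
      exact hd.continuousOn.comp (by fun_prop) fun s hs => hmem x hx s hs
    have := intervalIntegral.integral_eq_sub_of_hasDerivAt hder hcont.intervalIntegrable
    rw [intervalIntegral.integral_mul_const] at this
    rw [mul_comm, this]
    simp
  refine HasDerivAt.congr_of_eventuallyEq ?_ hev
  have hx0 : γ x₀ ∈ Metric.ball (γ x₀) (ρ - ‖h‖) := Metric.mem_ball_self (by linarith)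
  have h1 := hΓ _ (hmem x₀ hx0 1 (by simp))
  have h0 := hΓ _ (hmem x₀ hx0 0 (by simp))
  simp only [Complex.ofReal_one, one_mul, Complex.ofReal_zero, zero_mul, add_zero] at h1 h0
  have hγd := (hγ x₀).hasDerivAt
  exact (h1.comp x₀ (hγd.add_const h)).sub (h0.comp x₀ hγd)

/-- A contour with both ends at infinity, or closed for the function `g`, may be translated
by a small vector `h` if the integral converges absolutely during the translation. -/
lemma integral_contour_translate {g : ℂ → ℂ} {γ : ℝ → ℂ} {h : ℂ} {ρ : ℝ} (hh : ‖h‖ < ρ)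
    (hγ : ContDiff ℝ 1 γ)
    (hg : ∀ x z, ‖z‖ < ρ → DifferentiableAt ℂ g (γ x + z))
    (h0 : Integrable fun x => g (γ x) * deriv γ x)
    (h1 : Integrable fun x => g (γ x + h) * deriv γ x)
    (hs : Integrable (fun p : ℝ × ℝ => g (γ p.2 + p.1 * h) * deriv γ p.2)
      ((volume.restrict (Icc (0:ℝ) 1)).prod volume))
    (hend : Tendsto γ (cocompact ℝ) (cocompact ℂ) ∨
      ∃ A B : ℝ, (∀ x ≤ A, γ x = γ A) ∧ (∀ x ≥ B, γ x = γ B) ∧ ∀ z, g (γ B + z) = g (γ A + z)) :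
    ∫ x, g (γ x + h) * deriv γ x = ∫ x, g (γ x) * deriv γ x := by
  set P : ℝ → ℂ := fun x => h * ∫ s in (0:ℝ)..1, g (γ x + s * h) with hP
  have hder := hasDerivAt_segment_integral hh (hγ.differentiable one_ne_zero) hg
  have hint : Integrable fun x => g (γ x + h) * deriv γ x - g (γ x) * deriv γ x := h1.sub h0
  rw [← sub_eq_zero, ← integral_sub h1 h0]
  rcases hend with hinf | ⟨A, B, hA, hB, hAB⟩
  · rw [cocompact_eq_atBot_atTop, tendsto_sup] at hinf
    have hPγ : Integrable fun x => P x * deriv γ x := by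
      have := hs.integral_prod_right.const_mul h
      refine this.congr (Eventually.of_forall fun x => ?_)
      simp only [hP]
      rw [intervalIntegral.integral_of_le zero_le_one, ← integral_Icc_eq_integral_Ioc,
        integral_mul_const]
      ring
    have hcont : Continuous (deriv γ) := hγ.continuous_deriv le_rfl
    have htop := tendsto_limUnder_of_hasDerivAt_of_integrableOn_Ioi (a := 0) (f := P)
      (fun x _ => hder x) hint.integrableOn
    have hbot := tendsto_limUnder_of_hasDerivAt_of_integrableOn_Iic (a := 0) (f := P)
      (fun x _ => hder x) hint.integrableOn
    rw [integral_of_hasDerivAt_of_tendsto hder hint hbot htop,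
      eq_zero_of_integrableAtFilter_mul htop hcont (hPγ.integrableAtFilter _)
        (not_integrableAtFilter_atTop hγ hinf.2),
      eq_zero_of_integrableAtFilter_mul hbot hcont (hPγ.integrableAtFilter _)
        (not_integrableAtFilter_atBot hγ hinf.1), sub_zero]
  · have hbot : Tendsto P atBot (𝓝 (P A)) := by
      refine tendsto_const_nhds.congr' ?_
      filter_upwards [Iic_mem_atBot A] with x hx
      simp only [hP, hA x hx]
    have htop : Tendsto P atTop (𝓝 (P A)) := by
      refine tendsto_const_nhds.congr' ?_
      filter_upwards [Ici_mem_atTop B] with x hx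
      simp only [hP, hB x hx, hAB]
    rw [integral_of_hasDerivAt_of_tendsto hder hint hbot htop, sub_self]

end

section

open MeasureTheory Filter Topology Set

/-! ### Translation of a product contour in one of its variables -/

lemma exists_split_pi_aux {ι : Type} [Fintype ι] {α : ι → Type}
    [∀ i, MeasureSpace (α i)] [∀ i, SigmaFinite (volume : Measure (α i))] (p : ι → Prop)
    [DecidablePred p] [Unique {j // p j}] :
    ∃ (Z : Type) (_ : MeasureSpace Z) (_ : SigmaFinite (volume : Measure Z))
      (e : α (default : {j // p j}).1 × Z → ∀ j, α j), MeasurePreserving e ∧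
        MeasurableEmbedding e ∧ (∀ s z, e (s, z) (default : {j // p j}).1 = s) ∧
        ∀ s s' z j, ¬ p j → e (s, z) j = e (s', z) j := by
  let e₁ := (MeasurableEquiv.piEquivPiSubtypeProd α p).symm
  let e₂ := (MeasurableEquiv.piUnique fun j : {j // p j} => α j).symm
  have hm₁ : MeasurePreserving e₁ :=
    (volume_preserving_piEquivPiSubtypeProd α p).symm
  have hm₂ : MeasurePreserving e₂ := by
    have := (volume_preserving_piUnique fun j : {j // p j} => α j).symm
    convert! this
  refine ⟨∀ j : {j // ¬ p j}, α j, inferInstance, inferInstance,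
    fun x => e₁ (e₂ x.1, x.2), ?_, ?_, ?_, ?_⟩
  · exact hm₁.comp (hm₂.prod (MeasurePreserving.id _))
  · exact e₁.measurableEmbedding.comp
      (e₂.prodCongr (MeasurableEquiv.refl _)).measurableEmbedding
  · intro s z
    change (Equiv.piEquivPiSubtypeProd p α).symm (e₂ s, z) _ = s
    rw [Equiv.piEquivPiSubtypeProd_symm_apply, dif_pos (default : {j // p j}).2]
    rfl
  · intro s s' z j hj
    change (Equiv.piEquivPiSubtypeProd p α).symm (e₂ s, z) j =
      (Equiv.piEquivPiSubtypeProd p α).symm (e₂ s', z) j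
    rw [Equiv.piEquivPiSubtypeProd_symm_apply, Equiv.piEquivPiSubtypeProd_symm_apply]
    simp only [hj, dif_neg, not_false_eq_true]

/-- Splitting one coordinate off a product of measure spaces. -/
lemma exists_split_pi {ι : Type} [Fintype ι] [DecidableEq ι] {α : ι → Type}
    [∀ i, MeasureSpace (α i)] [∀ i, SigmaFinite (volume : Measure (α i))] (i : ι) :
    ∃ (Z : Type) (_ : MeasureSpace Z) (_ : SigmaFinite (volume : Measure Z))
      (e : α i × Z → ∀ j, α j), MeasurePreserving e ∧ MeasurableEmbedding e ∧
        (∀ s z, e (s, z) i = s) ∧ ∀ s s' z j, j ≠ i → e (s, z) j = e (s', z) j :=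
  exists_split_pi_aux (α := α) (· = i)

variable {k : ℕ} {v : Fin (k + 1) → ℕ}

/-- The unit vector in the direction of the variable `s m i`. -/
def unitVec (m : Fin k) (i : Fin (v m.castSucc)) : Vars v ℂ := Pi.single m (Pi.single i 1)

lemma unitVec_self (m : Fin k) (i : Fin (v m.castSucc)) :
    (unitVec m i : Vars v ℂ) m i = 1 := by simp [unitVec]

lemma unitVec_of_ne (m : Fin k) {i j : Fin (v m.castSucc)} (h : j ≠ i) :
    (unitVec m i : Vars v ℂ) m j = 0 := by simp [unitVec, h]

lemma unitVec_of_ne' {m m' : Fin k} (i : Fin (v m.castSucc)) (h : m' ≠ m)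
    (j : Fin (v m'.castSucc)) : (unitVec m i : Vars v ℂ) m' j = 0 := by simp [unitVec, h]

/-- Splitting the variable `x m i` off the integration variables. -/
lemma exists_split_vars (m : Fin k) (i : Fin (v m.castSucc)) :
    ∃ (Z : Type) (_ : MeasureSpace Z) (_ : SigmaFinite (volume : Measure Z))
      (e : ℝ × Z → Vars v ℝ), MeasurePreserving e ∧ MeasurableEmbedding e ∧
        (∀ s z, e (s, z) m i = s) ∧ (∀ s s' z j, j ≠ i → e (s, z) m j = e (s', z) m j) ∧
        ∀ s s' z m' j, m' ≠ m → e (s, z) m' j = e (s', z) m' j := by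
  obtain ⟨Z₁, _, _, e₁, hm₁, hE₁, hs₁, hn₁⟩ :=
    exists_split_pi (α := fun m : Fin k => Fin (v m.castSucc) → ℝ) m
  obtain ⟨Z₂, _, _, e₂, hm₂, hE₂, hs₂, hn₂⟩ :=
    exists_split_pi (α := fun _ : Fin (v m.castSucc) => ℝ) i
  refine ⟨Z₂ × Z₁, inferInstance, inferInstance, fun x => e₁ (e₂ (x.1, x.2.1), x.2.2),
    ?_, ?_, ?_, ?_, ?_⟩
  · exact hm₁.comp ((hm₂.prod (MeasurePreserving.id _)).comp
      (volume_preserving_prodAssoc.symm (MeasurableEquiv.prodAssoc (α := ℝ) (β := Z₂) (γ := Z₁))))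
  · exact hE₁.comp ((hE₂.prodMap MeasurableEmbedding.id).comp
      (MeasurableEquiv.prodAssoc (α := ℝ) (β := Z₂) (γ := Z₁)).symm.measurableEmbedding)
  · intro s z; simp [hs₁, hs₂]
  · intro s s' z j hj; simp only [hs₁]; exact hn₂ _ _ _ _ hj
  · intro s s' z m' j hm'; exact congrFun (hn₁ _ _ _ _ hm') j

/-- The product of the derivatives of all curves but one. -/
noncomputable def jacobianErase (γ : Vars v (ℝ → ℂ)) (m : Fin k) (i : Fin (v m.castSucc))
    (x : Vars v ℝ) : ℂ :=
  (∏ j ∈ Finset.univ.erase i, deriv (γ m j) (x m j)) *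
    ∏ m' ∈ Finset.univ.erase m, ∏ j, deriv (γ m' j) (x m' j)

lemma jacobian_eq_mul_jacobianErase (γ : Vars v (ℝ → ℂ)) (m : Fin k) (i : Fin (v m.castSucc))
    (x : Vars v ℝ) : jacobian γ x = deriv (γ m i) (x m i) * jacobianErase γ m i x := by
  rw [jacobian, jacobianErase, ← Finset.mul_prod_erase _ _ (Finset.mem_univ m),
    ← Finset.mul_prod_erase _ _ (Finset.mem_univ i), mul_assoc]

/-- The point with parameter `x` of the product contour `γ`. -/
def contourPoint (γ : Vars v (ℝ → ℂ)) (x : Vars v ℝ) : Vars v ℂ := fun m i => γ m i (x m i)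

lemma continuous_contourPoint {γ : Vars v (ℝ → ℂ)} (hγ : ∀ m i, ContDiff ℝ 1 (γ m i)) :
    Continuous (contourPoint γ) :=
  continuous_pi fun m => continuous_pi fun i =>
    (hγ m i).continuous.comp ((continuous_apply i).comp (continuous_apply m))

lemma continuous_jacobian {γ : Vars v (ℝ → ℂ)} (hγ : ∀ m i, ContDiff ℝ 1 (γ m i)) :
    Continuous (jacobian γ) := by
  refine continuous_finsetProd _ fun m _ => continuous_finsetProd _ fun i _ => ?_
  exact ((hγ m i).continuous_deriv le_rfl).comp ((continuous_apply i).comp (continuous_apply m))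

/-- The closing condition for the curve `γ` as part of a product contour, with respect to
a function `G` of all variables. -/
def ClosesUp (G : Vars v ℂ → ℂ) (m : Fin k) (i : Fin (v m.castSucc)) (γ : ℝ → ℂ) : Prop :=
  Tendsto γ (cocompact ℝ) (cocompact ℂ) ∨
    ∃ A B : ℝ, (∀ x ≤ A, γ x = γ A) ∧ (∀ x ≥ B, γ x = γ B) ∧
      ∀ y : Vars v ℂ, G (y + (γ B - γ A) • unitVec m i) = G y

/-- A product contour may be translated by a small vector in the plane of one variable. -/
lemma integral_translate_unitVec {G : Vars v ℂ → ℂ} {γ : Vars v (ℝ → ℂ)}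
    (hγ : ∀ m i, ContDiff ℝ 1 (γ m i)) (m : Fin k) (i : Fin (v m.castSucc))
    (hend : ClosesUp G m i (γ m i)) (c : Vars v ℂ) {h : ℂ} {ρ : ℝ} (hh : ‖h‖ < ρ) {M : ℝ}
    (hG : ∀ (x : Vars v ℝ) (z : ℂ), ‖z‖ < ρ →
      DifferentiableAt ℂ G (contourPoint γ x + c + z • unitVec m i))
    (hint : ∀ s ∈ Icc (0:ℝ) 1, Integrable fun x : Vars v ℝ =>
      G (contourPoint γ x + c + ((s:ℂ) * h) • unitVec m i) * jacobian γ x)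
    (hM : ∀ s ∈ Icc (0:ℝ) 1, ∫ x : Vars v ℝ,
      ‖G (contourPoint γ x + c + ((s:ℂ) * h) • unitVec m i) * jacobian γ x‖ ≤ M) :
    ∫ x : Vars v ℝ, G (contourPoint γ x + c + h • unitVec m i) * jacobian γ x =
      ∫ x : Vars v ℝ, G (contourPoint γ x + c) * jacobian γ x := by
  have hρ : 0 < ρ := (norm_nonneg h).trans_lt hh
  obtain ⟨Z, _, _, e, hme, hE, hes, hem, hen⟩ := exists_split_vars (v := v) m i
  have hsh : ∀ s ∈ Icc (0:ℝ) 1, ‖(s : ℂ) * h‖ < ρ := by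
    intro s hs
    rw [norm_mul, Complex.norm_real, Real.norm_of_nonneg hs.1]
    nlinarith [norm_nonneg h, hs.2]
  -- the integrand as a function of the parameter `s` of the translation and of `x`
  set F : ℝ × Vars v ℝ → ℂ := fun p =>
    G (contourPoint γ p.2 + c + ((p.1 : ℂ) * h) • unitVec m i) * jacobian γ p.2 with hF
  have hFcont : ContinuousOn F (Icc (0:ℝ) 1 ×ˢ univ) := by
    intro p hp
    have h1 : ContinuousAt G (contourPoint γ p.2 + c + ((p.1 : ℂ) * h) • unitVec m i) :=
      (hG _ _ (hsh _ hp.1)).continuousAt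
    have h2 : Continuous fun p : ℝ × Vars v ℝ =>
        contourPoint γ p.2 + c + ((p.1 : ℂ) * h) • (unitVec m i : Vars v ℂ) := by
      have := continuous_contourPoint hγ
      fun_prop
    exact ((ContinuousAt.comp (f := fun p : ℝ × Vars v ℝ =>
      contourPoint γ p.2 + c + ((p.1 : ℂ) * h) • (unitVec m i : Vars v ℂ)) h1
        h2.continuousAt).mul
      ((continuous_jacobian hγ).comp continuous_snd).continuousAt).continuousWithinAt
  have hFint : Integrable F ((volume.restrict (Icc (0:ℝ) 1)).prod volume) := by
    have hmeas : AEStronglyMeasurable F ((volume.restrict (Icc (0:ℝ) 1)).prod volume) := by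
      have := hFcont.aestronglyMeasurable (μ := (volume : Measure ℝ).prod volume)
        (measurableSet_Icc.prod MeasurableSet.univ)
      rwa [← Measure.prod_restrict, Measure.restrict_univ] at this
    refine (integrable_prod_iff hmeas).2 ⟨?_, ?_⟩
    · exact (ae_restrict_iff' measurableSet_Icc).2 (Eventually.of_forall hint)
    · refine Integrable.of_bound hmeas.norm.integral_prod_right' M ?_
      refine (ae_restrict_iff' measurableSet_Icc).2 (Eventually.of_forall fun s hs => ?_)
      rw [Real.norm_of_nonneg (integral_nonneg fun _ => norm_nonneg _)]
      exact hM s hs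
  -- the same function with the coordinate `x m i` split off
  have hFe : Integrable (fun p : (ℝ × ℝ) × Z => F (p.1.1, e (p.1.2, p.2)))
      (((volume.restrict (Icc (0:ℝ) 1)).prod volume).prod volume) := by
    have h1 : MeasurePreserving (Prod.map id e)
        ((volume.restrict (Icc (0:ℝ) 1)).prod (volume : Measure (ℝ × Z)))
        ((volume.restrict (Icc (0:ℝ) 1)).prod volume) :=
      (MeasurePreserving.id _).prod hme
    have h2 := (h1.integrable_comp_emb (MeasurableEmbedding.id.prodMap hE)).2 hFint
    exact ((measurePreserving_prodAssoc (volume.restrict (Icc (0:ℝ) 1)) (volume : Measure ℝ)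
      (volume : Measure Z)).integrable_comp_emb
        MeasurableEquiv.prodAssoc.measurableEmbedding).2 h2
  have hI : ∀ s ∈ Icc (0:ℝ) 1,
      Integrable (fun p : ℝ × Z => F (s, e p)) (volume.prod volume) := fun s hs =>
    (hme.integrable_comp_emb hE).2 (hint s hs)
  have hval : ∀ s : ℝ, ∫ x, F (s, x) = ∫ p : ℝ × Z, F (s, e p) := fun s =>
    (hme.integral_comp hE fun x => F (s, x)).symm
  have h1 := hI 1 (by simp)
  have h0 := hI 0 (by simp)
  have goal : ∫ x, F (1, x) = ∫ x, F (0, x) := by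
    rw [hval, hval]
    change ∫ p : ℝ × Z, F (1, e p) ∂(volume.prod volume) =
      ∫ p : ℝ × Z, F (0, e p) ∂(volume.prod volume)
    rw [integral_prod_symm _ h1, integral_prod_symm _ h0]
    refine integral_congr_ae ?_
    filter_upwards [hFe.prod_left_ae, h1.prod_left_ae, h0.prod_left_ae] with z hz hz1 hz0
    -- for fixed values of the other variables, this is the one-dimensional statement for `g`
    set J := jacobianErase γ m i (e (0, z)) with hJ
    set g : ℂ → ℂ := fun w =>
      G (contourPoint γ (e (0, z)) + c + (w - γ m i 0) • unitVec m i) with hg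
    have hpt : ∀ (x : ℝ) (u : ℂ), contourPoint γ (e (x, z)) + c + u • unitVec m i =
        contourPoint γ (e (0, z)) + c + (γ m i x + u - γ m i 0) • unitVec m i := by
      intro x u
      ext m' j
      by_cases hm' : m' = m
      · subst hm'
        by_cases hj : j = i
        · subst hj
          simp [contourPoint, unitVec_self, hes]
          ring
        · simp [contourPoint, unitVec_of_ne _ hj, hem x 0 z j hj]
      · simp [contourPoint, unitVec_of_ne' _ hm', hen x 0 z m' j hm']
    have hjac : ∀ x : ℝ, jacobian γ (e (x, z)) = deriv (γ m i) x * J := by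
      intro x
      rw [jacobian_eq_mul_jacobianErase γ m i, hes, hJ]
      congr 1
      refine congrArg₂ (· * ·) ?_ ?_
      · refine Finset.prod_congr rfl fun j hj => ?_
        rw [hem x 0 z j (Finset.mem_erase.1 hj).1]
      · refine Finset.prod_congr rfl fun m' hm' => Finset.prod_congr rfl fun j _ => ?_
        rw [hen x 0 z m' j (Finset.mem_erase.1 hm').1]
    have hFg : ∀ s x : ℝ, F (s, e (x, z)) = g (γ m i x + s * h) * deriv (γ m i) x * J := by
      intro s x
      change G (contourPoint γ (e (x, z)) + c + ((s : ℂ) * h) • unitVec m i) *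
        jacobian γ (e (x, z)) = _
      rw [hpt, hjac, mul_assoc]
    simp only [hFg] at hz hz1 hz0 ⊢
    by_cases hJ0 : J = 0
    · simp only [hJ0, mul_zero]
    rw [integral_mul_const, integral_mul_const]
    congr 1
    have hz' := hz.mul_const J⁻¹
    have hz1' := hz1.mul_const J⁻¹
    have hz0' := hz0.mul_const J⁻¹
    simp only [mul_inv_cancel_right₀ hJ0, Complex.ofReal_one, one_mul, Complex.ofReal_zero,
      zero_mul, add_zero] at hz' hz1' hz0' ⊢
    refine integral_contour_translate hh (hγ m i) ?_ hz0' hz1' hz' ?_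
    · intro x z' hz'
      have h1 := hG (e (x, z)) z' hz'
      rw [hpt] at h1
      exact DifferentiableAt.comp (f := fun w : ℂ => contourPoint γ (e (0, z)) + c +
        (w - γ m i 0) • (unitVec m i : Vars v ℂ)) _ h1 (by fun_prop)
    · rcases hend with h | ⟨A, B, hA, hB, hAB⟩
      · exact Or.inl h
      · refine Or.inr ⟨A, B, hA, hB, fun z' => ?_⟩
        simp only [hg]
        rw [← hAB (contourPoint γ (e (0, z)) + c + (γ m i A + z' - γ m i 0) • unitVec m i)]
        congr 1
        module
  simpa [hF] using goal

end

section

open MeasureTheory Filter Topology Set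

/-! ### Simultaneous shift of several variables -/

variable {k : ℕ} {v : Fin (k + 1) → ℕ}

/-- The sum of the unit vectors in the directions `s m i`, `i ∈ K`. -/
def indVec (m : Fin k) (K : Finset (Fin (v m.castSucc))) : Vars v ℂ :=
  Pi.single m fun i => if i ∈ K then 1 else 0

lemma indVec_apply_self (m : Fin k) (K : Finset (Fin (v m.castSucc))) (i : Fin (v m.castSucc)) :
    (indVec m K : Vars v ℂ) m i = if i ∈ K then 1 else 0 := by simp [indVec]

lemma indVec_apply_of_ne {m m' : Fin k} (h : m' ≠ m) (K : Finset (Fin (v m.castSucc)))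
    (i : Fin (v m'.castSucc)) : (indVec m K : Vars v ℂ) m' i = 0 := by simp [indVec, h]

lemma indVec_empty (m : Fin k) : (indVec m ∅ : Vars v ℂ) = 0 := by
  ext m' i
  by_cases h : m' = m
  · subst h; simp [indVec_apply_self]
  · simp [indVec_apply_of_ne h]

lemma indVec_insert {m : Fin k} {K : Finset (Fin (v m.castSucc))} {i : Fin (v m.castSucc)}
    (hi : i ∉ K) : (indVec m (insert i K) : Vars v ℂ) = indVec m K + unitVec m i := by
  ext m' j
  by_cases h : m' = m
  · subst h
    by_cases hj : j = i
    · subst hj; simp [indVec_apply_self, unitVec_self, hi]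
    · simp [indVec_apply_self, unitVec_of_ne _ hj, hj]
  · simp [indVec_apply_of_ne h, unitVec_of_ne' _ h]

lemma norm_indVec_le (m : Fin k) (K : Finset (Fin (v m.castSucc))) (m' : Fin k)
    (i : Fin (v m'.castSucc)) : ‖(indVec m K : Vars v ℂ) m' i‖ ≤ 1 := by
  by_cases h : m' = m
  · subst h
    rw [indVec_apply_self]
    split_ifs <;> simp
  · simp [indVec_apply_of_ne h]

lemma norm_smul_indVec_add_smul_unitVec_le {m : Fin k} {K : Finset (Fin (v m.castSucc))}
    {i : Fin (v m.castSucc)} (hi : i ∉ K) {z z' : ℂ} {δ : ℝ} (hz : ‖z‖ ≤ δ) (hz' : ‖z'‖ ≤ δ)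
    (m' : Fin k) (j : Fin (v m'.castSucc)) :
    ‖(z • indVec m K + z' • unitVec m i : Vars v ℂ) m' j‖ ≤ δ := by
  have hδ := (norm_nonneg z).trans hz
  simp only [Pi.add_apply, Pi.smul_apply, smul_eq_mul]
  by_cases h : m' = m
  · subst h
    by_cases hj : j = i
    · subst hj; simpa [indVec_apply_self, unitVec_self, hi] using hz'
    · rw [indVec_apply_self, unitVec_of_ne _ hj]
      split_ifs <;> simp [hz, hδ]
  · simp [indVec_apply_of_ne h, unitVec_of_ne' _ h, hδ]

/-- A product contour may be shifted by `L` in the planes of the variables `s m i`, `i ∈ K`,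
simultaneously, if the function `G` is holomorphic and absolutely integrable near the shifted
contours, uniformly during the shift. -/
theorem integral_shift {G : Vars v ℂ → ℂ} {γ : Vars v (ℝ → ℂ)}
    (hγ : ∀ m i, ContDiff ℝ 1 (γ m i)) (m : Fin k) (K : Finset (Fin (v m.castSucc)))
    (hend : ∀ i ∈ K, ClosesUp G m i (γ m i)) (L : ℂ) {δ : ℝ} (hδ : 0 < δ) {M : ℝ}
    (hG : ∀ u ∈ Icc (0:ℝ) 1, ∀ η : Vars v ℂ, (∀ m i, ‖η m i‖ ≤ δ) → ∀ x : Vars v ℝ,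
      DifferentiableAt ℂ G (contourPoint γ x + ((u : ℂ) * L) • indVec m K + η))
    (hint : ∀ u ∈ Icc (0:ℝ) 1, ∀ η : Vars v ℂ, (∀ m i, ‖η m i‖ ≤ δ) →
      Integrable fun x : Vars v ℝ =>
        G (contourPoint γ x + ((u : ℂ) * L) • indVec m K + η) * jacobian γ x)
    (hM : ∀ u ∈ Icc (0:ℝ) 1, ∀ η : Vars v ℂ, (∀ m i, ‖η m i‖ ≤ δ) →
      ∫ x : Vars v ℝ,
        ‖G (contourPoint γ x + ((u : ℂ) * L) • indVec m K + η) * jacobian γ x‖ ≤ M) :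
    ∫ x : Vars v ℝ, G (contourPoint γ x + L • indVec m K) * jacobian γ x =
      ∫ x : Vars v ℝ, G (contourPoint γ x) * jacobian γ x := by
  obtain ⟨N, hN⟩ := exists_nat_gt (‖L‖ / δ)
  have hN0 : (0 : ℝ) < N := (div_nonneg (norm_nonneg L) hδ.le).trans_lt hN
  have hNc : (N : ℂ) ≠ 0 := by exact_mod_cast hN0.ne'
  set h : ℂ := L / N with hh
  have hhδ : ‖h‖ < δ := by
    rw [hh, norm_div, Complex.norm_natCast, div_lt_iff₀ hN0]
    rwa [div_lt_iff₀ hδ, mul_comm] at hN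
  -- one of `N` small steps, made in the planes of the variables one after the other
  have hstep : ∀ u ∈ Icc (0:ℝ) 1, ∀ K' ⊆ K,
      ∫ x : Vars v ℝ, G (contourPoint γ x + ((u : ℂ) * L) • indVec m K + h • indVec m K') *
        jacobian γ x =
      ∫ x : Vars v ℝ, G (contourPoint γ x + ((u : ℂ) * L) • indVec m K) * jacobian γ x := by
    intro u hu K'
    induction K' using Finset.induction_on with
    | empty => intro _; simp [indVec_empty]
    | insert i K' hi ih =>
      intro hK'
      rw [← ih ((Finset.subset_insert i K').trans hK')]
      have hbd : ∀ z : ℂ, ‖z‖ ≤ δ → ∀ m' j,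
          ‖(h • indVec m K' + z • unitVec m i : Vars v ℂ) m' j‖ ≤ δ := fun z hz =>
        norm_smul_indVec_add_smul_unitVec_le hi hhδ.le hz
      have hrw : ∀ (x : Vars v ℝ) (z : ℂ),
          contourPoint γ x + (((u : ℂ) * L) • indVec m K + h • indVec m K') + z • unitVec m i =
            contourPoint γ x + ((u : ℂ) * L) • indVec m K +
              (h • indVec m K' + z • unitVec m i) := fun x z => by abel
      have hsh : ∀ s ∈ Icc (0:ℝ) 1, ‖(s : ℂ) * h‖ ≤ δ := by
        intro s hs
        rw [norm_mul, Complex.norm_real, Real.norm_of_nonneg hs.1]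
        nlinarith [norm_nonneg h, hs.2]
      have := integral_translate_unitVec hγ m i (hend i (hK' (Finset.mem_insert_self i K')))
        (((u : ℂ) * L) • indVec m K + h • indVec m K') hhδ (M := M)
        (fun x z hz => by rw [hrw]; exact hG u hu _ (hbd z hz.le) x)
        (fun s hs => by simp only [hrw]; exact hint u hu _ (hbd _ (hsh s hs)))
        (fun s hs => by simp only [hrw]; exact hM u hu _ (hbd _ (hsh s hs)))
      simp only [hrw] at this
      rw [indVec_insert hi, smul_add, this]
      simp only [add_assoc]
  have hall : ∀ j : ℕ, j ≤ N →
      ∫ x : Vars v ℝ, G (contourPoint γ x + (((j / N : ℝ) : ℂ) * L) • indVec m K) *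
        jacobian γ x =
      ∫ x : Vars v ℝ, G (contourPoint γ x) * jacobian γ x := by
    intro j
    induction j with
    | zero => intro _; simp
    | succ j ih =>
      intro hj
      have hu : ((j / N : ℝ)) ∈ Icc (0:ℝ) 1 := by
        refine ⟨by positivity, (div_le_one hN0).2 ?_⟩
        exact_mod_cast (Nat.le_succ j).trans hj
      rw [← ih ((Nat.le_succ j).trans hj), ← hstep _ hu K subset_rfl]
      refine integral_congr_ae (Eventually.of_forall fun x => ?_)
      simp only [add_assoc, ← add_smul]
      congr 4
      rw [hh]
      push_cast
      field_simp
  have := hall N le_rfl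
  rwa [div_self hN0.ne', Complex.ofReal_one, one_mul] at this

end

section

open Filter Topology Set

/-! ### The function `φ` and the factors of the integrand -/

lemma summable_phi {q : ℂ} (hq : ‖q‖ < 1) (x : ℂ) : Summable fun i : ℕ => ‖-(q ^ i * x)‖ := by
  simp only [norm_neg, norm_mul, norm_pow]
  exact (summable_geometric_of_lt_one (norm_nonneg q) hq).mul_right _

lemma phi_eq {q : ℂ} (hq : ‖q‖ < 1) (x : ℂ) : phi q x = (1 - x) * phi q (q * x) := by
  have e : (fun i : ℕ => 1 - q ^ i * (q * x)) = fun i : ℕ => 1 - q ^ (i + 1) * x := by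
    funext i; rw [pow_succ]; ring
  have h : Multipliable fun i : ℕ => 1 - q ^ (i + 1) * x := by
    have := multipliable_one_add_of_summable (summable_phi hq (q * x))
    simp only [← sub_eq_add_neg] at this
    rwa [e] at this
  have h1 := tprod_eq_zero_mul' (f := fun i : ℕ => 1 - q ^ i * x) h
  rw [pow_zero, one_mul, ← e] at h1
  exact h1

lemma phi_one {q : ℂ} (hq : ‖q‖ < 1) : phi q 1 = 0 := by
  rw [phi_eq hq, sub_self, zero_mul]

lemma ne_one_of_phi_ne_zero {q : ℂ} (hq : ‖q‖ < 1) {x : ℂ} (h : phi q x ≠ 0) : x ≠ 1 :=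
  fun h1 => h (h1 ▸ phi_one hq)

lemma differentiable_phi {q : ℂ} (hq : ‖q‖ < 1) : Differentiable ℂ (phi q) := by
  intro x
  have hx : x ∈ Metric.ball (0 : ℂ) (‖x‖ + 1) := by simp
  have h := Summable.hasProdLocallyUniformlyOn_nat_one_add
    (f := fun (i : ℕ) (x : ℂ) => -(q ^ i * x)) (K := Metric.ball (0 : ℂ) (‖x‖ + 1))
    (u := fun i => ‖q‖ ^ i * (‖x‖ + 1)) Metric.isOpen_ball
    ((summable_geometric_of_lt_one (norm_nonneg q) hq).mul_right _)
    (Eventually.of_forall fun i y hy => by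
      rw [norm_neg, norm_mul, norm_pow]
      have : ‖y‖ ≤ ‖x‖ + 1 := by simpa using (mem_ball_zero_iff.1 hy).le
      gcongr) (fun i => by fun_prop)
  have hd : DifferentiableOn ℂ (fun x => ∏' i : ℕ, (1 + -(q ^ i * x)))
      (Metric.ball (0 : ℂ) (‖x‖ + 1)) := by
    refine TendstoLocallyUniformlyOn.differentiableOn h (Eventually.of_forall fun s => ?_)
      Metric.isOpen_ball
    fun_prop
  have h1 := (hd x hx).differentiableAt (Metric.isOpen_ball.mem_nhds hx)
  have e : phi q = fun x => ∏' i : ℕ, (1 + -(q ^ i * x)) := by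
    funext x
    simp only [phi, sub_eq_add_neg]
  rwa [e]

/-- The coefficient of a shift operator in the Macdonald operator. -/
noncomputable def coefA (t : ℂ) {d : ℕ} (K : Finset (Fin d)) (y : Fin d → ℂ) : ℂ :=
  ∏ i ∈ K, ∏ j ∈ Kᶜ,
    (t * Complex.exp (y i) - Complex.exp (y j)) / (Complex.exp (y i) - Complex.exp (y j))

/-- The coefficient of an inverse shift operator in the adjoint of the Macdonald operator. -/
noncomputable def coefB (t : ℂ) {d : ℕ} (K : Finset (Fin d)) (y : Fin d → ℂ) : ℂ :=
  ∏ i ∈ K, ∏ j ∈ Kᶜ,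
    (Complex.exp (y i) - t * Complex.exp (y j)) / (Complex.exp (y i) - Complex.exp (y j))

/-- The effect on the kernel `factorH` of the inverse shifts of the variables `y i`, `i ∈ K`. -/
noncomputable def coefH (L t : ℂ) {d d' : ℕ} (K : Finset (Fin d)) (y : Fin d → ℂ)
    (y' : Fin d' → ℂ) : ℂ :=
  ∏ i ∈ K, ∏ j, (Complex.exp (y' j) - t * Complex.exp (y i - L)) /
    (Complex.exp (y' j) - Complex.exp (y i - L))

/-- The shift `s i ↦ q s i` for `i ∈ K`. -/
def shiftSet (L : ℂ) {d : ℕ} (K : Finset (Fin d)) (y : Fin d → ℂ) : Fin d → ℂ :=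
  fun i => if i ∈ K then y i + L else y i

lemma shiftSet_mem (L : ℂ) {d : ℕ} {K : Finset (Fin d)} (y : Fin d → ℂ) {i : Fin d}
    (hi : i ∈ K) : shiftSet L K y i = y i + L := if_pos hi

lemma shiftSet_notMem (L : ℂ) {d : ℕ} {K : Finset (Fin d)} (y : Fin d → ℂ) {i : Fin d}
    (hi : i ∉ K) : shiftSet L K y i = y i := if_neg hi

variable {L t : ℂ} {d d' : ℕ}

lemma exp_sub_eq_one {a b : ℂ} (h : Complex.exp a = Complex.exp b) : Complex.exp (a - b) = 1 := by
  rw [Complex.exp_sub, h, div_self (Complex.exp_ne_zero _)]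

/-- The integrand vanishes where two variables of a gauge node coincide. -/
lemma factorE_eq_zero {q : ℂ} (hq : ‖q‖ < 1) {y : Fin d → ℂ} {i j : Fin d} (hij : i ≠ j)
    (h : Complex.exp (y i) = Complex.exp (y j)) : factorE q t y = 0 := by
  refine Finset.prod_eq_zero (Finset.mem_univ i)
    (Finset.prod_eq_zero (Finset.mem_erase.2 ⟨hij.symm, Finset.mem_univ j⟩) ?_)
  rw [exp_sub_eq_one h, phi_one hq, zero_div]

lemma prod_offDiag_congr {f g : Fin d → Fin d → ℂ}
    (h : ∀ i j, i ≠ j → f i j * f j i = g i j * g j i) :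
    ∏ i, ∏ j ∈ Finset.univ.erase i, f i j = ∏ i, ∏ j ∈ Finset.univ.erase i, g i j := by
  have key : ∀ f : Fin d → Fin d → ℂ, ∏ i, ∏ j ∈ Finset.univ.erase i, f i j =
      ∏ i, ∏ j ∈ Finset.Ioi i, f i j * f j i := by
    intro f
    rw [Finset.prod_prod_Ioi_mul_eq_prod_prod_off_diag (fun i j => f j i)]
    refine Finset.prod_congr rfl fun i _ => Finset.prod_congr ?_ fun _ _ => rfl
    ext; simp
  rw [key, key]
  exact Finset.prod_congr rfl fun i _ => Finset.prod_congr rfl fun j hj =>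
    h i j (Finset.mem_Ioi.1 hj).ne

/-- A product over `K × Kᶜ` as a product over all pairs of distinct indices. -/
lemma prod_cross_eq (K : Finset (Fin d)) (f : Fin d → Fin d → ℂ) :
    ∏ i ∈ K, ∏ j ∈ Kᶜ, f i j =
      ∏ i, ∏ j ∈ Finset.univ.erase i, if i ∈ K ∧ j ∉ K then f i j else 1 := by
  rw [← Finset.prod_subset (Finset.subset_univ K)]
  · refine Finset.prod_congr rfl fun i hi => ?_
    have hsub : Kᶜ ⊆ Finset.univ.erase i := fun j hj =>
      Finset.mem_erase.2 ⟨fun h => Finset.mem_compl.1 hj (h ▸ hi), Finset.mem_univ j⟩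
    rw [← Finset.prod_subset hsub]
    · exact Finset.prod_congr rfl fun j hj => (if_pos ⟨hi, Finset.mem_compl.1 hj⟩).symm
    · intro j _ hj
      exact if_neg fun h => hj (Finset.mem_compl.2 h.2)
  · intro i _ hi
    exact Finset.prod_eq_one fun j _ => if_neg fun h => hi h.1

/-- The poles of `coefB` are cancelled by zeros of `factorE`.  At `s_i = s_j` the zero is double,
so that the formula also holds with the convention `1 / 0 = 0`. -/
lemma factorE_mul_coefB {q : ℂ} (hq : ‖q‖ < 1) (K : Finset (Fin d)) (y : Fin d → ℂ) :
    factorE q t y * coefB t K y = ∏ i, ∏ j ∈ Finset.univ.erase i,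
      if i ∈ K ∧ j ∉ K then -(phi q (q * Complex.exp (y i - y j)) *
          (Complex.exp (y i - y j) - t)) / phi q (t * Complex.exp (y i - y j))
        else phi q (Complex.exp (y i - y j)) / phi q (t * Complex.exp (y i - y j)) := by
  by_cases hne : ∀ i ∈ K, ∀ j ∉ K, Complex.exp (y i) ≠ Complex.exp (y j)
  · rw [coefB, prod_cross_eq, factorE, ← Finset.prod_mul_distrib]
    refine Finset.prod_congr rfl fun i _ => ?_
    rw [← Finset.prod_mul_distrib]
    refine Finset.prod_congr rfl fun j _ => ?_
    by_cases h : i ∈ K ∧ j ∉ K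
    · rw [if_pos h, if_pos h, phi_eq hq (Complex.exp (y i - y j))]
      have h1 : Complex.exp (y i) = Complex.exp (y i - y j) * Complex.exp (y j) := by
        rw [← Complex.exp_add, sub_add_cancel]
      have h2 : Complex.exp (y i - y j) - 1 ≠ 0 := fun h0 => hne i h.1 j h.2 (by
        rw [h1, sub_eq_zero.1 h0, one_mul])
      have h3 := Complex.exp_ne_zero (y j)
      rw [h1, ← sub_mul,
        show Complex.exp (y i - y j) * Complex.exp (y j) - Complex.exp (y j) =
          (Complex.exp (y i - y j) - 1) * Complex.exp (y j) by ring, mul_div_mul_right _ _ h3]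
      field_simp
      ring
    · rw [if_neg h, if_neg h, mul_one]
  · push Not at hne
    obtain ⟨i, hi, j, hj, hij⟩ := hne
    have hne : i ≠ j := fun h => hj (h ▸ hi)
    rw [factorE_eq_zero hq hne hij, zero_mul]
    symm
    refine Finset.prod_eq_zero (Finset.mem_univ j)
      (Finset.prod_eq_zero (Finset.mem_erase.2 ⟨hne, Finset.mem_univ i⟩) ?_)
    rw [if_neg (fun h => hj h.1), exp_sub_eq_one hij.symm, phi_one hq, zero_div]

/-- `factorE` times the coefficient of the Macdonald operator. -/
lemma factorE_mul_coefA {q : ℂ} (hq : ‖q‖ < 1) (K : Finset (Fin d)) (y : Fin d → ℂ)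
    (hy : ∀ i j, i ≠ j → phi q (t * Complex.exp (y i - y j)) ≠ 0) :
    factorE q t y * coefA t K y = ∏ i, ∏ j ∈ Finset.univ.erase i,
      if i ∈ K ∧ j ∉ K then phi q (q * Complex.exp (y i - y j)) /
          phi q (q * (t * Complex.exp (y i - y j)))
        else phi q (Complex.exp (y i - y j)) / phi q (t * Complex.exp (y i - y j)) := by
  by_cases hne : ∀ i ∈ K, ∀ j ∉ K, Complex.exp (y i) ≠ Complex.exp (y j)
  · rw [coefA, prod_cross_eq, factorE, ← Finset.prod_mul_distrib]
    refine Finset.prod_congr rfl fun i _ => ?_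
    rw [← Finset.prod_mul_distrib]
    refine Finset.prod_congr rfl fun j hj => ?_
    by_cases h : i ∈ K ∧ j ∉ K
    · have h0 := hy i j (Finset.mem_erase.1 hj).1.symm
      rw [phi_eq hq] at h0
      rw [if_pos h, if_pos h, phi_eq hq (Complex.exp (y i - y j)),
        phi_eq hq (t * Complex.exp (y i - y j))]
      have h1 : Complex.exp (y i) = Complex.exp (y i - y j) * Complex.exp (y j) := by
        rw [← Complex.exp_add, sub_add_cancel]
      have h2 : Complex.exp (y i - y j) - 1 ≠ 0 := fun h0 => hne i h.1 j h.2 (by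
        rw [h1, sub_eq_zero.1 h0, one_mul])
      have h3 := Complex.exp_ne_zero (y j)
      have h4 := left_ne_zero_of_mul h0
      have h5 := right_ne_zero_of_mul h0
      rw [h1, show t * (Complex.exp (y i - y j) * Complex.exp (y j)) - Complex.exp (y j) =
          (t * Complex.exp (y i - y j) - 1) * Complex.exp (y j) by ring,
        show Complex.exp (y i - y j) * Complex.exp (y j) - Complex.exp (y j) =
          (Complex.exp (y i - y j) - 1) * Complex.exp (y j) by ring, mul_div_mul_right _ _ h3]
      generalize phi q (q * (t * Complex.exp (y i - y j))) = P at *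
      generalize phi q (q * Complex.exp (y i - y j)) = P' at *
      generalize Complex.exp (y i - y j) = X at *
      rw [div_mul_div_comm, div_eq_div_iff (mul_ne_zero h0 h2) h5]
      ring
    · rw [if_neg h, if_neg h, mul_one]
  · push Not at hne
    obtain ⟨i, hi, j, hj, hij⟩ := hne
    have hne : i ≠ j := fun h => hj (h ▸ hi)
    rw [factorE_eq_zero hq hne hij, zero_mul]
    symm
    refine Finset.prod_eq_zero (Finset.mem_univ j)
      (Finset.prod_eq_zero (Finset.mem_erase.2 ⟨hne, Finset.mem_univ i⟩) ?_)
    rw [if_neg (fun h => hj h.1), exp_sub_eq_one hij.symm, phi_one hq, zero_div]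

/-- The Macdonald operator and its formal adjoint with respect to the weight `factorE`. -/
lemma factorE_mul_coefB_shiftSet (hq : ‖Complex.exp L‖ < 1) (K : Finset (Fin d))
    (y : Fin d → ℂ)
    (hy : ∀ i j, i ≠ j → phi (Complex.exp L) (t * Complex.exp (y i - y j)) ≠ 0)
    (hy' : ∀ i j, i ≠ j → phi (Complex.exp L)
      (t * Complex.exp (shiftSet L K y i - shiftSet L K y j)) ≠ 0) :
    factorE (Complex.exp L) t (shiftSet L K y) * coefB t K (shiftSet L K y) =
      factorE (Complex.exp L) t y * coefA t K y := by
  rw [factorE_mul_coefB hq, factorE_mul_coefA hq K y hy]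
  set q := Complex.exp L with hqL
  have hq0 : q ≠ 0 := Complex.exp_ne_zero L
  refine prod_offDiag_congr fun i j hij => ?_
  -- the contribution of a pair `i ∈ K`, `j ∉ K`
  have key : ∀ i ∈ K, ∀ j ∉ K,
      -(phi q (q * Complex.exp (y i + L - y j)) * (Complex.exp (y i + L - y j) - t)) /
          phi q (t * Complex.exp (y i + L - y j)) *
        (phi q (Complex.exp (y j - (y i + L))) / phi q (t * Complex.exp (y j - (y i + L)))) =
      phi q (q * Complex.exp (y i - y j)) / phi q (q * (t * Complex.exp (y i - y j))) *
        (phi q (Complex.exp (y j - y i)) / phi q (t * Complex.exp (y j - y i))) := by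
    intro i hi j hj
    have hij : i ≠ j := fun h => hj (h ▸ hi)
    have h1 := hy' j i hij.symm
    rw [shiftSet_mem L y hi, shiftSet_notMem L y hj] at h1
    set X := Complex.exp (y i - y j) with hX
    have hX0 : X ≠ 0 := Complex.exp_ne_zero _
    have e1 : Complex.exp (y i + L - y j) = q * X := by
      rw [hX, hqL, ← Complex.exp_add]; ring_nf
    have e2 : Complex.exp (y j - (y i + L)) = (q * X)⁻¹ := by
      rw [← e1, ← Complex.exp_neg]; ring_nf
    have e3 : Complex.exp (y j - y i) = q * (q * X)⁻¹ := by
      rw [mul_inv, mul_inv_cancel_left₀ hq0, hX, ← Complex.exp_neg]; ring_nf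
    rw [e2] at h1
    rw [e1, e2, e3, phi_eq hq (q * X), phi_eq hq (q * X)⁻¹, phi_eq hq (t * (q * X)⁻¹)]
    rw [phi_eq hq (t * (q * X)⁻¹)] at h1
    have h2 := left_ne_zero_of_mul h1
    have h4 : q * X ≠ 0 := mul_ne_zero hq0 hX0
    rw [show q * (t * (q * X)⁻¹) = t * (q * (q * X)⁻¹) by ring,
      show q * (t * X) = t * (q * X) by ring]
    generalize phi q (q * (q * X)) = P1
    generalize phi q (t * (q * X)) = P2
    generalize phi q (q * (q * X)⁻¹) = P3
    generalize phi q (t * (q * (q * X)⁻¹)) = P4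
    have e5 : (1 - (q * X)⁻¹) = (q * X - 1) / (q * X) := by field_simp
    have e6 : (1 - t * (q * X)⁻¹) = (q * X - t) / (q * X) := by field_simp
    rw [e6] at h2
    have h7 : q * X - t ≠ 0 := fun h0 => h2 (by rw [h0, zero_div])
    rw [e5, e6, mul_div_mul_comm ((q * X - 1) / (q * X)), div_div_div_cancel_right₀ h4]
    generalize q * X = Z at *
    have : (Z - 1) / (Z - t) * (Z - t) = Z - 1 := div_mul_cancel₀ _ h7
    linear_combination (-(P1 / P2) * (P3 / P4)) * this
  by_cases hi : i ∈ K <;> by_cases hj : j ∈ K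
  · simp [hi, hj, shiftSet_mem]
  · simpa [hi, hj, shiftSet_mem, shiftSet_notMem] using key i hi j hj
  · have := key j hj i hi
    simp only [hi, hj, shiftSet_mem, shiftSet_notMem, not_true_eq_false, not_false_eq_true,
      and_self, if_true, if_false]
    rw [mul_comm, this, mul_comm]
  · simp [hi, hj, shiftSet_notMem]

lemma factorH_shiftSet_mul_coefH (hq : ‖Complex.exp L‖ < 1) (K : Finset (Fin d))
    (y : Fin d → ℂ) (y' : Fin d' → ℂ)
    (hy : ∀ i j, phi (Complex.exp L) (Complex.exp (y i - y' j)) ≠ 0) :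
    factorH (Complex.exp L) t (shiftSet L K y) y' * coefH L t K (shiftSet L K y) y' =
      factorH (Complex.exp L) t y y' := by
  have h : coefH L t K (shiftSet L K y) y' = ∏ i, if i ∈ K then
      ∏ j, (Complex.exp (y' j) - t * Complex.exp (y i)) /
        (Complex.exp (y' j) - Complex.exp (y i)) else 1 := by
    rw [coefH, Finset.prod_ite_mem, Finset.univ_inter]
    refine Finset.prod_congr rfl fun i hi => Finset.prod_congr rfl fun j _ => ?_
    rw [shiftSet_mem L y hi, add_sub_cancel_right]
  rw [h, factorH, factorH, ← Finset.prod_mul_distrib]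
  refine Finset.prod_congr rfl fun i _ => ?_
  by_cases hi : i ∈ K
  · rw [if_pos hi, ← Finset.prod_mul_distrib]
    refine Finset.prod_congr rfl fun j _ => ?_
    have h0 := hy i j
    rw [shiftSet_mem L y hi]
    set q := Complex.exp L
    set X := Complex.exp (y i - y' j) with hX
    have e1 : Complex.exp (y i + L - y' j) = q * X := by
      rw [hX, ← Complex.exp_add]; ring_nf
    have e2 : Complex.exp (y i) = X * Complex.exp (y' j) := by
      rw [hX, ← Complex.exp_add]; ring_nf
    have h3 := Complex.exp_ne_zero (y' j)
    have h4 : 1 - X ≠ 0 := fun h => ne_one_of_phi_ne_zero hq h0 (sub_eq_zero.1 h).symm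
    rw [e1, e2, phi_eq hq X, phi_eq hq (t * X), mul_left_comm t q X]
    rw [show Complex.exp (y' j) - t * (X * Complex.exp (y' j)) =
        (1 - t * X) * Complex.exp (y' j) by ring,
      show Complex.exp (y' j) - X * Complex.exp (y' j) = (1 - X) * Complex.exp (y' j) by ring,
      mul_div_mul_right _ _ h3, mul_div_mul_comm]
    ring
  · rw [if_neg hi, mul_one]
    refine Finset.prod_congr rfl fun j _ => ?_
    rw [shiftSet_notMem L y hi]

/-- The effect on `factorH` of the shifts of the variables in the second argument. -/
lemma factorH_shiftSet_right (hq : ‖Complex.exp L‖ < 1) (I : Finset (Fin d'))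
    (y : Fin d → ℂ) (y' : Fin d' → ℂ) :
    factorH (Complex.exp L) t y (shiftSet L I y') =
      factorH (Complex.exp L) t y y' * ∏ j ∈ I, ∏ i,
        (Complex.exp (y' j) - t * Complex.exp (y i - L)) /
          (Complex.exp (y' j) - Complex.exp (y i - L)) := by
  have h : (∏ j ∈ I, ∏ i, (Complex.exp (y' j) - t * Complex.exp (y i - L)) /
          (Complex.exp (y' j) - Complex.exp (y i - L))) = ∏ i, ∏ j, if j ∈ I then
      (Complex.exp (y' j) - t * Complex.exp (y i - L)) /
          (Complex.exp (y' j) - Complex.exp (y i - L)) else 1 := by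
    rw [Finset.prod_comm]
    refine Finset.prod_congr rfl fun i _ => ?_
    rw [Finset.prod_ite_mem, Finset.univ_inter]
  rw [h, factorH, factorH, ← Finset.prod_mul_distrib]
  refine Finset.prod_congr rfl fun i _ => ?_
  rw [← Finset.prod_mul_distrib]
  refine Finset.prod_congr rfl fun j _ => ?_
  by_cases hj : j ∈ I
  · rw [if_pos hj, shiftSet_mem L y' hj]
    set q := Complex.exp L
    set X := Complex.exp (y i - (y' j + L)) with hX
    have e1 : Complex.exp (y i - y' j) = q * X := by
      rw [hX, ← Complex.exp_add]; ring_nf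
    have e2 : Complex.exp (y i - L) = X * Complex.exp (y' j) := by
      rw [hX, ← Complex.exp_add]; ring_nf
    have h3 := Complex.exp_ne_zero (y' j)
    rw [e1, e2, phi_eq hq X, phi_eq hq (t * X), mul_left_comm t q X]
    rw [show Complex.exp (y' j) - t * (X * Complex.exp (y' j)) =
        (1 - t * X) * Complex.exp (y' j) by ring,
      show Complex.exp (y' j) - X * Complex.exp (y' j) = (1 - X) * Complex.exp (y' j) by ring,
      mul_div_mul_right _ _ h3, mul_div_mul_comm]
    ring
  · rw [if_neg hj, mul_one, shiftSet_notMem L y' hj]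

end

section

open MeasureTheory Filter Topology Set

/-! ### Integrability of the integrand after cancellation of poles -/

lemma half_norm_le_norm_exp_sub_one {w : ℂ} (hw : ‖w‖ ≤ 1 / 2) : ‖w‖ / 2 ≤ ‖Complex.exp w - 1‖ := by
  have h1 := Complex.norm_exp_sub_one_sub_id_le (hw.trans (by norm_num))
  have h2 : ‖w‖ ≤ ‖Complex.exp w - 1‖ + ‖Complex.exp w - 1 - w‖ := by
    calc ‖w‖ = ‖(Complex.exp w - 1) - (Complex.exp w - 1 - w)‖ := by ring_nf
      _ ≤ _ := norm_sub_le _ _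
  nlinarith [norm_nonneg w]

/-- If two points `x exp z` and `x exp z'` with small `z`, `z'` are close to `1`, then `z` and `z'`
are close to each other. -/
lemma norm_sub_lt_of_exp_near_one {x z z' : ℂ} {ε : ℝ} (hε : ε ≤ 1 / 2) (hz : ‖z‖ ≤ 1 / 4)
    (hz' : ‖z'‖ ≤ 1 / 4) (h : ‖x * Complex.exp z - 1‖ < ε)
    (h' : ‖x * Complex.exp z' - 1‖ < ε) : ‖z - z'‖ < 8 * ε := by
  have hw : ‖z - z'‖ ≤ 1 / 2 := (norm_sub_le _ _).trans (by linarith)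
  have h1 := half_norm_le_norm_exp_sub_one hw
  set B := x * Complex.exp z' with hB
  have h2 : x * Complex.exp z = B * Complex.exp (z - z') := by
    rw [hB, mul_assoc, ← Complex.exp_add]; ring_nf
  have h3 : 1 / 2 ≤ ‖B‖ := by
    have : (1 : ℝ) ≤ ‖B - 1‖ + ‖B‖ := by
      calc (1 : ℝ) = ‖(1 : ℂ)‖ := by simp
        _ = ‖B - (B - 1)‖ := by ring_nf
        _ ≤ ‖B‖ + ‖B - 1‖ := norm_sub_le _ _
        _ = _ := add_comm _ _
    linarith
  have h4 : ‖B‖ * ‖Complex.exp (z - z') - 1‖ < 2 * ε := by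
    rw [← norm_mul]
    calc ‖B * (Complex.exp (z - z') - 1)‖ = ‖(x * Complex.exp z - 1) - (B - 1)‖ := by
          rw [h2]; ring_nf
      _ ≤ ‖x * Complex.exp z - 1‖ + ‖B - 1‖ := norm_sub_le _ _
      _ < 2 * ε := by linarith
  nlinarith [norm_nonneg (Complex.exp (z - z') - 1)]

/-- Among `N + 1` fixed circles around `0` there is, for any `N` functions `x exp z - 1`, one
on which none of them is small. -/
lemma exists_radii (δ : ℝ) (hδ : 0 < δ) (N : ℕ) :
    ∃ ε : ℝ, 0 < ε ∧ ∃ radii : Finset ℝ, (∀ ρ ∈ radii, 0 < ρ ∧ ρ ≤ δ) ∧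
      ∀ {ι : Type} (P : Finset ι), P.card ≤ N → ∀ x : ι → ℂ,
        ∃ ρ ∈ radii, ∀ p ∈ P, ∀ z : ℂ, ‖z‖ = ρ → ε ≤ ‖x p * Complex.exp z - 1‖ := by
  set δ₀ := min δ (1 / 4) with hδ₀
  have hδ₀pos : 0 < δ₀ := lt_min hδ (by norm_num)
  set g := δ₀ / (N + 1) with hg
  have hN : (0 : ℝ) < N + 1 := by positivity
  have hgpos : 0 < g := by positivity
  have hgle : g ≤ 1 / 4 := (div_le_self hδ₀pos.le (by linarith)).trans (min_le_right _ _)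
  have hrad : ∀ j ∈ Finset.range (N + 1), g * (j + 1) ≤ δ₀ := by
    intro j hj
    have : (j : ℝ) + 1 ≤ N + 1 := by exact_mod_cast Finset.mem_range.1 hj
    calc g * (j + 1) ≤ g * (N + 1) := by gcongr
      _ = δ₀ := div_mul_cancel₀ _ hN.ne'
  refine ⟨g / 8, by positivity, (Finset.range (N + 1)).image fun j : ℕ => g * (j + 1), ?_, ?_⟩
  · intro ρ hρ
    obtain ⟨j, hj, rfl⟩ := Finset.mem_image.1 hρ
    exact ⟨by positivity, (hrad j hj).trans (min_le_left _ _)⟩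
  · intro ι P hP x
    by_contra! hcon
    have hcon' : ∀ j : ℕ, j ∈ Finset.range (N + 1) →
        ∃ p ∈ P, ∃ z : ℂ, ‖z‖ = g * (j + 1) ∧ ‖x p * Complex.exp z - 1‖ < g / 8 :=
      fun j hj => hcon _ (Finset.mem_image_of_mem _ hj)
    obtain ⟨p₀, -⟩ := hcon' 0 (by simp)
    have : Nonempty ι := ⟨p₀⟩
    choose! p hp z hz hzx using hcon'
    obtain ⟨i, hi, j, hj, hij, hpij⟩ := Finset.exists_ne_map_eq_of_card_lt_of_maps_to
      (s := Finset.range (N + 1)) (t := P) (by simpa using Nat.lt_succ_of_le hP) (f := p) hp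
    have hle : ∀ j ∈ Finset.range (N + 1), ‖z j‖ ≤ 1 / 4 := fun j hj => by
      rw [hz j hj]; exact (hrad j hj).trans (min_le_right _ _)
    have h1 := norm_sub_lt_of_exp_near_one (by linarith) (hle i hi) (hle j hj) (hzx i hi)
      (hpij ▸ hzx j hj)
    have h2 : |g * ((i : ℝ) + 1) - g * (j + 1)| ≤ ‖z i - z j‖ := by
      rw [← hz i hi, ← hz j hj]; exact abs_norm_sub_norm_le _ _
    have h3 : (1 : ℝ) ≤ |(i : ℝ) - j| := by
      have : (1 : ℤ) ≤ |(i : ℤ) - j| := Int.one_le_abs (sub_ne_zero.2 (by exact_mod_cast hij))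
      exact_mod_cast this
    rw [← mul_sub, abs_mul, abs_of_pos hgpos, add_sub_add_right_eq_sub] at h2
    nlinarith

/-- If `exp` avoids the value `1` on a disc of radius `δ`, then it has a definite distance from `1`
at its centre. -/
lemma exists_le_norm_exp_sub_one (δ : ℝ) (hδ : 0 < δ) :
    ∃ ε : ℝ, 0 < ε ∧ ∀ w : ℂ, (∀ η : ℂ, ‖η‖ ≤ δ → Complex.exp (w + η) ≠ 1) →
      ε ≤ ‖Complex.exp w - 1‖ := by
  have hc : ContinuousAt Complex.log 1 := continuousAt_clog (by simp)
  have hev : ∀ᶠ x in 𝓝 (1 : ℂ), ‖Complex.log x‖ < δ ∧ x ≠ 0 := by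
    refine ((hc.norm).eventually (gt_mem_nhds ?_)).and (isOpen_ne.mem_nhds one_ne_zero)
    simpa using hδ
  obtain ⟨ε, hε, hball⟩ := Metric.eventually_nhds_iff.1 hev
  refine ⟨ε, hε, fun w hw => ?_⟩
  by_contra! hlt
  obtain ⟨h1, h2⟩ := hball (show dist (Complex.exp w) 1 < ε by rwa [dist_eq_norm])
  refine hw (-Complex.log (Complex.exp w)) (by rw [norm_neg]; exact h1.le) ?_
  rw [Complex.exp_add, Complex.exp_neg, Complex.exp_log h2, mul_inv_cancel₀ h2]

lemma norm_sub_div_sub_one_le {t x : ℂ} {ε : ℝ} (hε : 0 < ε) (hx : ε ≤ ‖x - 1‖) :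
    ‖(x - t) / (x - 1)‖ ≤ 1 + (1 + ‖t‖) / ε := by
  have h0 : x - 1 ≠ 0 := fun h => by rw [h, norm_zero] at hx; linarith
  have h1 : (x - t) / (x - 1) = 1 + (1 - t) / (x - 1) := by field_simp; ring
  rw [h1]
  refine (norm_add_le _ _).trans ?_
  rw [norm_one, norm_div]
  gcongr
  exact (norm_sub_le _ _).trans (by simp)

lemma norm_one_sub_div_one_sub_le {t x : ℂ} {ε : ℝ} (hε : 0 < ε) (hx : ε ≤ ‖x - 1‖) :
    ‖(1 - t * x) / (1 - x)‖ ≤ ‖t‖ + (1 + ‖t‖) / ε := by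
  have h0 : 1 - x ≠ 0 := fun h => by
    rw [← neg_sub, h, neg_zero, norm_zero] at hx; linarith
  have h1 : (1 - t * x) / (1 - x) = t + (1 - t) / (1 - x) := by field_simp; ring
  rw [h1]
  refine (norm_add_le _ _).trans ?_
  rw [norm_div, norm_sub_rev 1 x]
  gcongr
  exact (norm_sub_le _ _).trans (by simp)

variable {k : ℕ} {v : Fin (k + 1) → ℕ}

/-- A holomorphic function `G` is absolutely integrable over a product contour if it is bounded
by `F` on one of finitely many circles around each point of the contour, and `F` is absolutely
integrable over the contours translated along these circles.  This is the mean value property. -/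
lemma integrable_of_circle_bound {F G : Vars v ℂ → ℂ} {γ : Vars v (ℝ → ℂ)}
    (hγ : ∀ m i, ContDiff ℝ 1 (γ m i)) (w e : Vars v ℂ) {C M : ℝ} (hC : 0 ≤ C)
    (radii : Finset ℝ) (hpos : ∀ ρ ∈ radii, 0 < ρ)
    (hG : ∀ ρ ∈ radii, ∀ z : ℂ, ‖z‖ ≤ ρ → ∀ x : Vars v ℝ,
      DifferentiableAt ℂ G (contourPoint γ x + w + z • e))
    (hF : ∀ ρ ∈ radii, ∀ z : ℂ, ‖z‖ ≤ ρ → ∀ x : Vars v ℝ,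
      ContinuousAt F (contourPoint γ x + w + z • e))
    (hFint : ∀ ρ ∈ radii, ∀ z : ℂ, ‖z‖ ≤ ρ → Integrable fun x : Vars v ℝ =>
      F (contourPoint γ x + w + z • e) * jacobian γ x)
    (hM : ∀ ρ ∈ radii, ∀ z : ℂ, ‖z‖ ≤ ρ → ∫ x : Vars v ℝ,
      ‖F (contourPoint γ x + w + z • e) * jacobian γ x‖ ≤ M)
    (hbd : ∀ x : Vars v ℝ, ∃ ρ ∈ radii, ∀ z : ℂ, ‖z‖ = ρ →
      ‖G (contourPoint γ x + w + z • e)‖ ≤ C * ‖F (contourPoint γ x + w + z • e)‖) :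
    Integrable (fun x : Vars v ℝ => G (contourPoint γ x + w) * jacobian γ x) ∧
      ∫ x : Vars v ℝ, ‖G (contourPoint γ x + w) * jacobian γ x‖ ≤ radii.card * (C * M) := by
  set μ := volume.restrict (Ioc (0:ℝ) (2 * Real.pi)) with hμ
  have hcm : ∀ ρ ∈ radii, ∀ θ : ℝ, ‖circleMap 0 ρ θ‖ = ρ := fun ρ hρ θ => by
    rw [norm_circleMap_zero, abs_of_pos (hpos ρ hρ)]
  -- the integrand as a function of the angle and the parameter of the contour
  let Φ : ℝ → ℝ × Vars v ℝ → ℂ := fun ρ p =>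
    F (contourPoint γ p.2 + w + circleMap 0 ρ p.1 • e) * jacobian γ p.2
  have hΦc : ∀ ρ ∈ radii, Continuous (Φ ρ) := by
    intro ρ hρ
    refine continuous_iff_continuousAt.2 fun p => ?_
    have h1 := hF ρ hρ (circleMap 0 ρ p.1) (hcm ρ hρ _).le p.2
    have h2 : Continuous fun p : ℝ × Vars v ℝ =>
        contourPoint γ p.2 + w + circleMap 0 ρ p.1 • e := by
      have h3 := continuous_contourPoint hγ
      have h4 := continuous_circleMap 0 ρ
      fun_prop
    exact (ContinuousAt.comp (f := fun p : ℝ × Vars v ℝ =>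
      contourPoint γ p.2 + w + circleMap 0 ρ p.1 • e) h1 h2.continuousAt).mul
        ((continuous_jacobian hγ).comp continuous_snd).continuousAt
  have hslice : ∀ ρ ∈ radii, ∀ θ : ℝ, Integrable fun x => Φ ρ (θ, x) := fun ρ hρ θ =>
    hFint ρ hρ (circleMap 0 ρ θ) (hcm ρ hρ θ).le
  have hsliceM : ∀ ρ ∈ radii, ∀ θ : ℝ, ∫ x, ‖Φ ρ (θ, x)‖ ≤ M := fun ρ hρ θ =>
    hM ρ hρ (circleMap 0 ρ θ) (hcm ρ hρ θ).le
  have hΦnorm : ∀ ρ θ x, ‖Φ ρ (θ, x)‖ =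
      ‖F (contourPoint γ x + w + circleMap 0 ρ θ • e)‖ * ‖jacobian γ x‖ := fun ρ θ x =>
    norm_mul _ _
  clear_value Φ
  have hΦi : ∀ ρ ∈ radii, Integrable (Φ ρ) (μ.prod volume) := by
    intro ρ hρ
    have hmeas : AEStronglyMeasurable (Φ ρ) (μ.prod volume) := (hΦc ρ hρ).aestronglyMeasurable
    refine (integrable_prod_iff hmeas).2
      ⟨Eventually.of_forall fun θ => hslice ρ hρ θ, ?_⟩
    refine Integrable.of_bound hmeas.norm.integral_prod_right' M (Eventually.of_forall fun θ => ?_)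
    rw [Real.norm_of_nonneg (integral_nonneg fun _ => norm_nonneg _)]
    exact hsliceM ρ hρ θ
  have hΦn : ∀ ρ ∈ radii, Integrable (fun θ => ∫ x, ‖Φ ρ (θ, x)‖) μ := fun ρ hρ =>
    (hΦi ρ hρ).norm.integral_prod_left
  let A : ℝ → Vars v ℝ → ℝ := fun ρ x => (2 * Real.pi)⁻¹ * ∫ θ, ‖Φ ρ (θ, x)‖ ∂μ
  have hAi : ∀ ρ ∈ radii, Integrable (A ρ) := fun ρ hρ => by
    have h1 : Integrable (fun x => ∫ θ, ‖Φ ρ (θ, x)‖ ∂μ) := (hΦi ρ hρ).norm.integral_prod_right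
    exact h1.const_mul _
  have hAM : ∀ ρ ∈ radii, ∫ x, A ρ x ≤ M := by
    intro ρ hρ
    have h2pi := Real.two_pi_pos
    simp only [A]
    have h0 : ∫ θ, (∫ x, ‖Φ ρ (θ, x)‖) ∂μ = ∫ x, (∫ θ, ‖Φ ρ (θ, x)‖ ∂μ) :=
      integral_integral_swap (hΦi ρ hρ).norm
    rw [integral_const_mul, ← h0]
    have h1 : ∫ θ, (∫ x, ‖Φ ρ (θ, x)‖) ∂μ ≤ ∫ _θ, M ∂μ :=
      integral_mono (hΦn ρ hρ) (integrable_const M)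
        fun θ => hsliceM ρ hρ θ
    have h2 : ∫ _θ, M ∂μ = 2 * Real.pi * M := by
      rw [integral_const]
      simp [hμ, Measure.real, Real.pi_pos.le]
    rw [h2] at h1
    calc _ ≤ (2 * Real.pi)⁻¹ * (2 * Real.pi * M) := by gcongr
      _ = M := by field_simp
  have hbound : ∀ x : Vars v ℝ, ‖G (contourPoint γ x + w) * jacobian γ x‖ ≤
      C * ∑ ρ ∈ radii, A ρ x := by
    intro x
    obtain ⟨ρ, hρ, hb⟩ := hbd x
    have hρ0 := hpos ρ hρ
    -- the mean value property, and the bound on the circle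
    have hd : DiffContOnCl ℂ (fun z : ℂ => G (contourPoint γ x + w + z • e))
        (Metric.ball 0 |ρ|) := by
      refine DifferentiableOn.diffContOnCl fun z hz => ?_
      rw [abs_of_pos hρ0, closure_ball _ hρ0.ne', mem_closedBall_zero_iff] at hz
      exact (DifferentiableAt.comp (f := fun z : ℂ => contourPoint γ x + w + z • e) z
        (hG ρ hρ z hz x) (by fun_prop)).differentiableWithinAt
    have hmean := hd.circleAverage
    rw [Real.circleAverage_def, zero_smul, add_zero] at hmean
    rw [← hmean, norm_mul, norm_smul, Real.norm_of_nonneg (by positivity)]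
    have h1 : ‖∫ θ in (0:ℝ)..2 * Real.pi, G (contourPoint γ x + w + circleMap 0 ρ θ • e)‖ *
        ‖jacobian γ x‖ ≤ C * ∫ θ, ‖Φ ρ (θ, x)‖ ∂μ := by
      have hcont : Continuous fun θ => Φ ρ (θ, x) := (hΦc ρ hρ).comp (by fun_prop)
      rw [← integral_const_mul, hμ, ← intervalIntegral.integral_of_le Real.two_pi_pos.le,
        ← norm_mul, ← intervalIntegral.integral_mul_const]
      refine intervalIntegral.norm_integral_le_of_norm_le Real.two_pi_pos.le
        (Eventually.of_forall fun θ _ => ?_)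
        ((hcont.norm.const_mul C).intervalIntegrable _ _)
      rw [norm_mul, hΦnorm, ← mul_assoc]
      exact mul_le_mul_of_nonneg_right (hb _ (hcm ρ hρ θ)) (norm_nonneg _)
    calc _ = (2 * Real.pi)⁻¹ *
          (‖∫ θ in (0:ℝ)..2 * Real.pi, G (contourPoint γ x + w + circleMap 0 ρ θ • e)‖ *
        ‖jacobian γ x‖) := by ring
      _ ≤ (2 * Real.pi)⁻¹ * (C * ∫ θ, ‖Φ ρ (θ, x)‖ ∂μ) := by
          have := Real.two_pi_pos
          gcongr
      _ = C * A ρ x := by simp only [A]; ring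
      _ ≤ C * ∑ ρ ∈ radii, A ρ x := by
          refine mul_le_mul_of_nonneg_left ?_ hC
          exact Finset.single_le_sum (f := fun ρ => A ρ x) (fun ρ' _ => by
            have := Real.two_pi_pos
            exact mul_nonneg (by positivity) (integral_nonneg fun _ => norm_nonneg _)) hρ
  have hsum : Integrable fun x => C * ∑ ρ ∈ radii, A ρ x :=
    (integrable_finsetSum _ hAi).const_mul C
  have hGc : Continuous fun x : Vars v ℝ => G (contourPoint γ x + w) * jacobian γ x := by
    refine continuous_iff_continuousAt.2 fun x => ?_
    obtain ⟨ρ, hρ, -⟩ := hbd x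
    have h1 := (hG ρ hρ 0 (by simpa using (hpos ρ hρ).le) x).continuousAt
    rw [zero_smul, add_zero] at h1
    exact (ContinuousAt.comp (f := fun x : Vars v ℝ => contourPoint γ x + w) h1
      ((continuous_contourPoint hγ).add continuous_const).continuousAt).mul
        (continuous_jacobian hγ).continuousAt
  have hGi : Integrable fun x : Vars v ℝ => G (contourPoint γ x + w) * jacobian γ x :=
    hsum.mono' hGc.aestronglyMeasurable (Eventually.of_forall hbound)
  refine ⟨hGi, (integral_mono hGi.norm hsum hbound).trans ?_⟩
  rw [integral_const_mul, integral_finsetSum _ hAi]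
  calc C * ∑ ρ ∈ radii, ∫ x, A ρ x ≤ C * ∑ ρ ∈ radii, M := by
        gcongr with ρ hρ
        exact hAM ρ hρ
    _ = radii.card * (C * M) := by rw [Finset.sum_const, nsmul_eq_mul]; ring

end

section

open Filter Topology Set

/-! ### Shifts in the variables of one node -/

variable {k : ℕ} {v : Fin (k + 1) → ℕ} {L t : ℂ} {ω : Fin (k + 1) → ℂ}

/-- The integrand, with separate copies `Y`, `Y'` of the variables: `Y'` takes the place of `Y`
in the factors that link the variables of a node to those of the preceding node. -/
noncomputable def mixed (L t : ℂ) (v : Fin (k + 1) → ℕ) (ω : Fin (k + 1) → ℂ)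
    (Y Y' : (m : Fin (k + 1)) → Fin (v m) → ℂ) : ℂ :=
  ∏ m : Fin k, (factorE (Complex.exp L) t (Y m.castSucc) *
    (∏ i, Complex.exp ((ω m.castSucc - ω m.succ) * Y m.castSucc i / L)) *
    factorH (Complex.exp L) t (Y m.castSucc) (Y' m.succ))

/-- The shift of the variables of the node `m` with indices in `K`. -/
def shiftNode (L : ℂ) (m : Fin (k + 1)) (K : Finset (Fin (v m)))
    (Y : (m : Fin (k + 1)) → Fin (v m) → ℂ) : (m : Fin (k + 1)) → Fin (v m) → ℂ :=
  Function.update Y m (shiftSet L K (Y m))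

lemma shiftNode_self (m : Fin (k + 1)) (K : Finset (Fin (v m)))
    (Y : (m : Fin (k + 1)) → Fin (v m) → ℂ) : shiftNode L m K Y m = shiftSet L K (Y m) :=
  Function.update_self ..

lemma shiftNode_of_ne {m m' : Fin (k + 1)} (h : m' ≠ m) (K : Finset (Fin (v m)))
    (Y : (m : Fin (k + 1)) → Fin (v m) → ℂ) : shiftNode L m K Y m' = Y m' :=
  Function.update_of_ne h ..

lemma withFraming_castSucc (y : Vars v ℂ) (b : Fin (v (Fin.last k)) → ℂ) (m : Fin k) :
    withFraming y b m.castSucc = y m := by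
  simp [withFraming]

lemma withFraming_last (y : Vars v ℂ) (b : Fin (v (Fin.last k)) → ℂ) :
    withFraming y b (Fin.last k) = b := by
  simp [withFraming]

lemma integrand_eq_mixed (b : Fin (v (Fin.last k)) → ℂ) (y : Vars v ℂ) :
    integrand L t v ω b y = mixed L t v ω (withFraming y b) (withFraming y b) := by
  simp only [integrand, mixed, withFraming_castSucc]

lemma shiftNode_castSucc_withFraming (j : Fin k) (K : Finset (Fin (v j.castSucc)))
    (y : Vars v ℂ) (b : Fin (v (Fin.last k)) → ℂ) :
    shiftNode L j.castSucc K (withFraming y b) = withFraming (y + L • indVec j K) b := by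
  funext m
  cases m using Fin.lastCases with
  | last =>
    rw [shiftNode_of_ne (Fin.castSucc_lt_last j).ne', withFraming_last, withFraming_last]
  | cast m =>
    by_cases h : m = j
    · subst h
      rw [shiftNode_self, withFraming_castSucc, withFraming_castSucc]
      funext i
      simp only [shiftSet, Pi.add_apply, Pi.smul_apply, indVec_apply_self]
      split_ifs <;> simp
    · rw [shiftNode_of_ne (fun h' => h (Fin.castSucc_injective k h')), withFraming_castSucc,
        withFraming_castSucc]
      funext i
      simp [indVec_apply_of_ne h]

lemma shiftNode_last_withFraming (I : Finset (Fin (v (Fin.last k))))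
    (y : Vars v ℂ) (b : Fin (v (Fin.last k)) → ℂ) :
    shiftNode L (Fin.last k) I (withFraming y b) = withFraming y (shiftSet L I b) := by
  funext m
  cases m using Fin.lastCases with
  | last => rw [shiftNode_self, withFraming_last, withFraming_last]
  | cast m =>
    rw [shiftNode_of_ne (Fin.castSucc_lt_last m).ne, withFraming_castSucc, withFraming_castSucc]

lemma mixed_shiftNode_last (I : Finset (Fin (v (Fin.last k))))
    (y : Vars v ℂ) (b : Fin (v (Fin.last k)) → ℂ) :
    mixed L t v ω (withFraming y b) (shiftNode L (Fin.last k) I (withFraming y b)) =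
      integrand L t v ω (shiftSet L I b) y := by
  rw [shiftNode_last_withFraming, integrand_eq_mixed]
  simp only [mixed, withFraming_castSucc]

lemma mixed_shiftNode_zero (Y : (m : Fin (k + 1)) → Fin (v m) → ℂ) (K : Finset (Fin (v 0))) :
    mixed L t v ω Y (shiftNode L 0 K Y) = mixed L t v ω Y Y := by
  refine Finset.prod_congr rfl fun m _ => ?_
  rw [shiftNode_of_ne (Fin.succ_ne_zero m)]

lemma mixed_shiftNode_succ (hq : ‖Complex.exp L‖ < 1) (Y : (m : Fin (k + 1)) → Fin (v m) → ℂ)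
    (j : Fin k) (I : Finset (Fin (v j.succ))) :
    mixed L t v ω Y (shiftNode L j.succ I Y) = mixed L t v ω Y Y * ∏ i ∈ I, ∏ l,
      (Complex.exp (Y j.succ i) - t * Complex.exp (Y j.castSucc l - L)) /
          (Complex.exp (Y j.succ i) - Complex.exp (Y j.castSucc l - L)) := by
  rw [mixed, mixed, ← Finset.mul_prod_erase _ _ (Finset.mem_univ j),
    ← Finset.mul_prod_erase Finset.univ (fun m : Fin k => _ * _ * factorH _ t _ (Y m.succ))
      (Finset.mem_univ j), shiftNode_self, factorH_shiftSet_right hq]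
  rw [Finset.prod_congr rfl (g := fun m : Fin k => (factorE (Complex.exp L) t (Y m.castSucc) *
    (∏ i, Complex.exp ((ω m.castSucc - ω m.succ) * Y m.castSucc i / L)) *
    factorH (Complex.exp L) t (Y m.castSucc) (Y m.succ)))]
  · ring
  · intro m hm
    rw [shiftNode_of_ne (fun h => (Finset.mem_erase.1 hm).1 (Fin.succ_injective k h))]

lemma mixed_eq_zero (hq : ‖Complex.exp L‖ < 1) (Y Y' : (m : Fin (k + 1)) → Fin (v m) → ℂ)
    (m : Fin k) (h : ¬ Function.Injective fun i => Complex.exp (Y m.castSucc i)) :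
    mixed L t v ω Y Y' = 0 := by
  simp only [Function.Injective, not_forall] at h
  obtain ⟨i, j, hij, hne⟩ := h
  refine Finset.prod_eq_zero (Finset.mem_univ m) ?_
  rw [factorE_eq_zero hq hne hij, zero_mul, zero_mul]

/-- If two variables of a node coincide, the integrand vanishes, unless the node is the framing. -/
lemma mixed_eq_zero_of_not_injective (hq : ‖Complex.exp L‖ < 1)
    (Y Y' : (m : Fin (k + 1)) → Fin (v m) → ℂ)
    (hlast : Function.Injective fun i => Complex.exp (Y (Fin.last k) i)) (m : Fin (k + 1))
    (h : ¬ Function.Injective fun i => Complex.exp (Y m i)) : mixed L t v ω Y Y' = 0 := by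
  cases m using Fin.lastCases with
  | last => exact absurd hlast h
  | cast m => exact mixed_eq_zero hq Y Y' m h

/-- At the first node, the Macdonald operator acts on a constant. -/
lemma sum_coefA_mul_mixed_zero (hq : ‖Complex.exp L‖ < 1)
    (Y : (m : Fin (k + 1)) → Fin (v m) → ℂ)
    (hlast : Function.Injective fun i => Complex.exp (Y (Fin.last k) i)) (r : ℕ) :
    ∑ I ∈ Finset.powersetCard r Finset.univ,
        coefA t I (Y 0) * mixed L t v ω Y (shiftNode L 0 I Y) =
      gaussBinom t (v 0) r * mixed L t v ω Y Y := by
  simp only [mixed_shiftNode_zero, ← Finset.sum_mul]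
  by_cases h : Function.Injective fun i => Complex.exp (Y 0 i)
  · congr 1
    have := kernel_identity (Nat.zero_le (v 0)) (s := fun i : Fin 0 => i.elim0) h
      (fun i => i.elim0) (fun i => Complex.exp_ne_zero _) (fun i => i.elim0)
      (fun _ i => i.elim0) t r
    have h0 := this.trans (Finset.sum_eq_single 0 (fun l _ hl => by
      rw [Finset.powersetCard_eq_empty.2 (by simpa using Nat.pos_of_ne_zero hl),
        Finset.sum_empty, mul_zero]) (fun h0 => absurd (Finset.mem_range.2 r.succ_pos) h0))
    simpa [coefA] using h0
  · rw [mixed_eq_zero_of_not_injective hq Y Y hlast 0 h, mul_zero, mul_zero]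

/-- The kernel identity passes the Macdonald operator from a node to the preceding one. -/
lemma sum_coefA_mul_mixed_succ (hq : ‖Complex.exp L‖ < 1) (hv : Monotone v)
    (Y : (m : Fin (k + 1)) → Fin (v m) → ℂ)
    (hlast : Function.Injective fun i => Complex.exp (Y (Fin.last k) i)) (j : Fin k)
    (hY : ∀ i l, Complex.exp (Y j.castSucc i - L) ≠ Complex.exp (Y j.succ l)) (r : ℕ) :
    ∑ I ∈ Finset.powersetCard r Finset.univ,
        coefA t I (Y j.succ) * mixed L t v ω Y (shiftNode L j.succ I Y) =
      ∑ l ∈ Finset.range (r + 1), t ^ ((v j.castSucc - l) * (r - l)) *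
        gaussBinom t (v j.succ - v j.castSucc) (r - l) *
          ∑ K ∈ Finset.powersetCard l Finset.univ, mixed L t v ω Y Y *
            coefB t K (Y j.castSucc) * coefH L t K (Y j.castSucc) (Y j.succ) := by
  simp only [mixed_shiftNode_succ hq]
  by_cases h1 : Function.Injective fun i => Complex.exp (Y j.succ i)
  swap
  · simp [mixed_eq_zero_of_not_injective hq Y Y hlast j.succ h1]
  by_cases h2 : Function.Injective fun i => Complex.exp (Y j.castSucc i)
  swap
  · simp [mixed_eq_zero hq Y Y j h2]
  have h3 : Function.Injective fun i => Complex.exp (Y j.castSucc i - L) := by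
    intro i l hil
    apply h2
    simp only [Complex.exp_sub] at hil ⊢
    exact (div_left_inj' (Complex.exp_ne_zero L)).1 hil
  have := kernel_identity (hv (Fin.castSucc_lt_succ (i := j)).le) h1 h3
    (fun i => Complex.exp_ne_zero _) (fun i => Complex.exp_ne_zero _)
    (fun i l => (hY l i).symm) t r
  have hB : ∀ K : Finset (Fin (v j.castSucc)), coefB t K (Y j.castSucc) =
      ∏ k ∈ K, ∏ l ∈ Kᶜ, (Complex.exp (Y j.castSucc k - L) -
        t * Complex.exp (Y j.castSucc l - L)) /
        (Complex.exp (Y j.castSucc k - L) - Complex.exp (Y j.castSucc l - L)) := by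
    intro K
    refine Finset.prod_congr rfl fun i _ => Finset.prod_congr rfl fun l _ => ?_
    rw [Complex.exp_sub, Complex.exp_sub, mul_div_assoc', ← sub_div, ← sub_div,
      div_div_div_cancel_right₀ (Complex.exp_ne_zero L)]
  calc _ = mixed L t v ω Y Y * ∑ I ∈ Finset.powersetCard r Finset.univ,
        coefA t I (Y j.succ) * ∏ i ∈ I, ∏ l,
          (Complex.exp (Y j.succ i) - t * Complex.exp (Y j.castSucc l - L)) /
            (Complex.exp (Y j.succ i) - Complex.exp (Y j.castSucc l - L)) := by
        rw [Finset.mul_sum]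
        exact Finset.sum_congr rfl fun I _ => by ring
    _ = _ := by
        simp only [coefA]
        rw [this, Finset.mul_sum]
        refine Finset.sum_congr rfl fun l _ => ?_
        rw [mul_left_comm, Finset.mul_sum]
        simp only [hB, coefH, mul_assoc]

lemma prod_exp_shiftSet (hL : L ≠ 0) {d : ℕ} (K : Finset (Fin d)) (y : Fin d → ℂ) (c : ℂ) :
    ∏ i, Complex.exp (c * shiftSet L K y i / L) =
      Complex.exp c ^ K.card * ∏ i, Complex.exp (c * y i / L) := by
  have h : Complex.exp c ^ K.card = ∏ i, if i ∈ K then Complex.exp c else 1 := by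
    rw [Finset.prod_ite_mem, Finset.univ_inter, Finset.prod_const]
  rw [h, ← Finset.prod_mul_distrib]
  refine Finset.prod_congr rfl fun i _ => ?_
  by_cases hi : i ∈ K
  · rw [shiftSet_mem L y hi, if_pos hi, ← Complex.exp_add]
    congr 1
    field_simp
    ring
  · rw [shiftSet_notMem L y hi, if_neg hi, one_mul]

/-- Shifting the variables `K` of a gauge node turns a term of the adjoint operator, acting on the
kernel between this node and the next, into a term of the Macdonald operator acting on the factors
of the preceding nodes. -/
lemma mixed_shiftNode_castSucc (hq : ‖Complex.exp L‖ < 1) (hL : L ≠ 0)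
    (Y : (m : Fin (k + 1)) → Fin (v m) → ℂ) (j : Fin k) (K : Finset (Fin (v j.castSucc)))
    (hE : ∀ i l, i ≠ l →
      phi (Complex.exp L) (t * Complex.exp (Y j.castSucc i - Y j.castSucc l)) ≠ 0)
    (hE' : ∀ i l, i ≠ l → phi (Complex.exp L)
      (t * Complex.exp (shiftSet L K (Y j.castSucc) i - shiftSet L K (Y j.castSucc) l)) ≠ 0)
    (hH : ∀ i l, phi (Complex.exp L) (Complex.exp (Y j.castSucc i - Y j.succ l)) ≠ 0) :
    mixed L t v ω (shiftNode L j.castSucc K Y) (shiftNode L j.castSucc K Y) *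
        coefB t K (shiftSet L K (Y j.castSucc)) *
        coefH L t K (shiftSet L K (Y j.castSucc)) (Y j.succ) =
      Complex.exp (ω j.castSucc - ω j.succ) ^ K.card *
        (coefA t K (Y j.castSucc) * mixed L t v ω Y (shiftNode L j.castSucc K Y)) := by
  have hne : j.succ ≠ j.castSucc := (Fin.castSucc_lt_succ (i := j)).ne'
  rw [mixed, mixed, ← Finset.mul_prod_erase Finset.univ (fun m : Fin k =>
      factorE _ t (shiftNode L j.castSucc K Y m.castSucc) * _ *
        factorH _ t (shiftNode L j.castSucc K Y m.castSucc) _) (Finset.mem_univ j),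
    ← Finset.mul_prod_erase Finset.univ (fun m : Fin k =>
      factorE _ t (Y m.castSucc) * _ * factorH _ t (Y m.castSucc) _) (Finset.mem_univ j),
    shiftNode_self, shiftNode_of_ne hne]
  have h1 := factorE_mul_coefB_shiftSet hq K (Y j.castSucc) hE hE'
  have h2 := factorH_shiftSet_mul_coefH (t := t) hq K (Y j.castSucc) (Y j.succ) hH
  have h3 := prod_exp_shiftSet hL K (Y j.castSucc) (ω j.castSucc - ω j.succ)
  rw [h3]
  rw [Finset.prod_congr rfl (s₁ := Finset.univ.erase j) (g := fun m : Fin k =>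
    (factorE (Complex.exp L) t (Y m.castSucc) *
    (∏ i, Complex.exp ((ω m.castSucc - ω m.succ) * Y m.castSucc i / L)) *
    factorH (Complex.exp L) t (Y m.castSucc) (shiftNode L j.castSucc K Y m.succ)))]
  · rw [← h2]
    linear_combination (Complex.exp (ω j.castSucc - ω j.succ) ^ K.card *
      (∏ i, Complex.exp ((ω j.castSucc - ω j.succ) * Y j.castSucc i / L)) *
      factorH (Complex.exp L) t (shiftSet L K (Y j.castSucc)) (Y j.succ) *
      coefH L t K (shiftSet L K (Y j.castSucc)) (Y j.succ) *
      ∏ m ∈ Finset.univ.erase j, (factorE (Complex.exp L) t (Y m.castSucc) *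
    (∏ i, Complex.exp ((ω m.castSucc - ω m.succ) * Y m.castSucc i / L)) *
    factorH (Complex.exp L) t (Y m.castSucc) (shiftNode L j.castSucc K Y m.succ))) * h1
  · intro m hm
    have h4 : m.castSucc ≠ j.castSucc := fun h =>
      (Finset.mem_erase.1 hm).1 (Fin.castSucc_injective k h)
    rw [shiftNode_of_ne h4]

end

section

open MeasureTheory Filter Topology Set

/-! ### Contour shifts of the integrand times the coefficients of the adjoint operator -/

variable {k : ℕ} {v : Fin (k + 1) → ℕ} {L t : ℂ} {ω : Fin (k + 1) → ℂ}
  {b : Fin (v (Fin.last k)) → ℂ}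

/-- A term of the adjoint Macdonald operator at the node `j`, acting on the kernel between this
node and the next, times the integrand. -/
noncomputable def adjointTerm (L t : ℂ) (v : Fin (k + 1) → ℕ) (ω : Fin (k + 1) → ℂ)
    (b : Fin (v (Fin.last k)) → ℂ) (j : Fin k) (K : Finset (Fin (v j.castSucc)))
    (y : Vars v ℂ) : ℂ :=
  integrand L t v ω b y * coefB t K (y j) * coefH L t K (y j) (withFraming y b j.succ)

lemma adjointTerm_empty (j : Fin k) (y : Vars v ℂ) :
    adjointTerm L t v ω b j ∅ y = integrand L t v ω b y := by
  simp [adjointTerm, coefB, coefH]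

lemma withFraming_congr {y y' : Vars v ℂ} {m : Fin (k + 1)} {i : Fin (v m)}
    (h : ∀ m i, Complex.exp (y m i) = Complex.exp (y' m i)) :
    Complex.exp (withFraming y b m i) = Complex.exp (withFraming y' b m i) := by
  cases m using Fin.lastCases with
  | last => rw [withFraming_last, withFraming_last]
  | cast m => rw [withFraming_castSucc, withFraming_castSucc, h]

/-- The dependence on `y` is through `s = exp y` and the powers of `s` in the integrand. -/
lemma adjointTerm_congr (j : Fin k) (K : Finset (Fin (v j.castSucc))) {y y' : Vars v ℂ}
    (h : ∀ m i, Complex.exp (y m i) = Complex.exp (y' m i))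
    (h' : ∀ m i, Complex.exp ((ω m.castSucc - ω m.succ) * y m i / L) =
      Complex.exp ((ω m.castSucc - ω m.succ) * y' m i / L)) :
    adjointTerm L t v ω b j K y = adjointTerm L t v ω b j K y' := by
  have h1 := fun m i => withFraming_congr (b := b) (m := m) (i := i) h
  simp only [adjointTerm, integrand, factorE, factorH, coefB, coefH, Complex.exp_sub, h, h', h1]

lemma closesUp_adjointTerm (j : Fin k) (K : Finset (Fin (v j.castSucc))) (m : Fin k)
    (i : Fin (v m.castSucc)) {γ : ℝ → ℂ}
    (hγ : IsContour ((ω m.castSucc - ω m.succ) / L) γ) :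
    ClosesUp (adjointTerm L t v ω b j K) m i γ := by
  rcases hγ.2 with h | ⟨A, B, -, hA, hB, h1, h2⟩
  · exact Or.inl h
  refine Or.inr ⟨A, B, hA, hB, fun y => adjointTerm_congr j K ?_ ?_⟩
  all_goals
    intro m' i'
    by_cases hm : m' = m
    · subst hm
      by_cases hi : i' = i
      · subst hi
        simp only [Pi.add_apply, Pi.smul_apply, unitVec_self, smul_eq_mul, mul_one]
        first
        | rw [Complex.exp_add, exp_sub_eq_one h1, mul_one]
        | rw [mul_add, add_div, Complex.exp_add, mul_div_right_comm _ (γ B - γ A), h2, mul_one]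
      · simp [unitVec_of_ne _ hi]
    · simp [unitVec_of_ne' _ hm]

lemma differentiable_withFraming (b : Fin (v (Fin.last k)) → ℂ) (m : Fin (k + 1))
    (i : Fin (v m)) : Differentiable ℂ fun y : Vars v ℂ => withFraming y b m i := by
  cases m using Fin.lastCases with
  | last => simp only [withFraming_last]; fun_prop
  | cast m => simp only [withFraming_castSucc]; fun_prop

lemma differentiableAt_prod {E ι : Type*} [NormedAddCommGroup E] [NormedSpace ℂ E] {x : E}
    {s : Finset ι} {f : ι → E → ℂ} (h : ∀ i ∈ s, DifferentiableAt ℂ (f i) x) :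
    DifferentiableAt ℂ (fun x => ∏ i ∈ s, f i x) x := by
  classical
  induction s using Finset.induction_on with
  | empty => simp
  | insert i s hi ih =>
    simp only [Finset.prod_insert hi]
    exact (h i (Finset.mem_insert_self i s)).mul
      (ih fun l hl => h l (Finset.mem_insert_of_mem hl))

lemma differentiableAt_div {E : Type*} [NormedAddCommGroup E] [NormedSpace ℂ E] {x : E}
    {f g : E → ℂ} (hf : DifferentiableAt ℂ f x) (hg : DifferentiableAt ℂ g x) (h : g x ≠ 0) :
    DifferentiableAt ℂ (fun x => f x / g x) x := by
  simp only [div_eq_mul_inv]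
  exact hf.mul (hg.inv h)

lemma differentiableAt_factorH (hq : ‖Complex.exp L‖ < 1) (m : Fin k) {y : Vars v ℂ}
    (hy : PoleFree L t v b y) : DifferentiableAt ℂ (fun y : Vars v ℂ =>
      factorH (Complex.exp L) t (withFraming y b m.castSucc) (withFraming y b m.succ)) y := by
  refine differentiableAt_prod fun i _ => differentiableAt_prod fun l _ => ?_
  have h1 := differentiable_withFraming b m.castSucc i
  have h2 := differentiable_withFraming b m.succ l
  have h3 := differentiable_phi hq
  have h4 : DifferentiableAt ℂ (fun y : Vars v ℂ => phi (Complex.exp L)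
      (t * Complex.exp (withFraming y b m.castSucc i - withFraming y b m.succ l))) y := by
    fun_prop
  have h5 : DifferentiableAt ℂ (fun y : Vars v ℂ => phi (Complex.exp L)
      (Complex.exp (withFraming y b m.castSucc i - withFraming y b m.succ l))) y := by
    fun_prop
  exact differentiableAt_div h4 h5 (hy.2 m i l)

lemma differentiableAt_factorE_mul_coefB (hq : ‖Complex.exp L‖ < 1) (m : Fin k)
    (K : Finset (Fin (v m.castSucc))) {y : Vars v ℂ}
    (hy : PoleFree L t v b y) : DifferentiableAt ℂ (fun y : Vars v ℂ =>
      factorE (Complex.exp L) t (y m) * coefB t K (y m)) y := by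
  simp only [factorE_mul_coefB hq]
  refine differentiableAt_prod fun i _ => differentiableAt_prod fun l hl => ?_
  have h3 := differentiable_phi hq
  have h5 : DifferentiableAt ℂ (fun y : Vars v ℂ => phi (Complex.exp L)
      (t * Complex.exp (y m i - y m l))) y := by
    fun_prop
  have h0 := hy.1 m i l (Finset.mem_erase.1 hl).1.symm
  split_ifs
  · exact differentiableAt_div (by fun_prop) h5 h0
  · exact differentiableAt_div (by fun_prop) h5 h0

lemma differentiableAt_factorE (hq : ‖Complex.exp L‖ < 1) (m : Fin k) {y : Vars v ℂ}
    (hy : PoleFree L t v b y) : DifferentiableAt ℂ (fun y : Vars v ℂ =>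
      factorE (Complex.exp L) t (y m)) y := by
  simpa [coefB] using differentiableAt_factorE_mul_coefB hq m ∅ hy

/-- For `i ∈ K`, the point with `s j i` divided by `q` is not a pole of the integrand, so that
`coefH` has no pole. -/
lemma exp_ne_of_poleFree (hq : ‖Complex.exp L‖ < 1) {j : Fin k}
    {K : Finset (Fin (v j.castSucc))} {y : Vars v ℂ}
    (hy : PoleFree L t v b (y - L • indVec j K)) {i : Fin (v j.castSucc)} (hi : i ∈ K)
    (l : Fin (v j.succ)) :
    Complex.exp (y j i - L - withFraming y b j.succ l) ≠ 1 := by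
  have h := ne_one_of_phi_ne_zero hq (hy.2 j i l)
  have h1 : withFraming (y - L • indVec j K) b j.succ l = withFraming y b j.succ l := by
    have h2 := shiftNode_castSucc_withFraming (L := -L) j K y b
    rw [neg_smul, ← sub_eq_add_neg] at h2
    rw [← h2, shiftNode_of_ne (Fin.castSucc_lt_succ (i := j)).ne']
  rw [h1, withFraming_castSucc] at h
  simpa [indVec_apply_self, hi] using h

lemma differentiableAt_adjointTerm (hq : ‖Complex.exp L‖ < 1) (j : Fin k)
    (K : Finset (Fin (v j.castSucc))) {y : Vars v ℂ} (hy : PoleFree L t v b y)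
    (hy' : PoleFree L t v b (y - L • indVec j K)) :
    DifferentiableAt ℂ (adjointTerm L t v ω b j K) y := by
  have e : adjointTerm L t v ω b j K = fun y =>
      (factorE (Complex.exp L) t (y j) * coefB t K (y j)) *
        coefH L t K (y j) (withFraming y b j.succ) *
        ((∏ i, Complex.exp ((ω j.castSucc - ω j.succ) * y j i / L)) *
        factorH (Complex.exp L) t (withFraming y b j.castSucc) (withFraming y b j.succ)) *
        ∏ m ∈ Finset.univ.erase j, (factorE (Complex.exp L) t (y m) *
          (∏ i, Complex.exp ((ω m.castSucc - ω m.succ) * y m i / L)) *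
          factorH (Complex.exp L) t (withFraming y b m.castSucc) (withFraming y b m.succ)) := by
    funext y
    rw [adjointTerm, integrand, ← Finset.mul_prod_erase _ _ (Finset.mem_univ j)]
    ring
  have hexp : ∀ m : Fin k, DifferentiableAt ℂ (fun y : Vars v ℂ =>
      ∏ i, Complex.exp ((ω m.castSucc - ω m.succ) * y m i / L)) y := fun m =>
    differentiableAt_prod fun i _ => by simp only [div_eq_mul_inv]; fun_prop
  have hH : DifferentiableAt ℂ (fun y : Vars v ℂ =>
      coefH L t K (y j) (withFraming y b j.succ)) y := by
    refine differentiableAt_prod fun i hi =>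
      differentiableAt_prod fun l _ => ?_
    have h2 := differentiable_withFraming b j.succ l
    refine differentiableAt_div (by fun_prop) (by fun_prop) (sub_ne_zero.2 fun h => ?_)
    exact exp_ne_of_poleFree hq hy' hi l (exp_sub_eq_one h.symm)
  rw [e]
  exact (((differentiableAt_factorE_mul_coefB hq j K hy).mul hH).mul
    ((hexp j).mul (differentiableAt_factorH hq j hy))).mul
    (differentiableAt_prod fun m _ => ((differentiableAt_factorE hq m hy).mul
      (hexp m)).mul (differentiableAt_factorH hq m hy))

lemma norm_coefB_le {d : ℕ} (K : Finset (Fin d)) {y : Fin d → ℂ} {ε : ℝ} (hε : 0 < ε)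
    (h : ∀ i ∈ K, ∀ l ∈ Kᶜ, ε ≤ ‖Complex.exp (y i - y l) - 1‖) :
    ‖coefB t K y‖ ≤ ∏ _i ∈ K, ∏ _l ∈ Kᶜ, (1 + (1 + ‖t‖) / ε) := by
  rw [coefB, norm_prod]
  refine Finset.prod_le_prod (fun _ _ => norm_nonneg _) fun i hi => ?_
  rw [norm_prod]
  refine Finset.prod_le_prod (fun _ _ => norm_nonneg _) fun l hl => ?_
  have h1 : Complex.exp (y i) = Complex.exp (y i - y l) * Complex.exp (y l) := by
    rw [← Complex.exp_add, sub_add_cancel]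
  rw [h1, ← sub_mul, ← sub_one_mul, mul_div_mul_right _ _ (Complex.exp_ne_zero _)]
  exact norm_sub_div_sub_one_le hε (h i hi l hl)

lemma norm_coefH_le {d d' : ℕ} (K : Finset (Fin d)) {y : Fin d → ℂ} {y' : Fin d' → ℂ} {ε : ℝ}
    (hε : 0 < ε) (h : ∀ i ∈ K, ∀ l, ε ≤ ‖Complex.exp (y i - L - y' l) - 1‖) :
    ‖coefH L t K y y'‖ ≤ ∏ _i ∈ K, ∏ _l : Fin d', (‖t‖ + (1 + ‖t‖) / ε) := by
  rw [coefH, norm_prod]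
  refine Finset.prod_le_prod (fun _ _ => norm_nonneg _) fun i hi => ?_
  rw [norm_prod]
  refine Finset.prod_le_prod (fun _ _ => norm_nonneg _) fun l _ => ?_
  have h1 : Complex.exp (y i - L) = Complex.exp (y i - L - y' l) * Complex.exp (y' l) := by
    rw [← Complex.exp_add, sub_add_cancel]
  rw [h1, ← mul_assoc, ← one_sub_mul, ← one_sub_mul,
    mul_div_mul_right _ _ (Complex.exp_ne_zero _)]
  exact norm_one_sub_div_one_sub_le hε (h i hi l)

lemma shiftedPoint_update (γ : Vars v (ℝ → ℂ)) (j : Fin k) (K : Finset (Fin (v j.castSucc)))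
    (u : ℝ) (η : Vars v ℂ) (x : Vars v ℝ) :
    shiftedPoint L γ (Function.update (fun _ => ∅) j K) u η x =
      contourPoint γ x + ((u : ℂ) * L) • indVec j K + η := by
  funext m i
  simp only [shiftedPoint, contourPoint, Pi.add_apply, Pi.smul_apply, smul_eq_mul]
  by_cases h : m = j
  · subst h
    simp [indVec_apply_self]
  · simp [indVec_apply_of_ne h, Function.update_of_ne h]

/-- The part of admissibility that concerns shifts of the variables `s j i`, `i ∈ K`. -/
lemma Admissible.exists_bound {γ : Vars v (ℝ → ℂ)} (hγ : Admissible L t v ω b γ) :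
    ∃ δ : ℝ, 0 < δ ∧ ∃ M : ℝ, ∀ (j : Fin k) (K : Finset (Fin (v j.castSucc))) (u : ℝ),
      |u| ≤ 1 → ∀ η : Vars v ℂ, (∀ m i, ‖η m i‖ ≤ δ) →
        (∀ x : Vars v ℝ, PoleFree L t v b (contourPoint γ x + ((u : ℂ) * L) • indVec j K + η)) ∧
        Integrable (fun x : Vars v ℝ => integrand L t v ω b
          (contourPoint γ x + ((u : ℂ) * L) • indVec j K + η) * jacobian γ x) ∧
        ∫ x : Vars v ℝ, ‖integrand L t v ω b
          (contourPoint γ x + ((u : ℂ) * L) • indVec j K + η) * jacobian γ x‖ ≤ M := by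
  obtain ⟨-, δ, hδ, M, h⟩ := hγ
  refine ⟨δ, hδ, M, fun j K u hu η hη => ?_⟩
  have := h j (Function.update (fun _ => ∅) j K) (fun m hm => Function.update_of_ne hm ..) u hu
    η hη
  simpa only [shiftedPoint_update] using this

lemma norm_smul_indVec_le (z : ℂ) (j : Fin k) (K : Finset (Fin (v j.castSucc))) (m : Fin k)
    (i : Fin (v m.castSucc)) : ‖(z • indVec j K : Vars v ℂ) m i‖ ≤ ‖z‖ := by
  rw [Pi.smul_apply, Pi.smul_apply, smul_eq_mul, norm_mul]
  exact mul_le_of_le_one_right (norm_nonneg z) (norm_indVec_le j K m i)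

/-- The contours of the variables `s j i`, `i ∈ K`, may be multiplied by `q` in the integral of a
term of the adjoint operator. -/
theorem integral_adjointTerm_shift (hL : L.re < 0) {γ : Vars v (ℝ → ℂ)}
    (hγ : Admissible L t v ω b γ) (j : Fin k) (K : Finset (Fin (v j.castSucc))) :
    Integrable (fun x : Vars v ℝ =>
        adjointTerm L t v ω b j K (contourPoint γ x) * jacobian γ x) ∧
      Integrable (fun x : Vars v ℝ =>
        adjointTerm L t v ω b j K (contourPoint γ x + L • indVec j K) * jacobian γ x) ∧
      ∫ x : Vars v ℝ, adjointTerm L t v ω b j K (contourPoint γ x + L • indVec j K) *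
        jacobian γ x =
      ∫ x : Vars v ℝ, adjointTerm L t v ω b j K (contourPoint γ x) * jacobian γ x := by
  have hq : ‖Complex.exp L‖ < 1 := by rw [Complex.norm_exp]; exact Real.exp_lt_one_iff.2 hL
  have hγ1 := fun m i => (hγ.1 m i).1
  have hends := fun i (_ : i ∈ K) => closesUp_adjointTerm (t := t) (b := b) j K j i (hγ.1 j i)
  obtain ⟨δ', hδ', M, hA⟩ := hγ.exists_bound
  replace hA := hA j K
  obtain ⟨δ, hδ, rfl⟩ : ∃ δ : ℝ, 0 < δ ∧ δ' = 3 * δ := ⟨δ' / 3, by positivity, by ring⟩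
  -- `δ` is left for the translation of the contours, for the circles of the mean value property,
  -- and for the distance from the poles of `coefH`
  have hu1 : ∀ u ∈ Icc (0:ℝ) 1, |u| ≤ 1 := fun u hu => abs_le.2 ⟨by linarith [hu.1], hu.2⟩
  have hu2 : ∀ u ∈ Icc (0:ℝ) 1, |u - 1| ≤ 1 := fun u hu =>
    abs_le.2 ⟨by linarith [hu.1], by linarith [hu.2]⟩
  have hsub : ∀ (u : ℝ) (η : Vars v ℂ) (x : Vars v ℝ),
      contourPoint γ x + ((u : ℂ) * L) • indVec j K + η - L • indVec j K =
        contourPoint γ x + (((u - 1 : ℝ) : ℂ) * L) • indVec j K + η := by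
    intro u η x
    push_cast
    module
  have hdiff : ∀ u ∈ Icc (0:ℝ) 1, ∀ η : Vars v ℂ, (∀ m i, ‖η m i‖ ≤ 3 * δ) → ∀ x : Vars v ℝ,
      ∀ K' ⊆ K, K' = K ∨ K' = ∅ → DifferentiableAt ℂ (adjointTerm L t v ω b j K')
        (contourPoint γ x + ((u : ℂ) * L) • indVec j K + η) := by
    intro u hu η hη x K' _ hK'
    have h1 := (hA u (hu1 u hu) η hη).1 x
    rcases hK' with rfl | rfl
    · refine differentiableAt_adjointTerm hq j _ h1 ?_
      rw [hsub]
      exact (hA _ (hu2 u hu) η hη).1 x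
    · refine differentiableAt_adjointTerm hq j _ h1 ?_
      rwa [indVec_empty, smul_zero, sub_zero]
  obtain ⟨ε, hε, radii, hrad, hsep⟩ := exists_radii δ hδ (K ×ˢ Kᶜ).card
  obtain ⟨ε', hε', hsep'⟩ := exists_le_norm_exp_sub_one δ hδ
  set C : ℝ := (∏ _i ∈ K, ∏ _l ∈ Kᶜ, (1 + (1 + ‖t‖) / ε)) *
    ∏ _i ∈ K, ∏ _l : Fin (v j.succ), (‖t‖ + (1 + ‖t‖) / ε') with hC
  have hC0 : 0 ≤ C := by positivity
  -- `coefH` is bounded near the shifted contours, and `coefB` is bounded on one of the circles of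
  -- `exists_radii` around each of their points
  have hmain : ∀ u ∈ Icc (0:ℝ) 1, ∀ η : Vars v ℂ, (∀ m i, ‖η m i‖ ≤ δ) →
      Integrable (fun x : Vars v ℝ => adjointTerm L t v ω b j K
        (contourPoint γ x + ((u : ℂ) * L) • indVec j K + η) * jacobian γ x) ∧
      ∫ x : Vars v ℝ, ‖adjointTerm L t v ω b j K
        (contourPoint γ x + ((u : ℂ) * L) • indVec j K + η) * jacobian γ x‖ ≤
          radii.card * (C * M) := by
    intro u hu η hη
    have hrw : ∀ (z : ℂ) (x : Vars v ℝ),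
        contourPoint γ x + (((u : ℂ) * L) • indVec j K + η) + z • indVec j K =
        contourPoint γ x + ((u : ℂ) * L) • indVec j K + (η + z • indVec j K) := fun z x => by
      abel
    have hηz : ∀ z : ℂ, ‖z‖ ≤ δ → ∀ m i, ‖(η + z • indVec j K : Vars v ℂ) m i‖ ≤ 2 * δ := by
      intro z hz m i
      have h1 := (norm_smul_indVec_le z j K m i).trans hz
      have h2 : ‖(η + z • indVec j K : Vars v ℂ) m i‖ ≤
        ‖η m i‖ + ‖(z • indVec j K : Vars v ℂ) m i‖ := norm_add_le _ _
      linarith [hη m i]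
    have hηz3 : ∀ z : ℂ, ‖z‖ ≤ δ → ∀ m i, ‖(η + z • indVec j K : Vars v ℂ) m i‖ ≤ 3 * δ :=
      fun z hz m i => (hηz z hz m i).trans (by linarith)
    have hρ : ∀ ρ ∈ radii, ∀ z : ℂ, ‖z‖ ≤ ρ → ‖z‖ ≤ δ := fun ρ hρ z hz =>
      hz.trans (hrad ρ hρ).2
    have := integrable_of_circle_bound (F := integrand L t v ω b)
      (G := adjointTerm L t v ω b j K) (M := M) hγ1
      (((u : ℂ) * L) • indVec j K + η) (indVec j K) hC0 radii (fun ρ h => (hrad ρ h).1)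
      (fun ρ h z hz x => by
        rw [hrw]; exact hdiff u hu _ (hηz3 z (hρ ρ h z hz)) x K subset_rfl (Or.inl rfl))
      (fun ρ h z hz x => by
        rw [hrw]
        have h1 := hdiff u hu _ (hηz3 z (hρ ρ h z hz)) x ∅ (Finset.empty_subset K) (Or.inr rfl)
        have h2 : adjointTerm L t v ω b j ∅ = integrand L t v ω b :=
          funext (adjointTerm_empty j)
        rw [h2] at h1
        exact h1.continuousAt)
      (fun ρ h z hz => by
        simp only [hrw]; exact (hA u (hu1 u hu) _ (hηz3 z (hρ ρ h z hz))).2.1)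
      (fun ρ h z hz => by
        simp only [hrw]; exact (hA u (hu1 u hu) _ (hηz3 z (hρ ρ h z hz))).2.2) ?_
    · simpa only [← add_assoc] using this
    intro x
    set y₀ := contourPoint γ x + (((u : ℂ) * L) • indVec j K + η) with hy₀
    obtain ⟨ρ, hρm, hρs⟩ := hsep (K ×ˢ Kᶜ) le_rfl
      (fun p => Complex.exp (y₀ j p.1 - y₀ j p.2))
    refine ⟨ρ, hρm, fun z hz => ?_⟩
    -- a translation by `z • indVec j K` multiplies `s i / s l` by `exp z`, for `i ∈ K` and `l ∉ K`
    have h1 : ‖coefB t K ((y₀ + z • indVec j K) j)‖ ≤ _ := norm_coefB_le K hε (by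
      intro i hi l hl
      have h2 := hρs (i, l) (Finset.mk_mem_product hi hl) z hz
      have hl' := Finset.mem_compl.1 hl
      rw [← Complex.exp_add] at h2
      simp only [Pi.add_apply, Pi.smul_apply, smul_eq_mul, indVec_apply_self, hi, hl', if_true,
        if_false, mul_one, mul_zero, add_zero]
      rwa [add_sub_right_comm])
    have h2 : ‖coefH L t K ((y₀ + z • indVec j K) j)
        (withFraming (y₀ + z • indVec j K) b j.succ)‖ ≤ _ := norm_coefH_le K hε' (by
      intro i hi l
      refine hsep' _ fun η' hη' => ?_
      have h3 : ∀ m i, ‖(η + (z + η') • indVec j K : Vars v ℂ) m i‖ ≤ 3 * δ := by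
        intro m i
        have h4 := (norm_smul_indVec_le η' j K m i).trans hη'
        have h5 : ‖(η + (z + η') • indVec j K : Vars v ℂ) m i‖ ≤
            ‖(η + z • indVec j K : Vars v ℂ) m i‖ + ‖(η' • indVec j K : Vars v ℂ) m i‖ := by
          rw [add_smul, ← add_assoc]
          exact norm_add_le _ _
        linarith [hηz z (hρ ρ hρm z hz.le) m i]
      have h6 := (hA _ (hu2 u hu) _ h3).1 x
      rw [← hsub] at h6
      have h7 := exp_ne_of_poleFree hq h6 hi l
      have h8 : contourPoint γ x + ((u : ℂ) * L) • indVec j K + (η + (z + η') • indVec j K) =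
          y₀ + z • indVec j K + η' • indVec j K := by
        rw [hy₀, add_smul]; abel
      rw [h8] at h7
      have h9 : withFraming (y₀ + z • indVec j K + η' • indVec j K) b j.succ =
          withFraming (y₀ + z • indVec j K) b j.succ := by
        rw [← shiftNode_castSucc_withFraming, shiftNode_of_ne (Fin.castSucc_lt_succ (i := j)).ne']
      rw [h9] at h7
      generalize withFraming (y₀ + z • indVec j K) b j.succ l = Z at h7
      generalize y₀ + z • indVec j K = y₁ at *
      convert h7 using 2
      simp only [Pi.add_apply, Pi.smul_apply, smul_eq_mul, indVec_apply_self, hi, if_true]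
      ring)
    rw [adjointTerm, norm_mul, norm_mul, mul_assoc, mul_comm, hC]
    gcongr
  have hend := integral_shift hγ1 j K hends L hδ
    (fun u hu η hη x => hdiff u hu η (fun m i => (hη m i).trans (by linarith)) x K subset_rfl
      (Or.inl rfl))
    (fun u hu η hη => (hmain u hu η hη).1) (fun u hu η hη => (hmain u hu η hη).2)
  refine ⟨?_, ?_, hend⟩
  · simpa using (hmain 0 (by simp) 0 (fun _ _ => by simpa using hδ.le)).1
  · simpa using (hmain 1 (by simp) 0 (fun _ _ => by simpa using hδ.le)).1

end

section

open MeasureTheory Filter Topology Set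

/-! ### The Macdonald operators under the integral sign -/

variable {k : ℕ} {v : Fin (k + 1) → ℕ} {L t : ℂ} {ω : Fin (k + 1) → ℂ}
  {b : Fin (v (Fin.last k)) → ℂ} {γ : Vars v (ℝ → ℂ)}

/-- A term of the Macdonald operator in the variables of the node `m`, acting on the factors of the
preceding nodes, under the integral sign. -/
noncomputable def nodeIntegrand (L t : ℂ) (v : Fin (k + 1) → ℕ) (ω : Fin (k + 1) → ℂ)
    (b : Fin (v (Fin.last k)) → ℂ) (m : Fin (k + 1)) (K : Finset (Fin (v m)))
    (y : Vars v ℂ) : ℂ :=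
  coefA t K (withFraming y b m) *
    mixed L t v ω (withFraming y b) (shiftNode L m K (withFraming y b))

lemma Admissible.poleFree_shift (hγ : Admissible L t v ω b γ) (j : Fin k)
    (K : Finset (Fin (v j.castSucc))) {u : ℝ} (hu : |u| ≤ 1) (x : Vars v ℝ) :
    PoleFree L t v b (contourPoint γ x + ((u : ℂ) * L) • indVec j K) := by
  obtain ⟨δ, hδ, M, h⟩ := hγ.exists_bound
  simpa using (h j K u hu 0 fun m i => by simpa using hδ.le).1 x

lemma Admissible.poleFree (hγ : Admissible L t v ω b γ) (j : Fin k) (x : Vars v ℝ) :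
    PoleFree L t v b (contourPoint γ x) := by
  simpa using hγ.poleFree_shift j ∅ (u := 0) (by simp) x

lemma Admissible.poleFree_sub (hγ : Admissible L t v ω b γ) (j : Fin k)
    (K : Finset (Fin (v j.castSucc))) (x : Vars v ℝ) :
    PoleFree L t v b (contourPoint γ x - L • indVec j K) := by
  simpa [sub_eq_add_neg] using hγ.poleFree_shift j K (u := -1) (by simp) x

/-- On the shifted contour, a term of the adjoint operator is a term of the Macdonald operator. -/
lemma adjointTerm_shift (hL : L ≠ 0) (hq : ‖Complex.exp L‖ < 1) (hγ : Admissible L t v ω b γ)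
    (j : Fin k) (K : Finset (Fin (v j.castSucc))) (x : Vars v ℝ) :
    adjointTerm L t v ω b j K (contourPoint γ x + L • indVec j K) =
      Complex.exp (ω j.castSucc - ω j.succ) ^ K.card *
        nodeIntegrand L t v ω b j.castSucc K (contourPoint γ x) := by
  have h1 := hγ.poleFree j x
  have h2 : PoleFree L t v b (contourPoint γ x + L • indVec j K) := by
    simpa using hγ.poleFree_shift j K (u := 1) (by simp) x
  have h3 : (contourPoint γ x + L • indVec j K : Vars v ℂ) j =
      shiftSet L K (withFraming (contourPoint γ x) b j.castSucc) := by
    rw [← withFraming_castSucc (contourPoint γ x + L • indVec j K) b,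
      ← shiftNode_castSucc_withFraming, shiftNode_self]
  have h4 := mixed_shiftNode_castSucc (t := t) (ω := ω) hq hL
    (withFraming (contourPoint γ x) b) j K
    (fun i l hil => by simpa only [withFraming_castSucc] using h1.1 j i l hil)
    (fun i l hil => by rw [← h3]; exact h2.1 j i l hil) (h1.2 j)
  rw [nodeIntegrand, ← h4, adjointTerm, integrand_eq_mixed, h3, shiftNode_castSucc_withFraming]
  congr 2
  rw [← shiftNode_castSucc_withFraming, shiftNode_of_ne (Fin.castSucc_lt_succ (i := j)).ne']

lemma integrable_nodeIntegrand_castSucc (hL : L.re < 0) (hγ : Admissible L t v ω b γ)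
    (j : Fin k) (K : Finset (Fin (v j.castSucc))) : Integrable fun x : Vars v ℝ =>
      nodeIntegrand L t v ω b j.castSucc K (contourPoint γ x) * jacobian γ x := by
  have hq : ‖Complex.exp L‖ < 1 := by rw [Complex.norm_exp]; exact Real.exp_lt_one_iff.2 hL
  have hL0 : L ≠ 0 := fun h => by simp [h] at hL
  have h1 := (integral_adjointTerm_shift hL hγ j K).2.1
  simp only [adjointTerm_shift hL0 hq hγ, mul_assoc] at h1
  exact (integrable_const_mul_iff
    (pow_ne_zero _ (Complex.exp_ne_zero (ω j.castSucc - ω j.succ))).isUnit _).1 h1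

lemma integral_adjointTerm (hL : L.re < 0) (hγ : Admissible L t v ω b γ)
    (j : Fin k) (K : Finset (Fin (v j.castSucc))) :
    ∫ x : Vars v ℝ, adjointTerm L t v ω b j K (contourPoint γ x) * jacobian γ x =
      Complex.exp (ω j.castSucc - ω j.succ) ^ K.card *
        ∫ x : Vars v ℝ, nodeIntegrand L t v ω b j.castSucc K (contourPoint γ x) *
          jacobian γ x := by
  have hq : ‖Complex.exp L‖ < 1 := by rw [Complex.norm_exp]; exact Real.exp_lt_one_iff.2 hL
  have hL0 : L ≠ 0 := fun h => by simp [h] at hL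
  rw [← (integral_adjointTerm_shift hL hγ j K).2.2]
  simp only [adjointTerm_shift hL0 hq hγ, mul_assoc, integral_const_mul]

/-- For the framing node, the ratio of the shifted and the original integrand is bounded on the
contour. -/
lemma integrable_nodeIntegrand_last (hL : L.re < 0) (hγ : Admissible L t v ω b γ)
    {j : Fin k} (hj : j.succ = Fin.last k) (I : Finset (Fin (v j.succ))) :
    Integrable fun x : Vars v ℝ =>
      nodeIntegrand L t v ω b j.succ I (contourPoint γ x) * jacobian γ x := by
  have hq : ‖Complex.exp L‖ < 1 := by rw [Complex.norm_exp]; exact Real.exp_lt_one_iff.2 hL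
  have hγ1 := fun m i => (hγ.1 m i).1
  obtain ⟨β, hβ⟩ : ∃ β : Fin (v j.succ) → ℂ, ∀ y : Vars v ℂ, withFraming y b j.succ = β := by
    rw [hj]
    exact ⟨b, fun y => withFraming_last y b⟩
  have hint : Integrable fun x : Vars v ℝ =>
      integrand L t v ω b (contourPoint γ x) * jacobian γ x := by
    simpa only [adjointTerm_empty] using (integral_adjointTerm_shift hL hγ j ∅).1
  obtain ⟨δ, hδ, M, hA⟩ := hγ.exists_bound
  obtain ⟨ε, hε, hsep⟩ := exists_le_norm_exp_sub_one δ hδ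
  have hX : ∀ x l i, ε ≤ ‖Complex.exp (contourPoint γ x j l - L - β i) - 1‖ := by
    intro x l i
    refine hsep _ fun η hη => ?_
    have h1 := (hA j Finset.univ (-1) (by simp) (η • indVec j Finset.univ)
      (fun m i => (norm_smul_indVec_le η j _ m i).trans hη)).1 x
    have h2 : contourPoint γ x + (((-1 : ℝ) : ℂ) * L) • indVec j Finset.univ +
        η • indVec j Finset.univ = contourPoint γ x + η • indVec j Finset.univ -
          L • (indVec j Finset.univ : Vars v ℂ) := by
      push_cast
      module
    rw [h2] at h1
    have h3 := exp_ne_of_poleFree hq h1 (Finset.mem_univ l) i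
    rw [hβ] at h3
    convert h3 using 2
    simp only [Pi.add_apply, Pi.smul_apply, smul_eq_mul, indVec_apply_self, Finset.mem_univ,
      if_true]
    ring
  have e : ∀ x : Vars v ℝ, nodeIntegrand L t v ω b j.succ I (contourPoint γ x) * jacobian γ x =
      (coefA t I β * ∏ i ∈ I, ∏ l, (1 - t * Complex.exp (contourPoint γ x j l - L - β i)) /
        (1 - Complex.exp (contourPoint γ x j l - L - β i))) *
        (integrand L t v ω b (contourPoint γ x) * jacobian γ x) := by
    intro x
    rw [nodeIntegrand, mixed_shiftNode_succ hq, hβ, integrand_eq_mixed, withFraming_castSucc]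
    have h1 : ∀ i l, (Complex.exp (β i) - t * Complex.exp (contourPoint γ x j l - L)) /
        (Complex.exp (β i) - Complex.exp (contourPoint γ x j l - L)) =
        (1 - t * Complex.exp (contourPoint γ x j l - L - β i)) /
        (1 - Complex.exp (contourPoint γ x j l - L - β i)) := by
      intro i l
      have h2 : Complex.exp (contourPoint γ x j l - L) =
          Complex.exp (contourPoint γ x j l - L - β i) * Complex.exp (β i) := by
        rw [← Complex.exp_add, sub_add_cancel]
      rw [h2, ← mul_assoc, ← one_sub_mul, ← one_sub_mul,
        mul_div_mul_right _ _ (Complex.exp_ne_zero _)]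
    simp only [h1]
    ring
  simp only [e]
  refine hint.bdd_mul (c := ‖coefA t I β‖ * ∏ _i ∈ I, ∏ _l : Fin (v j.castSucc),
    (‖t‖ + (1 + ‖t‖) / ε)) ?_ (Eventually.of_forall fun x => ?_)
  · refine Continuous.aestronglyMeasurable ?_
    have hc : ∀ l, Continuous fun x : Vars v ℝ => contourPoint γ x j l := fun l =>
      (continuous_apply l).comp ((continuous_apply j).comp (continuous_contourPoint hγ1))
    refine continuous_const.mul (continuous_finsetProd _ fun i _ =>
      continuous_finsetProd _ fun l _ => Continuous.div ?_ ?_ fun x h0 => ?_)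
    · have := hc l
      fun_prop
    · have := hc l
      fun_prop
    · have h1 := hX x l i
      rw [← neg_sub, h0, neg_zero, norm_zero] at h1
      linarith
  · rw [norm_mul, norm_prod]
    refine mul_le_mul_of_nonneg_left (Finset.prod_le_prod (fun _ _ => norm_nonneg _)
      fun i _ => ?_) (norm_nonneg _)
    rw [norm_prod]
    exact Finset.prod_le_prod (fun _ _ => norm_nonneg _) fun l _ =>
      norm_one_sub_div_one_sub_le hε (hX x l i)

lemma integrable_nodeIntegrand (hL : L.re < 0) (hγ : Admissible L t v ω b γ)
    (m : Fin (k + 1)) (K : Finset (Fin (v m))) : Integrable fun x : Vars v ℝ =>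
      nodeIntegrand L t v ω b m K (contourPoint γ x) * jacobian γ x := by
  rcases Fin.eq_castSucc_or_eq_last m with ⟨j, rfl⟩ | hm
  · exact integrable_nodeIntegrand_castSucc hL hγ j K
  rcases Fin.eq_zero_or_eq_succ m with h0 | ⟨j, rfl⟩
  · -- there is no gauge node, and the integral is over a point
    obtain rfl : k = 0 := by
      have := congrArg Fin.val (h0.symm.trans hm)
      simpa using this.symm
    have : ∀ i : Fin 0, IsFiniteMeasure
        (volume : Measure (Fin (v i.castSucc) → ℝ)) := fun i => i.elim0
    have : IsFiniteMeasure (volume : Measure (Vars v ℝ)) := by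
      unfold Vars
      rw [volume_pi]
      infer_instance
    exact Integrable.of_finite
  · exact integrable_nodeIntegrand_last hL hγ hm K


lemma eigenvalue_eq_zero (τ : ℂ) (hv : Monotone v) (ω : Fin (k + 1) → ℂ) {m : Fin (k + 1)}
    {r : ℕ} (hr : v m < r) : eigenvalue τ v ω m r = 0 := by
  rw [eigenvalue, Polynomial.coeff_eq_zero_of_natDegree_lt
    ((natDegree_stagePoly_le τ hv ω m).trans_lt hr), mul_zero]

/-- At the first node there is nothing for the Macdonald operator to act on, and it multiplies the
integral by a constant. -/
lemma sum_integral_nodeIntegrand_zero (hL : L.re < 0) (hγ : Admissible L t v ω b γ)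
    (hb : Function.Injective fun i => Complex.exp (b i)) (r : ℕ) :
    ∑ K ∈ Finset.powersetCard r Finset.univ, ∫ x : Vars v ℝ,
        nodeIntegrand L t v ω b 0 K (contourPoint γ x) * jacobian γ x =
      gaussBinom t (v 0) r *
        ∫ x : Vars v ℝ, integrand L t v ω b (contourPoint γ x) * jacobian γ x := by
  have hq : ‖Complex.exp L‖ < 1 := by rw [Complex.norm_exp]; exact Real.exp_lt_one_iff.2 hL
  rw [← integral_finsetSum _ fun K _ => integrable_nodeIntegrand hL hγ 0 K,
    ← integral_const_mul]
  refine integral_congr_ae (Eventually.of_forall fun x => ?_)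
  simp only [nodeIntegrand, ← Finset.sum_mul]
  rw [sum_coefA_mul_mixed_zero hq _ (by simpa only [withFraming_last] using hb),
    integrand_eq_mixed, mul_assoc]

/-- The kernel identity followed by a contour shift moves the Macdonald operator from the node
`j.succ` to the node `j.castSucc`. -/
lemma sum_integral_nodeIntegrand_succ (hL : L.re < 0) (hv : Monotone v)
    (hγ : Admissible L t v ω b γ) (hb : Function.Injective fun i => Complex.exp (b i))
    (j : Fin k) (r : ℕ) :
    ∑ K ∈ Finset.powersetCard r Finset.univ, ∫ x : Vars v ℝ,
        nodeIntegrand L t v ω b j.succ K (contourPoint γ x) * jacobian γ x =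
      ∑ l ∈ Finset.range (r + 1), t ^ ((v j.castSucc - l) * (r - l)) *
        gaussBinom t (v j.succ - v j.castSucc) (r - l) *
        (Complex.exp (ω j.castSucc - ω j.succ) ^ l *
          ∑ K ∈ Finset.powersetCard l Finset.univ, ∫ x : Vars v ℝ,
            nodeIntegrand L t v ω b j.castSucc K (contourPoint γ x) * jacobian γ x) := by
  have hq : ‖Complex.exp L‖ < 1 := by rw [Complex.norm_exp]; exact Real.exp_lt_one_iff.2 hL
  have hadj := fun K => (integral_adjointTerm_shift (t := t) hL hγ j K).1
  have h1 : ∀ l, Complex.exp (ω j.castSucc - ω j.succ) ^ l *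
      ∑ K ∈ Finset.powersetCard l Finset.univ, ∫ x : Vars v ℝ,
        nodeIntegrand L t v ω b j.castSucc K (contourPoint γ x) * jacobian γ x =
      ∫ x : Vars v ℝ, ∑ K ∈ Finset.powersetCard l Finset.univ,
        adjointTerm L t v ω b j K (contourPoint γ x) * jacobian γ x := by
    intro l
    rw [integral_finsetSum _ fun K _ => hadj K, Finset.mul_sum]
    refine Finset.sum_congr rfl fun K hK => ?_
    rw [integral_adjointTerm hL hγ, (Finset.mem_powersetCard.1 hK).2]
  simp only [h1, ← integral_const_mul]
  rw [← integral_finsetSum _ fun K _ => integrable_nodeIntegrand hL hγ j.succ K,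
    ← integral_finsetSum _ fun l _ => (integrable_finsetSum _ fun K _ => hadj K).const_mul _]
  refine integral_congr_ae (Eventually.of_forall fun x => ?_)
  simp only [nodeIntegrand, ← Finset.sum_mul]
  rw [sum_coefA_mul_mixed_succ hq hv _ (by simpa only [withFraming_last] using hb) j ?_ r,
    Finset.sum_mul]
  · refine Finset.sum_congr rfl fun l _ => ?_
    simp only [adjointTerm, integrand_eq_mixed, withFraming_castSucc, mul_assoc]
  · intro i l h
    have h2 := exp_ne_of_poleFree hq (hγ.poleFree_sub j Finset.univ x) (Finset.mem_univ i) l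
    rw [withFraming_castSucc] at h
    exact h2 (exp_sub_eq_one h)

/-- The integral is an eigenfunction of the Macdonald operators in the variables of every node,
acting on the factors of the preceding nodes. -/
theorem sum_integral_nodeIntegrand (hL : L.re < 0) (hv : Monotone v) {τ : ℂ} (hτ : τ ≠ 0)
    (ht : τ ^ 2 = t) (hγ : Admissible L t v ω b γ)
    (hb : Function.Injective fun i => Complex.exp (b i)) (m : Fin (k + 1)) (r : ℕ) :
    Complex.exp (ω m) ^ r * ∑ K ∈ Finset.powersetCard r Finset.univ, ∫ x : Vars v ℝ,
        nodeIntegrand L t v ω b m K (contourPoint γ x) * jacobian γ x =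
      eigenvalue τ v ω m r *
        ∫ x : Vars v ℝ, integrand L t v ω b (contourPoint γ x) * jacobian γ x := by
  induction m using Fin.induction generalizing r with
  | zero =>
    rcases le_or_gt r (v 0) with hr | hr
    · rw [sum_integral_nodeIntegrand_zero hL hγ hb, eigenvalue_zero hτ v ω r hr, ht, mul_assoc]
    · rw [eigenvalue_eq_zero τ hv ω hr, Finset.powersetCard_eq_empty.2 (by simpa using hr),
        Finset.sum_empty, mul_zero, zero_mul]
  | succ j ih =>
    rcases le_or_gt r (v j.succ) with hr | hr
    · rw [sum_integral_nodeIntegrand_succ hL hv hγ hb, eigenvalue_succ hτ hv ω j r hr, ht,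
        Finset.mul_sum, Finset.sum_mul]
      refine Finset.sum_congr rfl fun l hl => ?_
      have hlr : l ≤ r := Nat.lt_succ_iff.1 (Finset.mem_range.1 hl)
      have h1 : Complex.exp (ω j.succ) ^ r =
          Complex.exp (ω j.succ) ^ (r - l) * Complex.exp (ω j.succ) ^ l := by
        rw [← pow_add, Nat.sub_add_cancel hlr]
      have h2 : Complex.exp (ω j.succ) ^ l * Complex.exp (ω j.castSucc - ω j.succ) ^ l =
          Complex.exp (ω j.castSucc) ^ l := by
        rw [← mul_pow, ← Complex.exp_add, add_sub_cancel]
      have h3 := ih l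
      rw [← h2] at h3
      rw [h1]
      linear_combination (t ^ ((v j.castSucc - l) * (r - l)) *
        gaussBinom t (v j.succ - v j.castSucc) (r - l) * Complex.exp (ω j.succ) ^ (r - l)) * h3
    · rw [eigenvalue_eq_zero τ hv ω hr, Finset.powersetCard_eq_empty.2 (by simpa using hr),
        Finset.sum_empty, mul_zero, zero_mul]

lemma exp_sum_shiftSet (hL : L ≠ 0) {d : ℕ} (K : Finset (Fin d)) (y : Fin d → ℂ) (c : ℂ) :
    Complex.exp (c * (∑ i, shiftSet L K y i) / L) =
      Complex.exp c ^ K.card * Complex.exp (c * (∑ i, y i) / L) := by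
  simp only [Finset.mul_sum, Finset.sum_div, Complex.exp_sum]
  exact prod_exp_shiftSet hL K y c

/-- The operator `T_r` acts on `V` under the integral sign. -/
lemma T_V_eq (hL : L ≠ 0) (r : ℕ) : T L t r (V L t v ω γ) b =
    Complex.exp (ω (Fin.last k) * (∑ i, b i) / L) / (2 * Real.pi * Complex.I) *
      (Complex.exp (ω (Fin.last k)) ^ r * ∑ K ∈ Finset.powersetCard r Finset.univ,
        ∫ x : Vars v ℝ, nodeIntegrand L t v ω b (Fin.last k) K (contourPoint γ x) *
          jacobian γ x) := by
  have hsum := Finset.mul_sum (ι := Finset (Fin (v (Fin.last k)))) (R := ℂ)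
  rw [T, hsum, hsum]
  refine Finset.sum_congr rfl fun K hK => ?_
  -- the shifts of `b` turn the integrand into a term of `nodeIntegrand`, and the prefactor
  -- produces a factor `exp ω` for each shifted variable
  have h1 : V L t v ω γ (fun i => if i ∈ K then b i + L else b i) =
      Complex.exp (ω (Fin.last k) * (∑ i, shiftSet L K b i) / L) / (2 * Real.pi * Complex.I) *
        ∫ x : Vars v ℝ, integrand L t v ω (shiftSet L K b) (contourPoint γ x) * jacobian γ x :=
    rfl
  rw [h1, exp_sum_shiftSet hL, (Finset.mem_powersetCard.1 hK).2]
  simp only [nodeIntegrand, mixed_shiftNode_last, withFraming_last, mul_assoc,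
    integral_const_mul]
  rw [coefA]
  ring

end

end TRS

theorem mainTheorem1 (k : ℕ) (v : Fin (k + 1) → ℕ) (hv : Monotone v)
    (L : ℂ) (hL : L.re < 0) (ħ : ℂ) (hħ : ħ ≠ 0) (t : ℂ) (ht : t = Complex.exp L / ħ)
    (τ : ℂ) (hτ : τ ^ 2 = t) (ω : Fin (k + 1) → ℂ)
    (b : Fin (v (Fin.last k)) → ℂ)
    (hb : ∀ i j, i ≠ j → Complex.exp (b i) ≠ Complex.exp (b j))
    (γ : TRS.Vars v (ℝ → ℂ)) (hγ : TRS.Admissible L t v ω b γ)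
    (r : ℕ) (hr : 1 ≤ r) (hrw : r ≤ v (Fin.last k)) :
    TRS.T L t r (TRS.V L t v ω γ) b =
      τ ^ (r * (v (Fin.last k) - r)) * TRS.S τ v (TRS.zetaHat τ v ω) r * TRS.V L t v ω γ b := by
  have hL0 : L ≠ 0 := fun h => by simp [h] at hL
  have hτ0 : τ ≠ 0 := by
    rintro rfl
    have h1 : t ≠ 0 := ht ▸ div_ne_zero (Complex.exp_ne_zero L) hħ
    exact h1 (by rw [← hτ, zero_pow two_ne_zero])
  have hb' : Function.Injective fun i => Complex.exp (b i) := fun i j hij =>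
    not_imp_not.1 (hb i j) hij
  rw [TRS.T_V_eq hL0, TRS.sum_integral_nodeIntegrand hL hv hτ0 hτ hγ hb', TRS.eigenvalue_last]
  change _ = _ * (_ * ∫ x : TRS.Vars v ℝ,
    TRS.integrand L t v ω b (TRS.contourPoint γ x) * TRS.jacobian γ x)
  ring
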